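/- Let $q$ be a prime power and let $G$ be one of the following groups acting naturally on a vector space $V$ of dimension $d$ over $\mathbb F_{q^u}$: $\mathrm{GL}_d(q)$ (type $\mathbf L$, $u=1$), $\mathrm{GU}_d(q)$ (type $\mathbf U$, $u=2$), $\mathrm{Sp}_d(q)$ (type $\mathbf{Sp}$, $u=1$), or $\mathrm{GO}^{\varepsilon}_d(q)$ with $d$ even and $\varepsilon=\pm$ (type $\mathbf O^\varepsilon$, $u=1$); write $\mathbf X$ for the type. An element $g\in\mathrm{GL}(V)$ is an *$e$-stingray element* if $V=U_g\oplus F_g$, where $F_g$ is the fixed point space of $g$ and $U_g$ is a $g$-invariant subspace of dimension $e$ on which $g$ acts irreducibly and non-trivially. A prime $r$ is a *primitive prime divisor* of $N^e-1$ if $r\mid N^e-1$ and $r\nmid N^i-1$ for $1\le i<e$. Let $d=e_1+e_2>8$ with $2\le e_2\le e_1$, and for $i=1,2$ let $r_i$ be a primitive prime divisor of $(q^u)^{e_i}-1$ and $g_i\in G$ an $e_i$-stingray element of order $r_i$. A *stingray duo* in $g_1^G\times g_2^G$ is a pair $(g,g')$ with $g\in g_1^G$, $g'\in g_2^G$ and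 $V=U_g\oplus U_{g'}$. Let $\mathrm{Prob}_2(g_1,g_2,\mathbf X)$ be the proportion, among the stingray duos in $g_1^G\times g_2^G$, of those $(g,g')$ for which $\langle g,g'\rangle$ is irreducible on $V$ and leaves invariant (that is, permutes the summands of) a direct decomposition $V=\bigoplus_{i=1}^b W_i$ with $b\ge 2$ and all $W_i\neq 0$. Then: (a) $\mathrm{Prob}_2(g_1,g_2,\mathbf X)=0$ if any of the following holds: (i) $\mathbf X=\mathbf{Sp}$, or $\mathbf X=\mathbf O^\varepsilon$ with $q$ even; (ii) $q^u=2$, or $r_i>e_i+1$ for some $i$, or $d$ is odd. (b) Otherwise $q^u>2$, $r_i=e_i+1\ge 3$ for each $i$, $d=e_1+e_2$ is even, and \[ \mathrm{Prob}_2(g_1,g_2,\mathbf X)< \begin{cases} 0.5\cdot e_1e_2\cdot q^{-2e_1e_2+e_1+e_2} & \text{if } \mathbf X=\mathbf L,\\ 1.46\cdot e_1e_2\cdot q^{-2e_1e_2+e_1+e_2} & \text{if } \mathbf X=\mathbf U,\\ 4.12\cdot e_1e_2\cdot q^{-e_1e_2+(e_1+e_2)/2} & \text{if } \mathbf X=\mathbf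 O^\varepsilon \text{ (with $q$ odd)}. \end{cases} \] Moreover, let $\mathcal M_2(\mathbf X)$ be empty if one of the conditions in (a) holds, and otherwise the set of the stabilisers in $G$ of the direct decompositions $V=\bigoplus_{i=1}^d W_i$ with $\dim W_i=1$, and with all $W_i$ nondegenerate if $\mathbf X\ne\mathbf L$. Then the duos counted in the numerator of $\mathrm{Prob}_2(g_1,g_2,\mathbf X)$ are exactly the stingray duos $(g,g')\in g_1^G\times g_2^G$ such that $\langle g,g'\rangle$ is irreducible on $V$ and is contained in some $M\in\mathcal M_2(\mathbf X)$; and every direct decomposition with at least two nonzero summands that is left invariant by an irreducible $\langle g,g'\rangle$, where $(g,g')$ is a stingray duo in $g_1^G\times g_2^G$, has exactly $d$ summands, all of dimension $1$, and all nondegenerate if $\mathbf X\neq\mathbf L$. -/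

import Mathlib

/-- The type of a finite classical group: linear, unitary, symplectic, or (even-dimensional)
orthogonal of type `ε = ±1`. -/
inductive ClassicalType where
  | L : ClassicalType
  | U : ClassicalType
  | Sp : ClassicalType
  | O (ε : ℤˣ) : ClassicalType

namespace ClassicalType

/-- The integer `u ∈ {1, 2}` for which the underlying field has `q ^ u` elements. -/
def u : ClassicalType → ℕ
  | L => 1
  | U => 2
  | Sp => 1
  | O _ => 1

end ClassicalType

/-- The form (if any) on `V` that a classical group preserves. In the unitary case `B` is linear in
the first and `σ`-semilinear in the second variable. The laws (hermitian, alternating,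
non-degenerate, of type `ε`) are imposed by `ClassicalForm.IsClassical`. -/
inductive ClassicalForm (F V : Type*) [Field F] [AddCommGroup V] [Module F V] where
  | linear : ClassicalForm F V
  | unitary (σ : F →+* F) (B : V →ₗ[F] V →ₛₗ[σ] F) : ClassicalForm F V
  | symplectic (B : V →ₗ[F] V →ₗ[F] F) : ClassicalForm F V
  | orthogonal (ε : ℤˣ) (Q : QuadraticForm F V) : ClassicalForm F V

section

variable {F V : Type*} [Field F] [AddCommGroup V] [Module F V]

namespace ClassicalForm

/-- The type of the classical group attached to a form. -/
def type : ClassicalForm F V → ClassicalType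
  | linear => .L
  | unitary _ _ => .U
  | symplectic _ => .Sp
  | orthogonal ε _ => .O ε

/-- The subspace `W` is non-degenerate: no nonzero vector of `W` is orthogonal to all of `W` (for a
quadratic form, orthogonality refers to the polar form). There is no condition in the linear
case. -/
def NondegenerateOn : ClassicalForm F V → Submodule F V → Prop
  | linear, _ => True
  | unitary _ B, W => ∀ x ∈ W, (∀ y ∈ W, B x y = 0) → x = 0
  | symplectic B, W => ∀ x ∈ W, (∀ y ∈ W, B x y = 0) → x = 0
  | orthogonal _ Q, W => ∀ x ∈ W, (∀ y ∈ W, QuadraticMap.polar Q x y = 0) → x = 0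

/-- `Φ` is a form defining a classical group over the field with `q ^ u` elements:
* linear: `|F| = q`;
* unitary: `|F| = q ^ 2`, and `B` is a non-degenerate hermitian form with respect to `x ↦ x ^ q`;
* symplectic: `|F| = q`, and `B` is a non-degenerate alternating form;
* orthogonal of type `ε = ±1`: `|F| = q`, `dim V` is even, `Q` is a non-degenerate quadratic form,
  and `Q` has a totally singular subspace of dimension `dim V / 2` precisely when `ε = 1`. -/
def IsClassical (q : ℕ) : ClassicalForm F V → Prop
  | linear => Nat.card F = q
  | unitary σ B =>
      Nat.card F = q ^ 2 ∧ (∀ a : F, σ a = a ^ q) ∧ (∀ x y : V, B x y = σ (B y x)) ∧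
        (unitary σ B).NondegenerateOn ⊤
  | symplectic B =>
      Nat.card F = q ∧ (∀ x : V, B x x = 0) ∧ (symplectic B).NondegenerateOn ⊤
  | orthogonal ε Q =>
      Nat.card F = q ∧ Even (Module.finrank F V) ∧ (orthogonal ε Q).NondegenerateOn ⊤ ∧
        (ε = 1 ↔ ∃ W : Submodule F V,
          2 * Module.finrank F W = Module.finrank F V ∧ ∀ x ∈ W, Q x = 0)

/-- The linear automorphism `g` preserves the form. -/
def IsIsometry : ClassicalForm F V → (V ≃ₗ[F] V) → Prop
  | linear, _ => True
  | unitary _ B, g => ∀ x y, B (g x) (g y) = B x y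
  | symplectic B, g => ∀ x y, B (g x) (g y) = B x y
  | orthogonal _ Q, g => ∀ x, Q (g x) = Q x

/-- The full isometry group of the form: the general linear, general unitary, symplectic or general
orthogonal group. -/
def isometryGroup (Φ : ClassicalForm F V) : Subgroup (V ≃ₗ[F] V) where
  carrier := {g | Φ.IsIsometry g}
  mul_mem' := by
    intro a b ha hb
    cases Φ <;> simp_all [IsIsometry]
  one_mem' := by
    cases Φ <;> simp [IsIsometry]
  inv_mem' := by
    intro a ha
    have h : ∀ x, a (a⁻¹ x) = x := fun x => a.apply_symm_apply x
    cases Φ with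
    | linear => trivial
    | unitary σ B =>
      intro x y
      have := ha (a⁻¹ x) (a⁻¹ y)
      rw [h, h] at this
      exact this.symm
    | symplectic B =>
      intro x y
      have := ha (a⁻¹ x) (a⁻¹ y)
      rw [h, h] at this
      exact this.symm
    | orthogonal ε Q =>
      intro x
      have := ha (a⁻¹ x)
      rw [h] at this
      exact this.symm

end ClassicalForm

/-- `r` is a primitive prime divisor of `N ^ e - 1`. -/
def IsPrimitivePrimeDivisor (r N e : ℕ) : Prop :=
  r.Prime ∧ r ∣ N ^ e - 1 ∧ ∀ i : ℕ, 1 ≤ i → i < e → ¬ r ∣ N ^ i - 1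

/-- The fixed point subspace of `g`. -/
def fixedSpace (g : V ≃ₗ[F] V) : Submodule F V :=
  LinearMap.eqLocus (g : V →ₗ[F] V) LinearMap.id

/-- `g` is an `e`-stingray element with associated subspace `U`: `V` is the direct sum of the
`e`-dimensional `g`-invariant subspace `U` and of the fixed point subspace of `g`, and `g` acts
irreducibly and non-trivially on `U`. -/
structure IsStingrayOn (e : ℕ) (g : V ≃ₗ[F] V) (U : Submodule F V) : Prop where
  isCompl : IsCompl U (fixedSpace g)
  invariant : ∀ x ∈ U, g x ∈ U
  finrank_eq : Module.finrank F U = e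
  nontrivial : ∃ x ∈ U, g x ≠ x
  irreducible : ∀ W : Submodule F V, W ≤ U → (∀ x ∈ W, g x ∈ W) → W = ⊥ ∨ W = U

/-- `g` is an `e`-stingray element. -/
def IsStingray (e : ℕ) (g : V ≃ₗ[F] V) : Prop :=
  ∃ U : Submodule F V, IsStingrayOn e g U

/-- `(g, g')` is an `(e₁, e₂)`-stingray duo on `V`. -/
def IsStingrayDuo (e₁ e₂ : ℕ) (g g' : V ≃ₗ[F] V) : Prop :=
  e₂ ≤ e₁ ∧ e₁ + e₂ = Module.finrank F V ∧
    ∃ U U' : Submodule F V, IsStingrayOn e₁ g U ∧ IsStingrayOn e₂ g' U' ∧ U ⊔ U' = ⊤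

/-- The conjugacy class `g ^ G` of `g` under the subgroup `G`. -/
def conjClass (G : Subgroup (V ≃ₗ[F] V)) (g : V ≃ₗ[F] V) : Set (V ≃ₗ[F] V) :=
  {h | ∃ x ∈ G, h = x * g * x⁻¹}

/-- The subgroup `H` acts irreducibly on `V`. -/
def ActsIrreducibly (H : Subgroup (V ≃ₗ[F] V)) : Prop :=
  ∀ W : Submodule F V, (∀ h ∈ H, ∀ x ∈ W, h x ∈ W) → W = ⊥ ∨ W = ⊤

/-- `V = W 0 ⊕ ⋯ ⊕ W (b - 1)` is a direct decomposition into nonzero summands. -/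
def IsDirectDecomposition {b : ℕ} (W : Fin b → Submodule F V) : Prop :=
  DirectSum.IsInternal W ∧ ∀ i, W i ≠ ⊥

/-- The group of all linear automorphisms of `V` that permute the subspaces `W i`. -/
def decompositionStabilizer {b : ℕ} (W : Fin b → Submodule F V) : Subgroup (V ≃ₗ[F] V) where
  carrier := {g | ∃ s : Equiv.Perm (Fin b), ∀ i, (W i).map (g : V →ₗ[F] V) = W (s i)}
  mul_mem' := by
    rintro a c ⟨s, hs⟩ ⟨t, ht⟩
    refine ⟨s * t, fun i => ?_⟩
    have : ((a * c : V ≃ₗ[F] V) : V →ₗ[F] V) = (a : V →ₗ[F] V) ∘ₗ (c : V →ₗ[F] V) := rfl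
    rw [this, Submodule.map_comp, ht, hs]
    rfl
  one_mem' := ⟨1, fun i => Submodule.map_id _⟩
  inv_mem' := by
    rintro a ⟨s, hs⟩
    refine ⟨s⁻¹, fun i => ?_⟩
    have h := hs (s⁻¹ i)
    have h1 : s (s⁻¹ i) = i := s.apply_symm_apply i
    rw [h1] at h
    have h2 : ((a⁻¹ : V ≃ₗ[F] V) : V →ₗ[F] V) ∘ₗ (a : V →ₗ[F] V) = LinearMap.id := by
      ext x
      exact a.symm_apply_apply x
    rw [← h, ← Submodule.map_comp, h2, Submodule.map_id]

/-- The subgroup `H` leaves invariant some direct decomposition of `V` with at least two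
summands. -/
def PreservesDecomposition (H : Subgroup (V ≃ₗ[F] V)) : Prop :=
  ∃ (b : ℕ) (W : Fin b → Submodule F V),
    2 ≤ b ∧ IsDirectDecomposition W ∧ H ≤ decompositionStabilizer W

/-- The `(e₁, e₂)`-stingray duos in `g₁ ^ G × g₂ ^ G`. -/
def stingrayDuos (G : Subgroup (V ≃ₗ[F] V)) (e₁ e₂ : ℕ) (g₁ g₂ : V ≃ₗ[F] V) :
    Set ((V ≃ₗ[F] V) × (V ≃ₗ[F] V)) :=
  {p | p.1 ∈ conjClass G g₁ ∧ p.2 ∈ conjClass G g₂ ∧ IsStingrayDuo e₁ e₂ p.1 p.2}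

/-- The stingray duos in `g₁ ^ G × g₂ ^ G` that generate an irreducible group. -/
def irreducibleDuos (G : Subgroup (V ≃ₗ[F] V)) (e₁ e₂ : ℕ) (g₁ g₂ : V ≃ₗ[F] V) :
    Set ((V ≃ₗ[F] V) × (V ≃ₗ[F] V)) :=
  {p ∈ stingrayDuos G e₁ e₂ g₁ g₂ | ActsIrreducibly (Subgroup.closure {p.1, p.2})}

/-- The stingray duos in `g₁ ^ G × g₂ ^ G` that generate an irreducible group leaving invariant a
direct decomposition with at least two summands. -/
def imprimitiveDuos (G : Subgroup (V ≃ₗ[F] V)) (e₁ e₂ : ℕ) (g₁ g₂ : V ≃ₗ[F] V) :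
    Set ((V ≃ₗ[F] V) × (V ≃ₗ[F] V)) :=
  {p ∈ irreducibleDuos G e₁ e₂ g₁ g₂ | PreservesDecomposition (Subgroup.closure {p.1, p.2})}

/-- The proportion, among all stingray duos in `g₁ ^ G × g₂ ^ G`, of those that generate an
irreducible group leaving invariant a direct decomposition with at least two summands. -/
noncomputable def prob₂ (G : Subgroup (V ≃ₗ[F] V)) (e₁ e₂ : ℕ) (g₁ g₂ : V ≃ₗ[F] V) : ℝ :=
  ((imprimitiveDuos G e₁ e₂ g₁ g₂).ncard : ℝ) / ((stingrayDuos G e₁ e₂ g₁ g₂).ncard : ℝ)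

/-- The conditions under which no irreducible stingray duo is imprimitive. -/
def ImprimitiveExcluded (X : ClassicalType) (q e₁ e₂ r₁ r₂ : ℕ) : Prop :=
  (X = .Sp ∨ ((∃ ε : ℤˣ, X = .O ε) ∧ Even q)) ∨
    (q ^ X.u = 2 ∨ (r₁ > e₁ + 1 ∨ r₂ > e₂ + 1) ∨ Odd (e₁ + e₂))

/-- The family of subgroups that is empty if one of the conditions `ImprimitiveExcluded` holds, and
consists otherwise of the stabilisers in the isometry group `G` of the direct decompositions of `V`
into `dim V` one-dimensional subspaces, non-degenerate unless the type is linear. -/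
def imprimitiveSubgroups (Φ : ClassicalForm F V) (q e₁ e₂ r₁ r₂ : ℕ) :
    Set (Subgroup (V ≃ₗ[F] V)) :=
  {M | ¬ ImprimitiveExcluded Φ.type q e₁ e₂ r₁ r₂ ∧
    ∃ W : Fin (Module.finrank F V) → Submodule F V,
      IsDirectDecomposition W ∧ (∀ i, Module.finrank F (W i) = 1) ∧
      (∀ i, Φ.NondegenerateOn (W i)) ∧ M = Φ.isometryGroup ⊓ decompositionStabilizer W}

end

/-! ### Primitive prime divisors -/

section PrimitivePrimeDivisors

/-! Let `(g, g')` be an irreducible stingray duo that preserves a decomposition. Each generator has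
prime order `r ≥ e + 1`. If it moves a block `W`, then `W` lies in a cycle of `r` blocks, and `g -
1`, whose image is in `U`, is injective on the sum of `r - 1` of them. So `(r - 1) * dim W ≤ e`,
which forces `r = e + 1` and `dim W = 1`; by equality of dimensions `g` fixes the blocks off the
cycle pointwise (`IsStingrayOn.block_cycle`). Irreducibility makes both generators move blocks, and
their cycles, of lengths `e₁ + 1` and `e₂ + 1`, cover all `e₁ + e₂` lines. Hence the cycles share
exactly two lines (`exists_marked`).

Take `w` on one shared line. On the other, `g' ^ k' w = c • g ^ k w`. The vectors `g ^ i w` and the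
remaining `g' ^ j w` form a basis, and `(k, k', c)` determines the duo up to conjugation in `GL(V)`
(`IsMarked.exists_conj`). Here `c ≠ 1`, since otherwise the sum of the coordinates would be an
invariant functional; so `|F| > 2`. If a form is preserved, `c ≠ 1` makes the basis orthogonal
(`IsMarked.orthogonal`), so the lines are nondegenerate and the bilinear form is not alternating. In
the unitary type `q ^ 2` is a square, hence not a primitive root modulo `r`, and `r = e + 1` never
happens: that type is always excluded.

The bounds compare two counts with `|G|`. A duo has at least `2 (|F| - 1)` marked vectors, those on
its two shared lines, and `G` is transitive on the marked duos with given `k`, `k'` and given `c`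
(linear type) or `Q w` (orthogonal type, where `c = -1`). So there are at most `|G| e₁ e₂ / 2`
imprimitive duos (`two_mul_card_le_of_marked`). From below, stingray duos are obtained by
conjugating `g₁` by `x` and `g₂` by `x y`, with `x` in `G` and `y` in a family of representatives;
the overcount is bounded by the restrictions to `U₁` and `U₂` of the centralizers
(`card_mul_card_le_card_stingrayDuos`).

In the linear type there are `q ^ (2 e₁ e₂)` representatives and at most `q ^ e - 1` restrictions.
In the orthogonal type the restrictions satisfy a norm-one equation, so there are at most `q ^ (e /
2) + 1`. By Witt's theorem the representatives correspond to linear maps `α : U₂ → U₁` for which `Q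
- Q ∘ α` is isometric to the form on the fixed space of `g₁`. They are counted by extending `α` from
a hyperplane: few `α` give a degenerate form there, about half of all values are admissible for the
extension, and a Gauss sum shows that each value is taken about equally often. -/

theorem IsPrimitivePrimeDivisor.not_dvd_base {r N e : ℕ} (h : IsPrimitivePrimeDivisor r N e)
    (hN : 1 ≤ N) (he : 1 ≤ e) : ¬ r ∣ N := by
  intro hd
  have h1 : r ∣ N ^ e := dvd_pow hd (by omega)
  have h2 : r ∣ 1 := by
    have h3 := Nat.dvd_sub h1 h.2.1
    have : 1 ≤ N ^ e := Nat.one_le_pow _ _ hN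
    rwa [Nat.sub_sub_self this] at h3
  exact h.1.one_lt.ne' (Nat.dvd_one.1 h2)

theorem Nat.Prime.dvd_pow_pred_sub_one {r N : ℕ} (hr : r.Prime) (h : ¬ r ∣ N) :
    r ∣ N ^ (r - 1) - 1 := by
  have hN : 1 ≤ N := Nat.one_le_iff_ne_zero.2 (by rintro rfl; exact h (dvd_zero _))
  have hc : Nat.Coprime N r := ((Nat.Prime.coprime_iff_not_dvd hr).2 h).symm
  have := Nat.ModEq.pow_totient hc
  rw [Nat.totient_prime hr] at this
  exact (Nat.modEq_iff_dvd' (Nat.one_le_pow _ _ hN)).1 this.symm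

/-- By Fermat, `r` divides `N ^ (r - 1) - 1`, and primitivity excludes exponents below `e`. -/
theorem IsPrimitivePrimeDivisor.succ_le {r N e : ℕ} (h : IsPrimitivePrimeDivisor r N e)
    (hN : 1 ≤ N) (he : 1 ≤ e) : e + 1 ≤ r := by
  by_contra hlt
  have h2 := h.1.two_le
  exact h.2.2 (r - 1) (by omega) (by omega)
    (h.1.dvd_pow_pred_sub_one (h.not_dvd_base hN he))

/-- A square is not a primitive root modulo an odd prime. -/
theorem IsPrimitivePrimeDivisor.ne_succ_of_sq {r q e : ℕ} (h : IsPrimitivePrimeDivisor r (q ^ 2) e)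
    (hq : 1 ≤ q) (he : 2 ≤ e) : r ≠ e + 1 := by
  intro hr
  have hnd := h.not_dvd_base (Nat.one_le_pow _ _ hq) (by omega)
  have hnd' : ¬ r ∣ q := fun hd => hnd (dvd_pow hd two_ne_zero)
  have h1 := h.1.dvd_pow_pred_sub_one hnd'
  have hodd : Odd r := h.1.odd_of_ne_two (by omega)
  obtain ⟨m, hm⟩ := hodd
  -- With `r = 2 m + 1`, Fermat's theorem for `q` says that `r` divides `(q ^ 2) ^ m - 1`, although
  -- `m < e`.
  apply h.2.2 m (by omega) (by omega)
  rw [← pow_mul]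
  convert h1 using 3
  omega

/-- Of the two factors of `q ^ (2 m) - 1`, primitivity excludes `q ^ m - 1`. This feeds the bound
for centralizers in orthogonal groups. -/
theorem IsPrimitivePrimeDivisor.dvd_pow_half_add_one {r q m : ℕ}
    (h : IsPrimitivePrimeDivisor r q (2 * m)) (hm : 1 ≤ m) : r ∣ q ^ m + 1 := by
  have h1 : q ^ (2 * m) - 1 = (q ^ m + 1) * (q ^ m - 1) := by
    rw [two_mul, pow_add, ← Nat.mul_self_sub_mul_self_eq]
  have h2 := h.2.1
  rw [h1] at h2
  exact (h.1.dvd_mul.1 h2).resolve_right (h.2.2 m hm (by omega))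

theorem IsPrimitivePrimeDivisor.even_of_eq_succ {r N e : ℕ} (h : IsPrimitivePrimeDivisor r N e)
    (he : 2 ≤ e) (hr : r = e + 1) : Even e := by
  have hodd : Odd r := h.1.odd_of_ne_two (by omega)
  obtain ⟨m, hm⟩ := hodd
  exact ⟨m, by omega⟩

end PrimitivePrimeDivisors

/-! ### Stingray elements -/

section Stingray

variable {F V : Type*} [Field F] [AddCommGroup V] [Module F V]

theorem mem_fixedSpace {g : V ≃ₗ[F] V} {x : V} : x ∈ fixedSpace g ↔ g x = x := Iff.rfl

theorem IsStingrayOn.sub_mem {e : ℕ} {g : V ≃ₗ[F] V} {U : Submodule F V}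
    (h : IsStingrayOn e g U) (x : V) : g x - x ∈ U := by
  have hx : x ∈ U ⊔ fixedSpace g := by rw [h.isCompl.sup_eq_top]; trivial
  obtain ⟨u, hu, f, hf, rfl⟩ := Submodule.mem_sup.1 hx
  rw [mem_fixedSpace] at hf
  have : g (u + f) - (u + f) = g u - u := by rw [map_add, hf]; abel
  rw [this]
  exact U.sub_mem (h.invariant u hu) hu

theorem IsStingrayOn.conj {e : ℕ} {g : V ≃ₗ[F] V} {U : Submodule F V}
    (h : IsStingrayOn e g U) (x : V ≃ₗ[F] V) :
    IsStingrayOn e (x * g * x⁻¹) (U.map (x : V →ₗ[F] V)) := by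
  have hx : ∀ v, x⁻¹ (x v) = v := fun v => x.symm_apply_apply v
  have hx' : ∀ v, x (x⁻¹ v) = v := fun v => x.apply_symm_apply v
  have hfix : fixedSpace (x * g * x⁻¹) = (fixedSpace g).map (x : V →ₗ[F] V) := by
    ext v
    simp only [mem_fixedSpace, Submodule.mem_map, LinearEquiv.mul_apply, LinearEquiv.coe_coe]
    constructor
    · intro hv
      refine ⟨x⁻¹ v, ?_, hx' v⟩
      have := congrArg (fun v => (x⁻¹ : V ≃ₗ[F] V) v) hv
      simp only [hx] at this
      exact this
    · rintro ⟨u, hu, rfl⟩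
      rw [hx, hu]
  refine ⟨?_, ?_, ?_, ?_, ?_⟩
  · rw [hfix]
    exact h.isCompl.map (Submodule.orderIsoMapComap x)
  · rintro _ ⟨u, hu, rfl⟩
    refine ⟨g u, h.invariant u hu, ?_⟩
    simp [hx, LinearEquiv.mul_apply]
  · rw [← h.finrank_eq]
    exact LinearEquiv.finrank_map_eq x U
  · obtain ⟨u, hu, hne⟩ := h.nontrivial
    refine ⟨x u, ⟨u, hu, rfl⟩, ?_⟩
    rw [LinearEquiv.mul_apply, LinearEquiv.mul_apply, hx]
    exact fun h => hne (x.injective h)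
  · intro W hWU hW
    have := h.irreducible (W.comap (x : V →ₗ[F] V)) ?_ ?_
    · rcases this with h0 | h0
      · left
        rw [← Submodule.map_comap_eq_of_surjective x.surjective W]
        exact (congrArg (Submodule.map (x : V →ₗ[F] V)) h0).trans (Submodule.map_bot _)
      · right
        rw [← Submodule.map_comap_eq_of_surjective x.surjective W]
        exact congrArg (Submodule.map (x : V →ₗ[F] V)) h0
    · intro v hv
      obtain ⟨u, hu, huv⟩ := hWU hv
      rwa [← x.injective huv]
    · intro v hv
      have := hW (x v) hv
      rw [LinearEquiv.mul_apply, LinearEquiv.mul_apply, hx] at this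
      exact this

theorem orderOf_conj_eq {G : Type*} [Group G] (x g : G) : orderOf (x * g * x⁻¹) = orderOf g := by
  simpa using orderOf_injective (MulAut.conj x).toMonoidHom (MulAut.conj x).injective g

end Stingray

/-! ### Stingray elements acting on the blocks of a decomposition -/

section Blocks

variable {F V : Type*} [Field F] [AddCommGroup V] [Module F V]

/-- The projections belonging to a direct decomposition. -/
theorem exists_projections {b : ℕ} {W : Fin b → Submodule F V} (hW : DirectSum.IsInternal W) :
    ∃ π : Fin b → V →ₗ[F] V, (∀ i x, π i x ∈ W i) ∧ (∀ x, ∑ i, π i x = x) ∧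
      (∀ i, ∀ x ∈ W i, π i x = x) ∧ (∀ i j, i ≠ j → ∀ x ∈ W j, π i x = 0) := by
  classical
  let E : (DirectSum (Fin b) fun i => W i) ≃ₗ[F] V :=
    LinearEquiv.ofBijective (DirectSum.coeLinearMap W) hW
  have hE : ∀ i, ∀ x : W i, E.symm (x : V) = DirectSum.lof F (Fin b) (fun i => W i) i x := by
    intro i x
    rw [LinearEquiv.symm_apply_eq]
    exact (DirectSum.coeLinearMap_lof W i x).symm
  refine ⟨fun i => (W i).subtype ∘ₗ DirectSum.component F (Fin b) (fun i => W i) i ∘ₗ E.symm,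
    fun i x => Subtype.property _, fun x => ?_, fun i x hx => ?_, fun i j hij x hx => ?_⟩
  · have h1 : E (E.symm x) = x := E.apply_symm_apply x
    conv_rhs => rw [← h1]
    change _ = DirectSum.coeLinearMap W _
    rw [DirectSum.coeLinearMap_eq_dfinsuppSum, DFinsupp.sum_eq_sum_fintype]
    · rfl
    · simp
  · have := hE i ⟨x, hx⟩
    simp only [LinearMap.comp_apply, LinearEquiv.coe_coe]
    rw [this, DirectSum.component.lof_self]
    rfl
  · have := hE j ⟨x, hx⟩
    simp only [LinearMap.comp_apply, LinearEquiv.coe_coe]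
    rw [this, DirectSum.component.of, dif_neg (fun h => hij h.symm)]
    rfl

theorem projection_equivariant {b : ℕ} {W : Fin b → Submodule F V} {π : Fin b → V →ₗ[F] V}
    (h1 : ∀ i x, π i x ∈ W i) (h2 : ∀ x, ∑ i, π i x = x) (h3 : ∀ i, ∀ x ∈ W i, π i x = x)
    (h4 : ∀ i j, i ≠ j → ∀ x ∈ W j, π i x = 0) {g : V ≃ₗ[F] V} {s : Equiv.Perm (Fin b)}
    (hs : ∀ i, (W i).map (g : V →ₗ[F] V) = W (s i)) (i : Fin b) (x : V) :
    π (s i) (g x) = g (π i x) := by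
  have hmem : ∀ j, g (π j x) ∈ W (s j) := fun j => by
    rw [← hs j]; exact ⟨_, h1 j x, rfl⟩
  conv_lhs => rw [← h2 x, map_sum, map_sum]
  rw [Finset.sum_eq_single i]
  · exact h3 _ _ (hmem i)
  · intro j _ hj
    exact h4 _ _ (fun h => hj (s.injective h).symm) _ (hmem j)
  · simp

theorem map_pow_block {b : ℕ} {W : Fin b → Submodule F V} {g : V ≃ₗ[F] V}
    {s : Equiv.Perm (Fin b)} (hs : ∀ i, (W i).map (g : V →ₗ[F] V) = W (s i)) (n : ℕ) (i : Fin b) :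
    (W i).map ((g ^ n : V ≃ₗ[F] V) : V →ₗ[F] V) = W ((s ^ n) i) := by
  induction n with
  | zero => exact Submodule.map_id _
  | succ n ih =>
    have : ((g ^ (n + 1) : V ≃ₗ[F] V) : V →ₗ[F] V)
        = (g : V →ₗ[F] V) ∘ₗ ((g ^ n : V ≃ₗ[F] V) : V →ₗ[F] V) := by
      ext x; rw [pow_succ']; rfl
    rw [this, Submodule.map_comp, ih, hs, pow_succ']
    rfl

theorem IsDirectDecomposition.injective {b : ℕ} {W : Fin b → Submodule F V}
    (hW : IsDirectDecomposition W) : Function.Injective W := by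
  classical
  intro i j hij
  by_contra hne
  have := hW.1.submodule_iSupIndep.pairwiseDisjoint hne
  rw [Function.onFun, hij, disjoint_self] at this
  exact hW.2 j this

theorem block_perm_pow_eq_one {b : ℕ} {W : Fin b → Submodule F V} (hW : IsDirectDecomposition W)
    {g : V ≃ₗ[F] V} {s : Equiv.Perm (Fin b)} (hs : ∀ i, (W i).map (g : V →ₗ[F] V) = W (s i))
    {n : ℕ} (hn : g ^ n = 1) : s ^ n = 1 := by
  ext1 i
  have := map_pow_block hs n i
  rw [hn] at this
  exact hW.injective (this.symm.trans (Submodule.map_id _))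

theorem block_minimalPeriod {b : ℕ} {W : Fin b → Submodule F V} (hW : IsDirectDecomposition W)
    {g : V ≃ₗ[F] V} {s : Equiv.Perm (Fin b)} (hs : ∀ i, (W i).map (g : V →ₗ[F] V) = W (s i))
    {r : ℕ} (hr : r.Prime) (ho : orderOf g = r) {i₀ : Fin b} (hi₀ : s i₀ ≠ i₀) :
    Function.minimalPeriod s i₀ = r := by
  have : Fact r.Prime := ⟨hr⟩
  refine Function.minimalPeriod_eq_prime ?_ hi₀
  have := block_perm_pow_eq_one hW hs (n := r) (by rw [← ho]; exact pow_orderOf_eq_one g)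
  rw [Function.IsPeriodicPt, Function.IsFixedPt, Equiv.Perm.iterate_eq_pow, this]
  rfl

theorem pow_apply_eq_iff_of_minimalPeriod {α : Type*} {s : Equiv.Perm α} {a : α} {r : ℕ}
    (h : Function.minimalPeriod s a = r) {m n : ℕ} (hm : m < r) (hn : n < r) :
    (s ^ m) a = (s ^ n) a ↔ m = n := by
  rw [← Equiv.Perm.iterate_eq_pow, ← Equiv.Perm.iterate_eq_pow]
  exact Function.iterate_eq_iterate_iff_of_lt_minimalPeriod (h ▸ hm) (h ▸ hn)

/-- If a stingray element of prime order `r > e` moves a block, then it acts as an `r`-cycle on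
one-dimensional blocks, and fixes the remaining blocks pointwise. -/
theorem IsStingrayOn.block_cycle [FiniteDimensional F V] {e r b : ℕ} {g : V ≃ₗ[F] V}
    {U : Submodule F V} (hg : IsStingrayOn e g U) (hr : r.Prime) (ho : orderOf g = r)
    (her : e + 1 ≤ r) {W : Fin b → Submodule F V} (hW : IsDirectDecomposition W)
    {s : Equiv.Perm (Fin b)} (hs : ∀ i, (W i).map (g : V →ₗ[F] V) = W (s i))
    {i₀ : Fin b} (hi₀ : s i₀ ≠ i₀) :
    r = e + 1 ∧ (∀ n : ℕ, Module.finrank F (W ((s ^ n) i₀)) = 1) ∧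
      ∀ j, (∀ n : ℕ, (s ^ n) i₀ ≠ j) → ∀ v ∈ W j, g v = v := by
  classical
  obtain ⟨π, h1, h2, h3, h4⟩ := exists_projections hW.1
  have hper := block_minimalPeriod hW hs hr ho hi₀
  have heqv := projection_equivariant h1 h2 h3 h4 hs
  have heqvn : ∀ (n : ℕ) (x : V), π ((s ^ n) i₀) ((g ^ n) x) = (g ^ n) (π i₀ x) := fun n x =>
    projection_equivariant h1 h2 h3 h4 (map_pow_block hs n) i₀ x
  have hgn : ∀ (n : ℕ) (z : V), g z = z → (g ^ n) z = z := by
    intro n z hz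
    induction n with
    | zero => rfl
    | succ n ih => rw [pow_succ, LinearEquiv.mul_apply, hz, ih]
  -- the fixed vectors with trivial component at `i₀` have trivial components on the orbit
  have hfix : ∀ z, g z = z → π i₀ z = 0 → ∀ n : ℕ, π ((s ^ n) i₀) z = 0 := by
    intro z hz h0 n
    have := heqvn n z
    rwa [hgn n z hz, h0, map_zero] at this
  -- The block `W i₀` is left out on purpose. On the cycle a fixed vector is determined by its
  -- component at `i₀`, so a sum over the other `r - 1` blocks that is fixed by `g` vanishes, and `g
  -- - 1` is injective there.
  let Y : (Fin (r - 1) → W i₀) →ₗ[F] V :=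
    ∑ t : Fin (r - 1), ((g ^ (t.val + 1) : V ≃ₗ[F] V) : V →ₗ[F] V) ∘ₗ (W i₀).subtype ∘ₗ
      LinearMap.proj t
  have hY : ∀ x, Y x = ∑ t : Fin (r - 1), (g ^ (t.val + 1)) (x t : V) := by
    intro x; simp [Y]
  have hmemW : ∀ (n : ℕ) (x : W i₀), (g ^ n) (x : V) ∈ W ((s ^ n) i₀) := by
    intro n x
    rw [← map_pow_block hs n i₀]
    exact ⟨x, x.2, rfl⟩
  have hr2 := hr.two_le
  have hYcomp : ∀ x (t : Fin (r - 1)), π ((s ^ (t.val + 1)) i₀) (Y x) = (g ^ (t.val + 1)) (x t : V) := by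
    intro x t
    rw [hY, map_sum, Finset.sum_eq_single t]
    · exact h3 _ _ (hmemW _ _)
    · intro t' _ hne
      refine h4 _ _ (fun h => hne ?_) _ (hmemW _ _)
      have := (pow_apply_eq_iff_of_minimalPeriod hper (m := t.val + 1) (n := t'.val + 1)
        (by omega) (by omega)).1 h
      exact Fin.ext (by omega)
    · simp
  have hY0 : ∀ x, π i₀ (Y x) = 0 := by
    intro x
    rw [hY, map_sum]
    refine Finset.sum_eq_zero fun t _ => h4 _ _ (fun h => ?_) _ (hmemW _ _)
    have := (pow_apply_eq_iff_of_minimalPeriod hper (m := 0) (n := t.val + 1)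
        (by omega) (by omega)).1 h
    omega
  have hYfix : ∀ x, (∀ n : ℕ, π ((s ^ n) i₀) (Y x) = 0) → x = 0 := by
    intro x hx
    funext t
    have := hYcomp x t
    rw [hx] at this
    have h0 : (x t : V) = 0 := (LinearEquiv.map_eq_zero_iff _).1 this.symm
    exact Subtype.ext h0
  let T : (Fin (r - 1) → W i₀) →ₗ[F] U :=
    LinearMap.codRestrict U (((g : V →ₗ[F] V) - LinearMap.id) ∘ₗ Y) (fun x => hg.sub_mem (Y x))
  have hTinj : Function.Injective T := by
    rw [← LinearMap.ker_eq_bot, LinearMap.ker_eq_bot']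
    intro x hx
    have hx' : g (Y x) - Y x = 0 := congrArg Subtype.val hx
    exact hYfix x (hfix _ (sub_eq_zero.1 hx') (hY0 x))
  have hdim := LinearMap.finrank_le_finrank_of_injective hTinj
  rw [Module.finrank_pi_fintype, hg.finrank_eq] at hdim
  simp only [Finset.sum_const, Finset.card_univ, Fintype.card_fin, smul_eq_mul] at hdim
  have hpos : 1 ≤ Module.finrank F (W i₀) := by
    rw [Nat.one_le_iff_ne_zero, Ne, Submodule.finrank_eq_zero]
    exact hW.2 i₀
  -- From `(r - 1) * dim (W i₀) ≤ e`, `1 ≤ dim (W i₀)` and `e ≤ r - 1`, both equalities follow.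
  have hre : r = e + 1 := by nlinarith [Nat.sub_add_cancel (show 1 ≤ r by omega)]
  have hm1 : Module.finrank F (W i₀) = 1 := by
    subst hre
    simp only [Nat.add_sub_cancel] at hdim
    have he : 0 < e := by omega
    nlinarith
  -- Now `T` is onto `U`. For `v` off the cycle some `Y x` has the same image under `g - 1`, so `v -
  -- Y x` is fixed with zero component at `i₀`; hence `x = 0` and `v` itself is fixed.
  have hTsurj : Function.Surjective T := by
    refine (LinearMap.injective_iff_surjective_of_finrank_eq_finrank ?_).1 hTinj
    rw [Module.finrank_pi_fintype, hg.finrank_eq]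
    simp only [Finset.sum_const, Finset.card_univ, Fintype.card_fin, smul_eq_mul, hm1]
    omega
  refine ⟨hre, fun n => ?_, fun j hj v hv => ?_⟩
  · rw [← map_pow_block hs n i₀, ← hm1]
    exact LinearEquiv.finrank_map_eq (g ^ n) (W i₀)
  · obtain ⟨x, hx⟩ := hTsurj ⟨g v - v, hg.sub_mem v⟩
    have hx' : g (Y x) - Y x = g v - v := congrArg Subtype.val hx
    have hz : g (v - Y x) = v - Y x := by
      rw [map_sub, sub_eq_sub_iff_sub_eq_sub]
      exact hx'.symm
    have hv0 : ∀ n : ℕ, π ((s ^ n) i₀) v = 0 := fun n => h4 _ _ (hj n) _ hv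
    have h0 := hfix _ hz (by
      have := hv0 0
      rw [pow_zero, Equiv.Perm.one_apply] at this
      rw [map_sub, hY0, this, sub_zero])
    have hx0 : x = 0 := hYfix x fun n => by
      have := h0 n
      rw [map_sub, hv0, zero_sub, neg_eq_zero] at this
      exact this
    rw [hx0, map_zero, sub_zero] at hz
    exact hz

/-- If a stingray element fixes all blocks, then one of them contains `U`. -/
theorem IsStingrayOn.le_block {e b : ℕ} {g : V ≃ₗ[F] V} {U : Submodule F V}
    (hg : IsStingrayOn e g U) {W : Fin b → Submodule F V} (hW : IsDirectDecomposition W)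
    (hs : ∀ i, (W i).map (g : V →ₗ[F] V) = W i) : ∃ i, U ≤ W i := by
  classical
  by_contra! hno
  obtain ⟨π, h1, h2, -, -⟩ := exists_projections hW.1
  -- The invariant space `W i ⊓ U` is zero unless `U ≤ W i`, and it contains `g v - v`.
  have hfix : ∀ i, ∀ v ∈ W i, g v = v := by
    intro i v hv
    have hinv : ∀ x ∈ W i, g x ∈ W i := fun x hx => by
      rw [← hs i]; exact ⟨x, hx, rfl⟩
    rcases hg.irreducible (W i ⊓ U) inf_le_right
      (fun x hx => ⟨hinv x hx.1, hg.invariant x hx.2⟩) with h | h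
    · have : g v - v ∈ W i ⊓ U := ⟨(W i).sub_mem (hinv v hv) hv, hg.sub_mem v⟩
      rw [h, Submodule.mem_bot] at this
      exact sub_eq_zero.1 this
    · exact absurd (h ▸ inf_le_left) (hno i)
  obtain ⟨x, -, hx⟩ := hg.nontrivial
  apply hx
  conv_lhs => rw [← h2 x, map_sum]
  rw [Finset.sum_congr rfl fun i _ => hfix i _ (h1 i x), h2]

end Blocks

/-! ### Irreducible imprimitive duos as pairs of cycles with two common lines -/

section Marked

variable {F V : Type*} [Field F] [AddCommGroup V] [Module F V]

/-- In finite dimension a subspace mapped into itself is mapped onto itself, so inverses come for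
free and irreducibility can be tested on the two generators. -/
theorem ActsIrreducibly.eq_bot_or_eq_top [FiniteDimensional F V] {g g' : V ≃ₗ[F] V}
    (h : ActsIrreducibly (Subgroup.closure {g, g'})) {W : Submodule F V}
    (hg : ∀ x ∈ W, g x ∈ W) (hg' : ∀ x ∈ W, g' x ∈ W) : W = ⊥ ∨ W = ⊤ := by
  have key : ∀ a : V ≃ₗ[F] V, (∀ x ∈ W, a x ∈ W) → ∀ x ∈ W, a⁻¹ x ∈ W := by
    intro a ha x hx
    have hle : W.map (a : V →ₗ[F] V) ≤ W := by
      rintro _ ⟨y, hy, rfl⟩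
      exact ha y hy
    have heq := Submodule.eq_of_le_of_finrank_eq hle (LinearEquiv.finrank_map_eq a W)
    rw [← heq] at hx
    obtain ⟨y, hy, rfl⟩ := hx
    have : a⁻¹ (a y) = y := a.symm_apply_apply y
    exact this.symm ▸ hy
  refine h W fun a ha => ?_
  induction ha using Subgroup.closure_induction with
  | mem a ha =>
    rcases ha with rfl | rfl
    · exact hg
    · exact hg'
  | one => exact fun x hx => hx
  | mul a c _ _ iha ihc => exact fun x hx => iha _ (ihc x hx)
  | inv a _ iha => exact key a iha

/-- The vector `w` spans a line in the common support of the monomial elements `g` and `g'`;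
the other common line is spanned by `g ^ k w`, and contains `g' ^ k' w = c • g ^ k w`. -/
structure IsMarked (g g' : V ≃ₗ[F] V) (w : V) (k k' : ℕ) (c : F) : Prop where
  k_pos : 0 < k
  k_lt : k < orderOf g
  k'_pos : 0 < k'
  k'_lt : k' < orderOf g'
  w_ne : w ≠ 0
  c_ne : c ≠ 0
  link : (g' ^ (k' : ℤ)) w = c • (g ^ (k : ℤ)) w
  fix_left : ∀ j : ℤ, ¬ (orderOf g' : ℤ) ∣ j → ¬ (orderOf g' : ℤ) ∣ j - k' →
    g ((g' ^ j) w) = (g' ^ j) w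
  fix_right : ∀ i : ℤ, ¬ (orderOf g : ℤ) ∣ i → ¬ (orderOf g : ℤ) ∣ i - k →
    g' ((g ^ i) w) = (g ^ i) w

theorem exists_nat_zpow {G : Type*} [Group G] {g : G} {r : ℕ} (hr : 0 < r) (ho : orderOf g = r)
    (i : ℤ) : ∃ n : ℕ, n < r ∧ g ^ i = g ^ n ∧ (r : ℤ) ∣ i - n := by
  have hr' : (r : ℤ) ≠ 0 := by omega
  refine ⟨(i % r).toNat, ?_, ?_, ?_⟩
  · have := Int.emod_nonneg i hr'
    have := Int.emod_lt_of_pos i (b := r) (by omega)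
    omega
  · rw [← zpow_natCast, Int.toNat_of_nonneg (Int.emod_nonneg i hr'), ← ho, zpow_mod_orderOf]
  · rw [Int.toNat_of_nonneg (Int.emod_nonneg i hr')]
    exact Int.dvd_self_sub_emod

/-- An irreducible group generated by two stingray elements that preserves a decomposition is
monomial, and the two generators act as cycles whose supports have two common points. -/
theorem exists_marked [FiniteDimensional F V] {e₁ e₂ r₁ r₂ b : ℕ} {g g' : V ≃ₗ[F] V}
    {U U' : Submodule F V} (hg : IsStingrayOn e₁ g U) (hg' : IsStingrayOn e₂ g' U')
    (hr₁ : r₁.Prime) (hr₂ : r₂.Prime) (ho₁ : orderOf g = r₁) (ho₂ : orderOf g' = r₂)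
    (he₁ : 2 ≤ e₁) (he₂ : 2 ≤ e₂) (her₁ : e₁ + 1 ≤ r₁) (her₂ : e₂ + 1 ≤ r₂)
    (hd : Module.finrank F V = e₁ + e₂)
    (hirr : ActsIrreducibly (Subgroup.closure {g, g'}))
    {W : Fin b → Submodule F V} (hb : 2 ≤ b) (hW : IsDirectDecomposition W)
    (hstab : Subgroup.closure {g, g'} ≤ decompositionStabilizer W) :
    r₁ = e₁ + 1 ∧ r₂ = e₂ + 1 ∧ b = e₁ + e₂ ∧ (∀ i, Module.finrank F (W i) = 1) ∧
      ∃ (w : V) (k k' : ℕ) (c : F), IsMarked g g' w k k' c ∧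
        ∀ i, ∃ n : ℕ, (g ^ n) w ∈ W i ∨ (g' ^ n) w ∈ W i := by
  classical
  obtain ⟨s, hs⟩ := hstab (Subgroup.subset_closure (Set.mem_insert g {g'}))
  obtain ⟨s', hs'⟩ := hstab (Subgroup.subset_closure (Set.mem_insert_of_mem g rfl))
  have hnotinv : ∀ i, ¬ ((∀ x ∈ W i, g x ∈ W i) ∧ ∀ x ∈ W i, g' x ∈ W i) := by
    rintro i ⟨h1, h2⟩
    rcases hirr.eq_bot_or_eq_top h1 h2 with h | h
    · exact hW.2 i h
    · obtain ⟨j, hj⟩ : ∃ j : Fin b, i ≠ j :=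
        haveI : Nontrivial (Fin b) := Fin.nontrivial_iff_two_le.2 hb
        (exists_ne i).imp fun _ h => h.symm
      have := hW.1.submodule_iSupIndep.pairwiseDisjoint hj
      rw [Function.onFun, h, disjoint_comm, disjoint_top] at this
      exact hW.2 j this
  have hmemof : ∀ {a : V ≃ₗ[F] V} {t : Equiv.Perm (Fin b)},
      (∀ i, (W i).map (a : V →ₗ[F] V) = W (t i)) → ∀ i, t i = i → ∀ x ∈ W i, a x ∈ W i := by
    intro a t ht i hi x hx
    have := ht i
    rw [hi] at this
    rw [← this]
    exact ⟨x, hx, rfl⟩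
  -- an element that moves a block excludes that the other one moves no block
  have hone : ∀ {e e' r : ℕ} {a a' : V ≃ₗ[F] V} {t t' : Equiv.Perm (Fin b)} {A A' : Submodule F V},
      IsStingrayOn e a A → IsStingrayOn e' a' A' → r.Prime → orderOf a = r → e + 1 ≤ r → 2 ≤ e' →
      (∀ i, (W i).map (a : V →ₗ[F] V) = W (t i)) →
      (∀ i, (W i).map (a' : V →ₗ[F] V) = W (t' i)) →
      (∀ i, ¬ ((∀ x ∈ W i, a x ∈ W i) ∧ ∀ x ∈ W i, a' x ∈ W i)) →
      (∃ i, t i ≠ i) → ∃ i, t' i ≠ i := by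
    intro e e' r a a' t t' A A' ha ha' hr ho her he' ht ht' hni ⟨i₀, hi₀⟩
    -- Otherwise `A'` lies in a single block `W j`. If `W j` is on the cycle of `a` it is a line,
    -- too small for `2 ≤ e'`; if it is off the cycle it is invariant under both elements.
    by_contra! hall
    obtain ⟨-, h2, h3⟩ := ha.block_cycle hr ho her hW ht hi₀
    obtain ⟨j, hj⟩ := ha'.le_block hW (fun i => by rw [ht', hall])
    by_cases hjo : ∃ n : ℕ, (t ^ n) i₀ = j
    · obtain ⟨n, rfl⟩ := hjo
      have := Submodule.finrank_mono hj
      rw [ha'.finrank_eq, h2 n] at this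
      omega
    · push Not at hjo
      refine hni j ⟨fun x hx => ?_, hmemof ht' j (hall j)⟩
      rw [h3 j hjo x hx]
      exact hx
  have hmove : (∃ i, s i ≠ i) ∧ ∃ i, s' i ≠ i := by
    by_cases h : ∃ i, s i ≠ i
    · exact ⟨h, hone hg hg' hr₁ ho₁ her₁ he₂ hs hs' hnotinv h⟩
    · have h' : ∃ i, s' i ≠ i := by
        by_contra! hall
        push Not at h
        exact hnotinv ⟨0, by omega⟩ ⟨hmemof hs _ (h _), hmemof hs' _ (hall _)⟩
      exact absurd (hone hg' hg hr₂ ho₂ her₂ he₁ hs' hs (fun i hi => hnotinv i hi.symm) h') h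
  obtain ⟨⟨i₀, hi₀⟩, ⟨i₀', hi₀'⟩⟩ := hmove
  obtain ⟨hre₁, hdim₁, hfix₁⟩ := hg.block_cycle hr₁ ho₁ her₁ hW hs hi₀
  obtain ⟨hre₂, hdim₂, hfix₂⟩ := hg'.block_cycle hr₂ ho₂ her₂ hW hs' hi₀'
  have hper₁ := block_minimalPeriod hW hs hr₁ ho₁ hi₀
  have hper₂ := block_minimalPeriod hW hs' hr₂ ho₂ hi₀'
  have hcover : ∀ j, (∃ n : ℕ, (s ^ n) i₀ = j) ∨ ∃ n : ℕ, (s' ^ n) i₀' = j := by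
    intro j
    by_contra! hj
    refine hnotinv j ⟨fun x hx => ?_, fun x hx => ?_⟩
    · rw [hfix₁ j hj.1 x hx]; exact hx
    · rw [hfix₂ j hj.2 x hx]; exact hx
  have hdim : ∀ i, Module.finrank F (W i) = 1 := by
    intro j
    rcases hcover j with ⟨n, rfl⟩ | ⟨n, rfl⟩
    · exact hdim₁ n
    · exact hdim₂ n
  have hbd : b = e₁ + e₂ := by
    rw [← hd, ← (LinearEquiv.ofBijective (DirectSum.coeLinearMap W) hW.1).finrank_eq,
      Module.finrank_directSum]
    simp [hdim]
  -- the supports, and their intersection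
  let O : Finset (Fin b) := (Finset.range r₁).image fun n => (s ^ n) i₀
  let O' : Finset (Fin b) := (Finset.range r₂).image fun n => (s' ^ n) i₀'
  have hO : O.card = r₁ := by
    rw [Finset.card_image_of_injOn, Finset.card_range]
    intro m hm n hn h
    exact (pow_apply_eq_iff_of_minimalPeriod hper₁ (by simpa using hm) (by simpa using hn)).1 h
  have hO' : O'.card = r₂ := by
    rw [Finset.card_image_of_injOn, Finset.card_range]
    intro m hm n hn h
    exact (pow_apply_eq_iff_of_minimalPeriod hper₂ (by simpa using hm) (by simpa using hn)).1 h
  have hmodpow : ∀ {r : ℕ} {a : V ≃ₗ[F] V} {t : Equiv.Perm (Fin b)}, orderOf a = r →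
      (∀ i, (W i).map (a : V →ₗ[F] V) = W (t i)) → ∀ n : ℕ, t ^ n = t ^ (n % r) := by
    intro r a t hor ht n
    have h1 := block_perm_pow_eq_one hW ht (n := r) (by rw [← hor]; exact pow_orderOf_eq_one a)
    conv_lhs => rw [← Nat.div_add_mod n r, pow_add, pow_mul, h1, one_pow, one_mul]
  have hmemO : ∀ j, j ∈ O ↔ ∃ n : ℕ, (s ^ n) i₀ = j := by
    intro j
    simp only [O, Finset.mem_image, Finset.mem_range]
    constructor
    · rintro ⟨n, -, h⟩; exact ⟨n, h⟩
    · rintro ⟨n, h⟩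
      exact ⟨n % r₁, Nat.mod_lt _ hr₁.pos, by rw [← hmodpow ho₁ hs]; exact h⟩
  have hmemO' : ∀ j, j ∈ O' ↔ ∃ n : ℕ, (s' ^ n) i₀' = j := by
    intro j
    simp only [O', Finset.mem_image, Finset.mem_range]
    constructor
    · rintro ⟨n, -, h⟩; exact ⟨n, h⟩
    · rintro ⟨n, h⟩
      exact ⟨n % r₂, Nat.mod_lt _ hr₂.pos, by rw [← hmodpow ho₂ hs']; exact h⟩
  have hunion : O ∪ O' = Finset.univ := by
    ext j
    simp only [Finset.mem_union, Finset.mem_univ, iff_true]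
    rcases hcover j with h | h
    · exact Or.inl ((hmemO j).2 h)
    · exact Or.inr ((hmemO' j).2 h)
  -- The intersection has `(e₁ + 1) + (e₂ + 1) - (e₁ + e₂) = 2` elements.
  have hinter : (O ∩ O').card = 2 := by
    have := Finset.card_union_add_card_inter O O'
    rw [hunion, Finset.card_univ, Fintype.card_fin, hO, hO'] at this
    omega
  obtain ⟨c₁, c₂, hc, hcc⟩ := Finset.card_eq_two.1 hinter
  have hc₁ : c₁ ∈ O ∩ O' := by rw [hcc]; simp
  have hc₂ : c₂ ∈ O ∩ O' := by rw [hcc]; simp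
  rw [Finset.mem_inter] at hc₁ hc₂
  -- the cycles, started at the common point `c₁`
  have hmv : ∀ {t : Equiv.Perm (Fin b)} {i : Fin b}, t i ≠ i → ∀ n : ℕ,
      t ((t ^ n) i) ≠ (t ^ n) i := by
    intro t i hi n h
    apply hi
    apply (t ^ n).injective
    rw [← Equiv.Perm.mul_apply, ← pow_succ, pow_succ']
    exact h
  have hmv₁ : s c₁ ≠ c₁ := by
    obtain ⟨n, h⟩ := (hmemO _).1 hc₁.1
    rw [← h]; exact hmv hi₀ n
  have hmv₂ : s' c₁ ≠ c₁ := by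
    obtain ⟨n, h⟩ := (hmemO' _).1 hc₁.2
    rw [← h]; exact hmv hi₀' n
  have hp₁ := block_minimalPeriod hW hs hr₁ ho₁ hmv₁
  have hp₂ := block_minimalPeriod hW hs' hr₂ ho₂ hmv₂
  have hreach : ∀ {r : ℕ} {t : Equiv.Perm (Fin b)} {i x y : Fin b}, 0 < r → (∀ n : ℕ, t ^ n = t ^ (n % r)) →
      (∃ n : ℕ, (t ^ n) i = x) → (∃ n : ℕ, (t ^ n) i = y) → ∃ n : ℕ, n < r ∧ (t ^ n) x = y := by
    rintro r t i x y hr hmod ⟨n, rfl⟩ ⟨m, rfl⟩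
    -- This exponent is `m - n` modulo `r`, with `(r - 1) * n` standing for `-n`.
    refine ⟨(m + (r - 1) * n) % r, Nat.mod_lt _ hr, ?_⟩
    rw [← hmod, ← Equiv.Perm.mul_apply, ← pow_add]
    have h1 : m + (r - 1) * n + n = m + r * n := by
      obtain ⟨r, rfl⟩ : ∃ k, r = k + 1 := ⟨r - 1, by omega⟩
      simp only [Nat.add_sub_cancel]; ring
    rw [h1, hmod, Nat.add_mul_mod_self_left, ← hmod]
  obtain ⟨k, hk, hkc⟩ := hreach hr₁.pos (hmodpow ho₁ hs) ((hmemO _).1 hc₁.1) ((hmemO _).1 hc₂.1)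
  obtain ⟨k', hk', hkc'⟩ :=
    hreach hr₂.pos (hmodpow ho₂ hs') ((hmemO' _).1 hc₁.2) ((hmemO' _).1 hc₂.2)
  have hkpos : 0 < k := by
    rcases Nat.eq_zero_or_pos k with rfl | h
    · exact absurd hkc hc
    · exact h
  have hkpos' : 0 < k' := by
    rcases Nat.eq_zero_or_pos k' with rfl | h
    · exact absurd hkc' hc
    · exact h
  obtain ⟨w, hw, hw0⟩ := Submodule.exists_mem_ne_zero_of_ne_bot (hW.2 c₁)
  have hgw : ∀ n : ℕ, (g ^ n) w ∈ W ((s ^ n) c₁) := fun n => by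
    rw [← map_pow_block hs n]; exact ⟨w, hw, rfl⟩
  have hgw' : ∀ n : ℕ, (g' ^ n) w ∈ W ((s' ^ n) c₁) := fun n => by
    rw [← map_pow_block hs' n]; exact ⟨w, hw, rfl⟩
  have hlink : ∃ c : F, c • (g ^ k) w = (g' ^ k') w := by
    have h1 := hgw k
    have h2 := hgw' k'
    rw [hkc] at h1
    rw [hkc'] at h2
    obtain ⟨c, hc⟩ := (finrank_eq_one_iff_of_nonzero' (⟨_, h1⟩ : W c₂)
      (fun h => hw0 ((LinearEquiv.map_eq_zero_iff _).1 (congrArg Subtype.val h)))).1 (hdim c₂)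
      ⟨_, h2⟩
    exact ⟨c, congrArg Subtype.val hc⟩
  obtain ⟨c, hcl⟩ := hlink
  have hOc : ∀ n : ℕ, (s ^ n) c₁ ∈ O := by
    intro n
    obtain ⟨m, h⟩ := (hmemO _).1 hc₁.1
    exact (hmemO _).2 ⟨n + m, by rw [pow_add, Equiv.Perm.mul_apply, h]⟩
  have hOc' : ∀ n : ℕ, (s' ^ n) c₁ ∈ O' := by
    intro n
    obtain ⟨m, h⟩ := (hmemO' _).1 hc₁.2
    exact (hmemO' _).2 ⟨n + m, by rw [pow_add, Equiv.Perm.mul_apply, h]⟩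
  refine ⟨hre₁, hre₂, hbd, hdim, w, k, k', c, ⟨hkpos, ho₁ ▸ hk, hkpos', ho₂ ▸ hk', hw0, ?_, ?_, ?_,
    ?_⟩, ?_⟩
  · rintro rfl
    rw [zero_smul] at hcl
    exact hw0 ((LinearEquiv.map_eq_zero_iff _).1 hcl.symm)
  · rw [zpow_natCast, zpow_natCast, hcl]
  · intro j hj0 hjk
    rw [ho₂] at hj0 hjk
    obtain ⟨n, hn, hgn, hdvd⟩ := exists_nat_zpow hr₂.pos ho₂ j
    rw [hgn]
    -- A block on both cycles is `c₁` or `c₂`, that is `n = 0` or `n = k'`, and these residues are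
    -- excluded.
    refine hfix₁ _ (fun m hm => ?_) _ (hgw' n)
    have hmem : (s' ^ n) c₁ ∈ O ∩ O' := Finset.mem_inter.2 ⟨(hmemO _).2 ⟨m, hm⟩, hOc' n⟩
    rw [hcc, Finset.mem_insert, Finset.mem_singleton] at hmem
    rcases hmem with h | h
    · have := (pow_apply_eq_iff_of_minimalPeriod hp₂ hn hr₂.pos).1 h
      subst this
      exact hj0 (by simpa using hdvd)
    · rw [← hkc'] at h
      have := (pow_apply_eq_iff_of_minimalPeriod hp₂ hn hk').1 h
      subst this
      exact hjk hdvd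
  · intro j hj0 hjk
    rw [ho₁] at hj0 hjk
    obtain ⟨n, hn, hgn, hdvd⟩ := exists_nat_zpow hr₁.pos ho₁ j
    rw [hgn]
    refine hfix₂ _ (fun m hm => ?_) _ (hgw n)
    have hmem : (s ^ n) c₁ ∈ O ∩ O' := Finset.mem_inter.2 ⟨hOc n, (hmemO' _).2 ⟨m, hm⟩⟩
    rw [hcc, Finset.mem_insert, Finset.mem_singleton] at hmem
    rcases hmem with h | h
    · have := (pow_apply_eq_iff_of_minimalPeriod hp₁ hn hr₁.pos).1 h
      subst this
      exact hj0 (by simpa using hdvd)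
    · rw [← hkc] at h
      have := (pow_apply_eq_iff_of_minimalPeriod hp₁ hn hk).1 h
      subst this
      exact hjk hdvd
  · intro i
    rcases hcover i with h | h
    · obtain ⟨n, -, hn⟩ := hreach hr₁.pos (hmodpow ho₁ hs) ((hmemO _).1 hc₁.1) h
      exact ⟨n, Or.inl (hn ▸ hgw n)⟩
    · obtain ⟨n, -, hn⟩ := hreach hr₂.pos (hmodpow ho₂ hs') ((hmemO' _).1 hc₁.2) h
      exact ⟨n, Or.inr (hn ▸ hgw' n)⟩

end Marked

/-! ### The basis attached to a marked duo -/

section MarkedBasis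

variable {F V : Type*} [Field F] [AddCommGroup V] [Module F V]

/-- The index set of the basis attached to marked elements of orders `r` and `r'`. -/
abbrev MarkedIndex (r r' k' : ℕ) : Type := Fin r ⊕ {j : Fin r' // j.val ≠ 0 ∧ j.val ≠ k'}

/-- The vectors `g ^ i w`, and the vectors `g' ^ j w` that are not on the lines of the former. -/
def markedFamily (g g' : V ≃ₗ[F] V) (w : V) (r r' k' : ℕ) : MarkedIndex r r' k' → V :=
  Sum.elim (fun i => (g ^ (i.val : ℤ)) w) (fun j => (g' ^ (j.val.val : ℤ)) w)

theorem card_markedIndex {r r' k' : ℕ} (h0 : 0 < k') (hk' : k' < r') :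
    Fintype.card (MarkedIndex r r' k') + 2 = r + r' := by
  have h1 : Fintype.card {j : Fin r' // j.val ≠ 0 ∧ j.val ≠ k'} + 2 = r' := by
    rw [Fintype.card_subtype]
    have h2 : (Finset.univ.filter fun j : Fin r' => j.val ≠ 0 ∧ j.val ≠ k')
        = ({⟨0, by omega⟩, ⟨k', hk'⟩} : Finset (Fin r'))ᶜ := by
      ext j
      simp [Fin.ext_iff]
    have h3 : ({⟨0, by omega⟩, ⟨k', hk'⟩} : Finset (Fin r')).card = 2 :=
      Finset.card_pair (by simp [Fin.ext_iff]; omega)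
    have h4 := Finset.card_add_card_compl ({⟨0, by omega⟩, ⟨k', hk'⟩} : Finset (Fin r'))
    rw [h2]
    rw [h3, Fintype.card_fin] at h4
    omega
  rw [Fintype.card_sum, Fintype.card_fin]
  omega

namespace IsMarked

variable {g g' : V ≃ₗ[F] V} {w : V} {k k' : ℕ} {c : F} {r r' : ℕ}

theorem zpow_left (hm : IsMarked g g' w k k' c) (hr : orderOf g = r) (i : ℤ) :
    ∃ a : Fin r, ∀ k', (g ^ i) w = markedFamily g g' w r r' k' (Sum.inl a) ∧
      (r : ℤ) ∣ i - a.val := by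
  obtain ⟨n, hn, h, hd⟩ := exists_nat_zpow (by have := hm.k_lt; omega) hr i
  exact ⟨⟨n, hn⟩, fun k' => ⟨by rw [h, ← zpow_natCast]; rfl, hd⟩⟩

/-- The first two alternatives are the shared lines, already represented by powers of `g`; the
second is where `c` enters. -/
theorem zpow_right (hm : IsMarked g g' w k k' c) (hr' : orderOf g' = r') (j : ℤ) :
    ((r' : ℤ) ∣ j ∧ (g' ^ j) w = w) ∨ ((r' : ℤ) ∣ j - k' ∧ (g' ^ j) w = c • (g ^ (k : ℤ)) w) ∨
      ∃ a, ¬ (r' : ℤ) ∣ j ∧ ¬ (r' : ℤ) ∣ j - k' ∧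
        (g' ^ j) w = markedFamily g g' w r r' k' (Sum.inr a) ∧ (r' : ℤ) ∣ j - a.val.val := by
  obtain ⟨n, hn, h, hd⟩ := exists_nat_zpow (by have := hm.k'_lt; omega) hr' j
  have hk'lt := hr' ▸ hm.k'_lt
  by_cases h0 : n = 0
  · subst h0
    left
    exact ⟨by simpa using hd, by rw [h]; rfl⟩
  by_cases h1 : n = k'
  · subst h1
    right; left
    exact ⟨hd, by rw [h, ← zpow_natCast, hm.link]⟩
  right; right
  refine ⟨⟨⟨n, hn⟩, h0, h1⟩, fun hj => ?_, fun hj => ?_, by rw [h, ← zpow_natCast]; rfl, hd⟩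
  · have h2 : (r' : ℤ) ∣ n := by have := dvd_sub hj hd; simpa using this
    exact h0 (Nat.eq_zero_of_dvd_of_lt (Int.natCast_dvd_natCast.1 h2) hn)
  · have h2 : (r' : ℤ) ∣ (n : ℤ) - k' := by have := dvd_sub hj hd; simpa using this
    have := Int.eq_zero_of_abs_lt_dvd h2 (by rw [abs_lt]; omega)
    omega

theorem apply_zpow (g : V ≃ₗ[F] V) (i : ℤ) (v : V) : g ((g ^ i) v) = (g ^ (i + 1)) v := by
  rw [add_comm, zpow_add, zpow_one, LinearEquiv.mul_apply]

theorem zpow_mem (hm : IsMarked g g' w k k' c) (hr : orderOf g = r) {S : Submodule F V}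
    (hS : ∀ a, markedFamily g g' w r r' k' a ∈ S) (i : ℤ) : (g ^ i) w ∈ S := by
  obtain ⟨a, ha⟩ := hm.zpow_left (r' := r') hr i
  rw [(ha k').1]
  exact hS _

theorem zpow_mem' (hm : IsMarked g g' w k k' c) (hr : orderOf g = r) (hr' : orderOf g' = r')
    {S : Submodule F V} (hS : ∀ a, markedFamily g g' w r r' k' a ∈ S) (j : ℤ) :
    (g' ^ j) w ∈ S := by
  have h0 := hm.zpow_mem hr hS
  rcases hm.zpow_right (r := r) hr' j with ⟨-, h⟩ | ⟨-, h⟩ | ⟨a, -, -, h, -⟩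
  · rw [h]; exact h0 0
  · rw [h]; exact S.smul_mem _ (h0 _)
  · rw [h]; exact hS _

theorem apply_left (hm : IsMarked g g' w k k' c) (hr' : orderOf g' = r')
    (a : {j : Fin r' // j.val ≠ 0 ∧ j.val ≠ k'}) :
    g ((g' ^ (a.val.val : ℤ)) w) = (g' ^ (a.val.val : ℤ)) w := by
  have ha := a.val.isLt
  have hk' := hm.k'_lt
  refine hm.fix_left _ (fun h0 => ?_) (fun h3 => ?_)
  · rw [hr', Int.natCast_dvd_natCast] at h0
    exact a.2.1 (Nat.eq_zero_of_dvd_of_lt h0 a.val.isLt)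
  · have := Int.eq_zero_of_abs_lt_dvd h3 (by rw [abs_lt]; omega)
    exact a.2.2 (by omega)

theorem apply_right (hm : IsMarked g g' w k k' c) (hr : orderOf g = r) (a : Fin r) :
    (a.val = 0) ∨ (a.val = k) ∨ g' ((g ^ (a.val : ℤ)) w) = (g ^ (a.val : ℤ)) w := by
  by_cases h0 : a.val = 0
  · exact Or.inl h0
  by_cases h1 : a.val = k
  · exact Or.inr (Or.inl h1)
  refine Or.inr (Or.inr (hm.fix_right _ (fun h => ?_) (fun h => ?_)))
  · rw [hr, Int.natCast_dvd_natCast] at h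
    exact h0 (Nat.eq_zero_of_dvd_of_lt h a.isLt)
  · have ha := a.isLt
    have hk' := hm.k_lt
    have := Int.eq_zero_of_abs_lt_dvd h (by rw [abs_lt]; omega)
    exact h1 (by omega)

variable [FiniteDimensional F V]

/-- The span contains `w ≠ 0` and is stable under both generators; at the second shared line,
stability under `g'` uses that `c` is invertible. -/
theorem span_eq_top (hm : IsMarked g g' w k k' c) (hr : orderOf g = r) (hr' : orderOf g' = r')
    (hirr : ActsIrreducibly (Subgroup.closure {g, g'})) :
    Submodule.span F (Set.range (markedFamily g g' w r r' k')) = ⊤ := by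
  set S := Submodule.span F (Set.range (markedFamily g g' w r r' k'))
  have hS : ∀ a, markedFamily g g' w r r' k' a ∈ S := fun a =>
    Submodule.subset_span ⟨a, rfl⟩
  have h1 := hm.zpow_mem hr hS
  have h2 := hm.zpow_mem' hr hr' hS
  have hcl : ∀ a : V ≃ₗ[F] V, (∀ x ∈ Set.range (markedFamily g g' w r r' k'), a x ∈ S) →
      ∀ x ∈ S, a x ∈ S := by
    intro a ha x hx
    have : S ≤ S.comap (a : V →ₗ[F] V) := Submodule.span_le.2 ha
    exact this hx
  have hlink : (g ^ (k : ℤ)) w = c⁻¹ • (g' ^ (k' : ℤ)) w := by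
    rw [hm.link, smul_smul, inv_mul_cancel₀ hm.c_ne, one_smul]
  have hgS : ∀ x ∈ Set.range (markedFamily g g' w r r' k'), g x ∈ S := by
    rintro _ ⟨a | a, rfl⟩
    · change g ((g ^ (a.val : ℤ)) w) ∈ S
      rw [apply_zpow]
      exact h1 _
    · change g ((g' ^ (a.val.val : ℤ)) w) ∈ S
      rw [hm.apply_left hr' a]
      exact h2 _
  have hgS' : ∀ x ∈ Set.range (markedFamily g g' w r r' k'), g' x ∈ S := by
    rintro _ ⟨a | a, rfl⟩
    · change g' ((g ^ (a.val : ℤ)) w) ∈ S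
      rcases hm.apply_right hr a with h | h | h
      · rw [h]; exact h2 1
      · rw [h, hlink, map_smul, apply_zpow]
        exact S.smul_mem _ (h2 _)
      · rw [h]; exact h1 _
    · change g' ((g' ^ (a.val.val : ℤ)) w) ∈ S
      rw [apply_zpow]
      exact h2 _
  refine (hirr.eq_bot_or_eq_top (hcl g hgS) (hcl g' hgS')).resolve_left fun h => ?_
  have := h1 0
  rw [h] at this
  exact hm.w_ne this

/-- The basis attached to marked elements of an irreducible group. -/
theorem exists_basis (hm : IsMarked g g' w k k' c) (hr : orderOf g = r) (hr' : orderOf g' = r')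
    (hd : Module.finrank F V + 2 = r + r')
    (hirr : ActsIrreducibly (Subgroup.closure {g, g'})) :
    ∃ b : Module.Basis (MarkedIndex r r' k') F V, ⇑b = markedFamily g g' w r r' k' := by
  have hcard : Fintype.card (MarkedIndex r r' k') = Module.finrank F V := by
    have := card_markedIndex (r := r) hm.k'_pos (hr' ▸ hm.k'_lt)
    omega
  have hspan := hm.span_eq_top hr hr' hirr
  have hli := linearIndependent_of_top_le_span_of_card_eq_finrank hspan.ge hcard
  exact ⟨Module.Basis.mk hli hspan.ge, Module.Basis.coe_mk _ _⟩

/-- The constant of marked elements of an irreducible group is not `1`: otherwise the group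
would permute a basis. -/
theorem c_ne_one (hm : IsMarked g g' w k k' c) (hr : orderOf g = r) (hr' : orderOf g' = r')
    (hd : Module.finrank F V + 2 = r + r') (hd2 : 2 ≤ Module.finrank F V)
    (hirr : ActsIrreducibly (Subgroup.closure {g, g'})) : c ≠ 1 := by
  rintro rfl
  obtain ⟨b, hb⟩ := hm.exists_basis hr hr' hd hirr
  -- If `c = 1`, both generators permute the basis, so the sum of the coordinates is invariant and
  -- its kernel is a proper nonzero submodule.
  let φ : V →ₗ[F] F := b.constr F fun _ => (1 : F)
  have hφ : ∀ a, φ (markedFamily g g' w r r' k' a) = 1 := fun a => by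
    rw [← hb]; exact b.constr_basis F _ a
  have h1 : ∀ i : ℤ, φ ((g ^ i) w) = 1 := fun i => by
    obtain ⟨a, ha⟩ := hm.zpow_left (r' := r') hr i
    rw [(ha k').1]; exact hφ _
  have h2 : ∀ j : ℤ, φ ((g' ^ j) w) = 1 := fun j => by
    rcases hm.zpow_right (r := r) hr' j with ⟨-, h⟩ | ⟨-, h⟩ | ⟨a, -, -, h, -⟩
    · rw [h]; exact h1 0
    · rw [h, one_smul]; exact h1 _
    · rw [h]; exact hφ _
  have hg : φ ∘ₗ (g : V →ₗ[F] V) = φ := by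
    refine b.ext fun a => ?_
    rw [hb, hφ]
    rcases a with a | a
    · change φ (g ((g ^ (a.val : ℤ)) w)) = 1
      rw [apply_zpow, h1]
    · change φ (g ((g' ^ (a.val.val : ℤ)) w)) = 1
      rw [hm.apply_left hr' a, h2]
  have hg' : φ ∘ₗ (g' : V →ₗ[F] V) = φ := by
    refine b.ext fun a => ?_
    rw [hb, hφ]
    rcases a with a | a
    · change φ (g' ((g ^ (a.val : ℤ)) w)) = 1
      rcases hm.apply_right hr a with h | h | h
      · rw [h]; exact h2 1
      · have := hm.link
        rw [one_smul] at this
        rw [h, ← this, apply_zpow, h2]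
      · rw [h, h1]
    · change φ (g' ((g' ^ (a.val.val : ℤ)) w)) = 1
      rw [apply_zpow, h2]
  rcases hirr.eq_bot_or_eq_top (W := LinearMap.ker φ)
    (fun x hx => by
      rw [LinearMap.mem_ker] at hx ⊢
      rw [← hx]; exact LinearMap.congr_fun hg x)
    (fun x hx => by
      rw [LinearMap.mem_ker] at hx ⊢
      rw [← hx]; exact LinearMap.congr_fun hg' x) with h | h
  · have hrank := LinearMap.finrank_range_add_finrank_ker φ
    rw [h, finrank_bot] at hrank
    have hle := Submodule.finrank_le (LinearMap.range φ)
    rw [Module.finrank_self] at hle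
    omega
  · have h0 : w ∈ LinearMap.ker φ := by rw [h]; trivial
    rw [LinearMap.mem_ker] at h0
    have h3 := h1 0
    rw [zpow_zero, LinearEquiv.coe_one, id_eq, h0] at h3
    exact zero_ne_one h3

/-- Marked elements with the same data are conjugate. -/
theorem exists_conj {g₀ g₀' : V ≃ₗ[F] V} {w₀ : V} (h₀ : IsMarked g₀ g₀' w₀ k k' c)
    (hm : IsMarked g g' w k k' c) (hr₀ : orderOf g₀ = r) (hr₀' : orderOf g₀' = r')
    (hr : orderOf g = r) (hr' : orderOf g' = r')
    (hd : Module.finrank F V + 2 = r + r')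
    (hirr₀ : ActsIrreducibly (Subgroup.closure {g₀, g₀'}))
    (hirr : ActsIrreducibly (Subgroup.closure {g, g'})) :
    ∃ x : V ≃ₗ[F] V, x * g₀ * x⁻¹ = g ∧ x * g₀' * x⁻¹ = g' ∧ x w₀ = w ∧
      ∀ a, x (markedFamily g₀ g₀' w₀ r r' k' a) = markedFamily g g' w r r' k' a := by
  obtain ⟨b₀, hb₀⟩ := h₀.exists_basis hr₀ hr₀' hd hirr₀
  obtain ⟨b, hb⟩ := hm.exists_basis hr hr' hd hirr
  -- Matching the two bases matches all `g ^ i w` and `g' ^ j w`, because `k`, `k'` and `c` are the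
  -- same on both sides.
  let x : V ≃ₗ[F] V := b₀.equiv b (Equiv.refl _)
  have hx : ∀ a, x (markedFamily g₀ g₀' w₀ r r' k' a) = markedFamily g g' w r r' k' a := by
    intro a
    rw [← hb₀, ← hb]
    exact b₀.equiv_apply a b (Equiv.refl _)
  have h1 : ∀ i : ℤ, x ((g₀ ^ i) w₀) = (g ^ i) w := fun i => by
    obtain ⟨a, ha⟩ := h₀.zpow_left (r' := r') hr₀ i
    rw [(ha k').1, hx]
    change (g ^ (a.val : ℤ)) w = (g ^ i) w
    have : g ^ i = g ^ (a.val : ℤ) := by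
      rw [← sub_add_cancel i (a.val : ℤ), zpow_add,
        orderOf_dvd_iff_zpow_eq_one.1 (hr.symm ▸ (ha k').2), one_mul]
    rw [this]
  have h2 : ∀ j : ℤ, x ((g₀' ^ j) w₀) = (g' ^ j) w := fun j => by
    rcases h₀.zpow_right (r := r) hr₀' j with ⟨hd, h⟩ | ⟨hd, h⟩ | ⟨a, -, -, h, hd⟩
    · rw [h, orderOf_dvd_iff_zpow_eq_one.1 (hr'.symm ▸ hd)]
      exact h1 0
    · have : g' ^ j = g' ^ (k' : ℤ) := by
        rw [← sub_add_cancel j (k' : ℤ), zpow_add,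
          orderOf_dvd_iff_zpow_eq_one.1 (hr'.symm ▸ hd), one_mul]
      rw [h, map_smul, h1, this, hm.link]
    · have : g' ^ j = g' ^ (a.val.val : ℤ) := by
        rw [← sub_add_cancel j (a.val.val : ℤ), zpow_add,
          orderOf_dvd_iff_zpow_eq_one.1 (hr'.symm ▸ hd), one_mul]
      rw [h, hx, this]
      rfl
  have hconj : ∀ {a₀ a : V ≃ₗ[F] V}, (∀ v, x (a₀ v) = a (x v)) → x * a₀ * x⁻¹ = a := by
    intro a₀ a h
    rw [mul_inv_eq_iff_eq_mul]
    exact LinearEquiv.ext h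
  refine ⟨x, hconj ?_, hconj ?_, h1 0, hx⟩
  · have : (x : V →ₗ[F] V) ∘ₗ (g₀ : V →ₗ[F] V) = (g : V →ₗ[F] V) ∘ₗ (x : V →ₗ[F] V) := by
      refine b₀.ext fun a => ?_
      rw [hb₀]
      rcases a with a | a
      · change x (g₀ ((g₀ ^ (a.val : ℤ)) w₀)) = g (x ((g₀ ^ (a.val : ℤ)) w₀))
        rw [apply_zpow, h1, h1, apply_zpow]
      · change x (g₀ ((g₀' ^ (a.val.val : ℤ)) w₀)) = g (x ((g₀' ^ (a.val.val : ℤ)) w₀))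
        rw [h₀.apply_left hr₀' a, h2, hm.apply_left hr' a]
    exact LinearMap.congr_fun this
  · have hlink : ∀ {a a' : V ≃ₗ[F] V} {v : V}, IsMarked a a' v k k' c →
        (a ^ (k : ℤ)) v = c⁻¹ • (a' ^ (k' : ℤ)) v := by
      intro a a' v h
      rw [h.link, smul_smul, inv_mul_cancel₀ h.c_ne, one_smul]
    have : (x : V →ₗ[F] V) ∘ₗ (g₀' : V →ₗ[F] V) = (g' : V →ₗ[F] V) ∘ₗ (x : V →ₗ[F] V) := by
      refine b₀.ext fun a => ?_
      rw [hb₀]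
      rcases a with a | a
      · change x (g₀' ((g₀ ^ (a.val : ℤ)) w₀)) = g' (x ((g₀ ^ (a.val : ℤ)) w₀))
        rcases h₀.apply_right hr₀ a with h | h | h
        · rw [h1, h]
          exact h2 1
        · rw [h1, h, hlink h₀, hlink hm]
          simp only [map_smul]
          rw [apply_zpow, apply_zpow, h2]
        · rw [h, h1]
          -- The alternatives of `apply_right` need not correspond for the two duos, so the mixed
          -- cases are settled separately.
          rcases hm.apply_right hr a with h' | h' | h'
          · have h3 : g₀' w₀ = w₀ := by simpa [h'] using h
            have h4 := h2 1
            rw [zpow_one, zpow_one, h3] at h4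
            have h5 := h1 0
            simp only [zpow_zero, LinearEquiv.coe_one, id_eq] at h5
            simp [h', ← h4, h5]
          · have h3 := h1 k
            rw [h'] at h ⊢
            rw [hlink hm, map_smul, apply_zpow]
            rw [hlink h₀, map_smul, apply_zpow] at h
            have h4 := congrArg x h
            rw [map_smul, map_smul, h2, h2] at h4
            exact h4.symm
          · exact h'.symm
      · change x (g₀' ((g₀' ^ (a.val.val : ℤ)) w₀)) = g' (x ((g₀' ^ (a.val.val : ℤ)) w₀))
        rw [apply_zpow, h2, h2, apply_zpow]
    exact LinearMap.congr_fun this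

end IsMarked

/-! ### Orthogonality of the marked basis -/

section Orthogonality

variable {σ : F →+* F} (B : V →ₗ[F] V →ₛₗ[σ] F) {g g' : V ≃ₗ[F] V}

theorem isometry_zpow {B : V →ₗ[F] V →ₛₗ[σ] F} (hg : ∀ x y, B (g x) (g y) = B x y) (n : ℤ)
    (x y : V) : B ((g ^ n) x) ((g ^ n) y) = B x y := by
  have h1 : ∀ (a : V ≃ₗ[F] V) (m : ℕ), (∀ x y, B (a x) (a y) = B x y) →
      ∀ x y, B ((a ^ m) x) ((a ^ m) y) = B x y := by
    intro a m ha
    induction m with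
    | zero => exact fun x y => rfl
    | succ m ih =>
      intro x y
      rw [pow_succ, LinearEquiv.mul_apply, LinearEquiv.mul_apply, ih, ha]
  have h2 : ∀ x y, B (g⁻¹ x) (g⁻¹ y) = B x y := by
    intro x y
    have h3 : ∀ v, g (g⁻¹ v) = v := fun v => g.apply_symm_apply v
    rw [← hg, h3, h3]
  obtain ⟨m, rfl | rfl⟩ := n.eq_nat_or_neg
  · rw [zpow_natCast]; exact h1 g m hg x y
  · rw [zpow_neg, zpow_natCast, ← inv_pow]; exact h1 _ m h2 x y

theorem isometry_zpow_sub {B : V →ₗ[F] V →ₛₗ[σ] F} (hg : ∀ x y, B (g x) (g y) = B x y) (i j : ℤ)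
    (w : V) : B ((g ^ i) w) ((g ^ j) w) = B ((g ^ (i - j)) w) w := by
  rw [← isometry_zpow hg j ((g ^ (i - j)) w) w, ← LinearEquiv.mul_apply, ← zpow_add]
  congr 4
  ring

theorem eq_apply_zpow_of_fixed {x : V} (hx : g x = x) (n : ℤ) : (g ^ n) x = x := by
  have h : g ∈ MulAction.stabilizer (V ≃ₗ[F] V) x := hx
  exact zpow_mem h n

variable {w : V} {k k' : ℕ} {c : F} {r r' : ℕ}

/-- The basis attached to marked isometries of a reflexive sesquilinear form is orthogonal. -/
theorem IsMarked.orthogonal (hm : IsMarked g g' w k k' c) (hr : orderOf g = r)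
    (hr' : orderOf g' = r') (hrp : r.Prime) (hr5 : 5 ≤ r) (hr3 : 3 ≤ r') (hc : c ≠ 1)
    (hrefl : ∀ x y, B x y = 0 → B y x = 0)
    (hg : ∀ x y, B (g x) (g y) = B x y) (hg' : ∀ x y, B (g' x) (g' y) = B x y)
    (a a' : MarkedIndex r r' k') (haa' : a ≠ a') :
    B (markedFamily g g' w r r' k' a) (markedFamily g g' w r r' k' a') = 0 := by
  subst hr hr'
  have hk := hm.k_lt
  have hk0 := hm.k_pos
  have hk' := hm.k'_lt
  have hk0' := hm.k'_pos
  -- a line outside the support of `g`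
  obtain ⟨j₀, hj₀, hj₁⟩ : ∃ j : ℤ, ¬ (orderOf g' : ℤ) ∣ j ∧ ¬ (orderOf g' : ℤ) ∣ j - k' := by
    have hnd : ∀ z : ℤ, 0 < |z| → |z| < orderOf g' → ¬ (orderOf g' : ℤ) ∣ z := by
      intro z h0 h1 hd
      have := Int.eq_zero_of_abs_lt_dvd hd h1
      simp [this] at h0
    by_cases h : k' = 1
    · refine ⟨2, hnd 2 (by norm_num) (by norm_num; omega), hnd _ ?_ ?_⟩ <;> subst h <;> norm_num
      omega
    · refine ⟨1, hnd 1 (by norm_num) (by norm_num; omega), hnd _ ?_ ?_⟩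
      · rw [abs_pos]; omega
      · rw [abs_lt]; omega
  -- the values `B (g ^ i w) w` off `0, k` agree with those of `B (g ^ i w) (g' ^ j w)`
  have hleft : ∀ i j : ℤ, ¬ (orderOf g' : ℤ) ∣ j → ¬ (orderOf g' : ℤ) ∣ j - k' →
      B ((g ^ i) w) ((g' ^ j) w) = B w ((g' ^ j) w) := by
    intro i j h0 h1
    conv_lhs => rw [← eq_apply_zpow_of_fixed (hm.fix_left j h0 h1) i]
    exact isometry_zpow hg i _ _
  have hright : ∀ i j : ℤ, ¬ (orderOf g : ℤ) ∣ i → ¬ (orderOf g : ℤ) ∣ i - k →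
      B ((g ^ i) w) ((g' ^ j) w) = B ((g ^ i) w) w := by
    intro i j h0 h1
    conv_lhs => rw [← eq_apply_zpow_of_fixed (hm.fix_right i h0 h1) j]
    exact isometry_zpow hg' j _ _
  -- For `i` different from `0` and `k` modulo the order, `g'` fixes `(g ^ i) w`, while `g` fixes
  -- `(g' ^ j₀) w`. So these products all have one common value.
  have hκ : ∀ i : ℤ, ¬ (orderOf g : ℤ) ∣ i → ¬ (orderOf g : ℤ) ∣ i - k →
      B ((g ^ i) w) w = B w ((g' ^ j₀) w) := by
    intro i h0 h1
    rw [← hright i j₀ h0 h1, hleft i j₀ hj₀ hj₁]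
  -- Invariance under `g'` replaces the second `w` by `(g' ^ k') w = c • (g ^ k) w`; invariance
  -- under `g` then moves the exponent by `k`.
  have hshift : ∀ i : ℤ, ¬ (orderOf g : ℤ) ∣ i → ¬ (orderOf g : ℤ) ∣ i - k →
      B ((g ^ i) w) w = σ c * B ((g ^ (i - k)) w) w := by
    intro i h0 h1
    rw [← hright i k' h0 h1, hm.link, map_smulₛₗ, smul_eq_mul, isometry_zpow_sub hg]
  have hσc : σ c ≠ 1 := fun h => hc (σ.injective (h.trans σ.map_one.symm))
  have hσc0 : σ c ≠ 0 := (map_ne_zero σ).2 hm.c_ne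
  have hknd : ¬ (orderOf g : ℤ) ∣ k := fun h =>
    absurd (Nat.le_of_dvd hk0 (Int.natCast_dvd_natCast.1 h)) (by omega)
  have hprime : Prime (orderOf g : ℤ) := Nat.prime_iff_prime_int.1 hrp
  have hmul : ∀ m : ℤ, 0 < m → m < orderOf g → ¬ (orderOf g : ℤ) ∣ m * k := by
    intro m h0 h1 hd
    rcases hprime.dvd_or_dvd hd with h | h
    · exact absurd (Int.le_of_dvd h0 h) (by omega)
    · exact hknd h
  -- At `i = 3 k` the common value equals `σ c` times itself. The multiples `k`, `2 k`, `3 k` must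
  -- be nonzero modulo the prime `r`, whence `5 ≤ r`.
  have hκ0 : B w ((g' ^ j₀) w) = 0 := by
    have h3 : ¬ (orderOf g : ℤ) ∣ 3 * k := hmul 3 (by norm_num) (by omega)
    have h2 : ¬ (orderOf g : ℤ) ∣ 3 * k - k := by
      have := hmul 2 (by norm_num) (by omega)
      rwa [show (3 * k - k : ℤ) = 2 * k by ring]
    have h1 : ¬ (orderOf g : ℤ) ∣ 3 * k - k - k := by
      rwa [show (3 * k - k - k : ℤ) = k by ring]
    have h4 := hshift _ h3 h2
    rw [hκ _ h3 h2, hκ _ h2 h1] at h4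
    have h5 : (1 - σ c) * B w ((g' ^ j₀) w) = 0 := by rw [sub_mul, one_mul, ← h4, sub_self]
    exact (mul_eq_zero.1 h5).resolve_left (sub_ne_zero.2 hσc.symm)
  have hC : ∀ i : ℤ, ¬ (orderOf g : ℤ) ∣ i → B ((g ^ i) w) w = 0 := by
    intro i h0
    by_cases h1 : (orderOf g : ℤ) ∣ i - k
    · have h2 : ¬ (orderOf g : ℤ) ∣ 2 * k := hmul 2 (by norm_num) (by omega)
      have h3 : ¬ (orderOf g : ℤ) ∣ 2 * k - k := by rwa [show (2 * k - k : ℤ) = k by ring]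
      have h4 := hshift _ h2 h3
      rw [hκ _ h2 h3, hκ0, show (2 * k - k : ℤ) = k by ring] at h4
      have h5 : g ^ i = g ^ (k : ℤ) := by
        rw [← sub_add_cancel i (k : ℤ), zpow_add, orderOf_dvd_iff_zpow_eq_one.1 h1, one_mul]
      rw [h5]
      exact (mul_eq_zero.1 h4.symm).resolve_left hσc0
    · rw [hκ i h0 h1, hκ0]
  obtain ⟨i₀, hi₀, hi₁⟩ : ∃ i : ℤ, ¬ (orderOf g : ℤ) ∣ i ∧ ¬ (orderOf g : ℤ) ∣ i - k :=
    ⟨2 * k, hmul 2 (by norm_num) (by omega), by rwa [show (2 * k - k : ℤ) = k by ring]⟩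
  have hmix : ∀ i j : ℤ, ¬ (orderOf g' : ℤ) ∣ j → ¬ (orderOf g' : ℤ) ∣ j - k' →
      B ((g ^ i) w) ((g' ^ j) w) = 0 := by
    intro i j h0 h1
    rw [hleft i j h0 h1, ← hleft i₀ j h0 h1, hright i₀ j hi₀ hi₁, hC i₀ hi₀]
  have hC' : ∀ j : ℤ, ¬ (orderOf g' : ℤ) ∣ j → B ((g' ^ j) w) w = 0 := by
    intro j h0
    by_cases h1 : (orderOf g' : ℤ) ∣ j - k'
    · have h5 : g' ^ j = g' ^ (k' : ℤ) := by
        rw [← sub_add_cancel j (k' : ℤ), zpow_add, orderOf_dvd_iff_zpow_eq_one.1 h1, one_mul]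
      rw [h5, hm.link, map_smul, LinearMap.smul_apply, hC k hknd, smul_zero]
    · exact hrefl _ _ (hmix 0 j h0 h1)
  have hsmall : ∀ {n : ℕ} {x y : ℕ}, x < n → y < n → x ≠ y → ¬ (n : ℤ) ∣ (x : ℤ) - y := by
    intro n x y hx hy hne hd
    have := Int.eq_zero_of_abs_lt_dvd hd (by rw [abs_lt]; omega)
    omega
  have hinr : ∀ a : {j : Fin (orderOf g') // j.val ≠ 0 ∧ j.val ≠ k'},
      ¬ (orderOf g' : ℤ) ∣ (a.val.val : ℤ) ∧ ¬ (orderOf g' : ℤ) ∣ (a.val.val : ℤ) - k' := by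
    intro a
    refine ⟨?_, hsmall a.val.isLt hk' a.2.2⟩
    have := hsmall a.val.isLt (show 0 < orderOf g' by omega) a.2.1
    simpa using this
  rcases a with a | a <;> rcases a' with a' | a'
  · change B ((g ^ (a.val : ℤ)) w) ((g ^ (a'.val : ℤ)) w) = 0
    rw [isometry_zpow_sub hg]
    refine hC _ (hsmall a.isLt a'.isLt fun h => haa' ?_)
    rw [Fin.ext h]
  · exact hmix _ _ (hinr a').1 (hinr a').2
  · exact hrefl _ _ (hmix _ _ (hinr a).1 (hinr a).2)
  · change B ((g' ^ (a.val.val : ℤ)) w) ((g' ^ (a'.val.val : ℤ)) w) = 0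
    rw [isometry_zpow_sub hg']
    refine hC' _ (hsmall a.val.isLt a'.val.isLt fun h => haa' ?_)
    rw [Subtype.ext (Fin.ext h)]

end Orthogonality

end MarkedBasis

/-! ### Forms and the structure of the preserved decompositions -/

section Structure

variable {F V : Type*} [Field F] [AddCommGroup V] [Module F V]

theorem ClassicalForm.IsClassical.card_eq {Φ : ClassicalForm F V} {q : ℕ} (h : Φ.IsClassical q) :
    Nat.card F = q ^ Φ.type.u := by
  cases Φ with
  | linear => simpa [ClassicalForm.type, ClassicalType.u] using! h
  | unitary σ B => exact h.1
  | symplectic B => simpa [ClassicalForm.type, ClassicalType.u] using! h.1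
  | orthogonal ε Q => simpa [ClassicalForm.type, ClassicalType.u] using! h.1

theorem two_eq_zero_of_even_card [Finite F] (h : Even (Nat.card F)) : (2 : F) = 0 := by
  have := Fintype.ofFinite F
  rw [Nat.card_eq_fintype_card] at h
  have h1 : ringChar F = 2 := FiniteField.even_card_iff_char_two.2 (Nat.even_iff.1 h)
  have h2 := ringChar.Nat.cast_ringChar (R := F)
  rw [h1] at h2
  exact_mod_cast h2

/-- The sesquilinear form that belongs to a classical form which is not linear. -/
theorem ClassicalForm.IsClassical.exists_form [Finite F] {Φ : ClassicalForm F V} {q : ℕ}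
    (h : Φ.IsClassical q) (hL : Φ.type ≠ .L) :
    ∃ (σ : F →+* F) (B : V →ₗ[F] V →ₛₗ[σ] F), (∀ x y, B x y = 0 → B y x = 0) ∧
      (∀ x, (∀ y, B x y = 0) → x = 0) ∧
      (∀ g ∈ Φ.isometryGroup, ∀ x y, B (g x) (g y) = B x y) ∧
      (∀ W : Submodule F V, Φ.NondegenerateOn W ↔ ∀ x ∈ W, (∀ y ∈ W, B x y = 0) → x = 0) ∧
      ((Φ.type = .Sp ∨ ((∃ ε : ℤˣ, Φ.type = .O ε) ∧ Even q)) → ∀ x, B x x = 0) := by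
  cases Φ with
  | linear => exact absurd rfl hL
  | unitary σ B =>
    refine ⟨σ, B, fun x y hxy => ?_, fun x hx => h.2.2.2 x trivial fun y _ => hx y,
      fun g hg => hg, fun W => Iff.rfl, ?_⟩
    · rw [h.2.2.1 y x, hxy, map_zero]
    · rintro (h | ⟨⟨ε, h⟩, -⟩) <;> exact ClassicalType.noConfusion h
  | symplectic B =>
    refine ⟨RingHom.id F, B, fun x y hxy => ?_, fun x hx => h.2.2 x trivial fun y _ => hx y,
      fun g hg => hg, fun W => Iff.rfl, fun _ => h.2.1⟩
    have h1 := h.2.1 (x + y)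
    simp only [map_add, LinearMap.add_apply, h.2.1, hxy, add_zero, zero_add] at h1
    exact h1
  | orthogonal ε Q =>
    refine ⟨RingHom.id F, Q.polarBilin, fun x y hxy => ?_,
      fun x hx => h.2.2.1 x trivial fun y _ => hx y, fun g hg x y => ?_, fun W => Iff.rfl, ?_⟩
    · rw [QuadraticMap.polarBilin_apply_apply] at hxy ⊢
      rw [QuadraticMap.polar_comm, hxy]
    · rw [QuadraticMap.polarBilin_apply_apply, QuadraticMap.polarBilin_apply_apply,
        QuadraticMap.polar, QuadraticMap.polar, ← map_add, hg, hg, hg]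
    · rintro (h' | ⟨-, hq⟩) x
      · exact ClassicalType.noConfusion h'
      · rw [QuadraticMap.polarBilin_apply_apply, QuadraticMap.polar_self, two_nsmul, ← two_mul,
          two_eq_zero_of_even_card (h.1 ▸ hq), zero_mul]

theorem conjClass_subset {G : Subgroup (V ≃ₗ[F] V)} {g h : V ≃ₗ[F] V} (hg : g ∈ G)
    (hh : h ∈ conjClass G g) : h ∈ G ∧ orderOf h = orderOf g := by
  obtain ⟨x, hx, rfl⟩ := hh
  exact ⟨G.mul_mem (G.mul_mem hx hg) (G.inv_mem hx), orderOf_conj_eq x g⟩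

/-- The structure of the decompositions preserved by an irreducible stingray duo. -/
theorem imprimitive_structure [Finite F] [FiniteDimensional F V]
    {Φ : ClassicalForm F V} {q : ℕ} (hΦ : Φ.IsClassical q) {e₁ e₂ r₁ r₂ : ℕ}
    (he₂ : 2 ≤ e₂) (he : e₂ ≤ e₁)
    (hd : Module.finrank F V = e₁ + e₂) (hd8 : 8 < e₁ + e₂)
    (hr₁ : IsPrimitivePrimeDivisor r₁ (q ^ Φ.type.u) e₁)
    (hr₂ : IsPrimitivePrimeDivisor r₂ (q ^ Φ.type.u) e₂)
    {g₁ g₂ : V ≃ₗ[F] V} (hg₁ : g₁ ∈ Φ.isometryGroup) (hg₂ : g₂ ∈ Φ.isometryGroup)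
    (ho₁ : orderOf g₁ = r₁) (ho₂ : orderOf g₂ = r₂)
    {p : (V ≃ₗ[F] V) × (V ≃ₗ[F] V)} (hp : p ∈ irreducibleDuos Φ.isometryGroup e₁ e₂ g₁ g₂)
    {b : ℕ} {W : Fin b → Submodule F V} (hb : 2 ≤ b) (hW : IsDirectDecomposition W)
    (hstab : Subgroup.closure {p.1, p.2} ≤ decompositionStabilizer W) :
    (r₁ = e₁ + 1 ∧ r₂ = e₂ + 1) ∧ (b = e₁ + e₂ ∧ (∀ i, Module.finrank F (W i) = 1) ∧
      ∀ i, Φ.NondegenerateOn (W i)) ∧ ¬ ImprimitiveExcluded Φ.type q e₁ e₂ r₁ r₂ ∧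
      ∃ (w : V) (k k' : ℕ) (c : F), c ≠ 1 ∧ IsMarked p.1 p.2 w k k' c := by
  obtain ⟨⟨hp1, hp2, -, -, U, U', hU, hU', -⟩, hirr⟩ := hp
  obtain ⟨hpG1, hpo1⟩ := conjClass_subset hg₁ hp1
  obtain ⟨hpG2, hpo2⟩ := conjClass_subset hg₂ hp2
  rw [ho₁] at hpo1
  rw [ho₂] at hpo2
  have hcard := hΦ.card_eq
  have hF : 1 < Nat.card F := Finite.one_lt_card
  have hN : 1 ≤ q ^ Φ.type.u := by omega
  obtain ⟨hre₁, hre₂, hbd, hdim, w, k, k', c, hm, hlines⟩ := exists_marked hU hU' hr₁.1 hr₂.1 hpo1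
    hpo2 (by omega) he₂ (hr₁.succ_le hN (by omega)) (hr₂.succ_le hN (by omega)) hd hirr hb hW hstab
  have hdr : Module.finrank F V + 2 = r₁ + r₂ := by omega
  have hc : c ≠ 1 := hm.c_ne_one hpo1 hpo2 hdr (by omega) hirr
  obtain ⟨bs, hbs⟩ := hm.exists_basis hpo1 hpo2 hdr hirr
  have horth : ∀ {σ : F →+* F} {B : V →ₗ[F] V →ₛₗ[σ] F}, (∀ x y, B x y = 0 → B y x = 0) →
      (∀ g ∈ Φ.isometryGroup, ∀ x y, B (g x) (g y) = B x y) → ∀ a a', a ≠ a' →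
      B (bs a) (bs a') = 0 := by
    intro σ B hrefl hinv
    rw [hbs]
    exact hm.orthogonal B hpo1 hpo2 hr₁.1 (by omega) (by omega) hc hrefl (hinv _ hpG1) (hinv _ hpG2)
  -- An isotropic vector of an orthogonal basis would lie in the radical.
  have hnondeg : ∀ {σ : F →+* F} {B : V →ₗ[F] V →ₛₗ[σ] F}, (∀ x y, B x y = 0 → B y x = 0) →
      (∀ x, (∀ y, B x y = 0) → x = 0) →
      (∀ g ∈ Φ.isometryGroup, ∀ x y, B (g x) (g y) = B x y) → ∀ a, B (bs a) (bs a) ≠ 0 := by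
    intro σ B hrefl hnd hinv a h0
    apply bs.ne_zero a
    refine hnd _ fun y => ?_
    rw [← bs.sum_repr y, map_sum]
    refine Finset.sum_eq_zero fun a' _ => ?_
    rw [map_smulₛₗ]
    by_cases h : a = a'
    · rw [← h, h0, smul_zero]
    · rw [horth hrefl hinv a a' h, smul_zero]
  have hline : ∀ i, ∃ a, bs a ∈ W i := by
    intro i
    obtain ⟨n, h | h⟩ := hlines i
    · obtain ⟨a, ha⟩ := hm.zpow_left (r' := r₂) hpo1 n
      refine ⟨Sum.inl a, ?_⟩
      rw [hbs, ← (ha k').1, zpow_natCast]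
      exact h
    · rw [← zpow_natCast] at h
      rcases hm.zpow_right (r := r₁) hpo2 n with ⟨-, h'⟩ | ⟨-, h'⟩ | ⟨a, -, -, h', -⟩
      · obtain ⟨a, ha⟩ := hm.zpow_left (r' := r₂) hpo1 0
        refine ⟨Sum.inl a, ?_⟩
        rw [hbs, ← (ha k').1]
        rw [h'] at h
        exact h
      · obtain ⟨a, ha⟩ := hm.zpow_left (r' := r₂) hpo1 k
        refine ⟨Sum.inl a, ?_⟩
        rw [hbs, ← (ha k').1]
        rw [h'] at h
        exact ((W i).smul_mem_iff hm.c_ne).1 h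
      · refine ⟨Sum.inr a, ?_⟩
        rw [hbs, ← h']
        exact h
  refine ⟨⟨hre₁, hre₂⟩, ⟨hbd, hdim, fun i => ?_⟩, ?_, w, k, k', c, hc, hm⟩
  · by_cases hL : Φ.type = .L
    · cases Φ with
      | linear => trivial
      | unitary σ B => exact ClassicalType.noConfusion hL
      | symplectic B => exact ClassicalType.noConfusion hL
      | orthogonal ε Q => exact ClassicalType.noConfusion hL
    · obtain ⟨σ, B, hrefl, hnd, hinv, hW', -⟩ := hΦ.exists_form hL
      rw [hW']
      intro x hx hxy
      obtain ⟨a, ha⟩ := hline i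
      obtain ⟨t, ht⟩ := (finrank_eq_one_iff_of_nonzero' (⟨_, ha⟩ : W i)
        (fun h => bs.ne_zero a (congrArg Subtype.val h))).1 (hdim i) ⟨x, hx⟩
      have ht' : t • bs a = x := congrArg Subtype.val ht
      have h0 := hxy _ ha
      rw [← ht', map_smul, LinearMap.smul_apply, smul_eq_mul] at h0
      rw [← ht', (mul_eq_zero.1 h0).resolve_right (hnondeg hrefl hnd hinv a), zero_smul]
  · have hev₁ := hr₁.even_of_eq_succ (by omega) hre₁
    have hev₂ := hr₂.even_of_eq_succ (by omega) hre₂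
    rintro (hX | h2 | (h | h) | hodd)
    · have hL : Φ.type ≠ .L := by
        rintro hL
        rw [hL] at hX
        rcases hX with h | ⟨⟨ε, h⟩, -⟩ <;> exact ClassicalType.noConfusion h
      obtain ⟨σ, B, hrefl, hnd, hinv, -, hiso⟩ := hΦ.exists_form hL
      have a : MarkedIndex r₁ r₂ k' := Sum.inl ⟨0, hr₁.1.pos⟩
      exact hnondeg hrefl hnd hinv a (hiso hX _)
    · rw [← hcard] at h2
      have := Fintype.ofFinite F
      rw [Nat.card_eq_fintype_card] at h2
      classical
      -- Since `c` is neither `0` nor `1`, the field has at least three elements.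
      have h3 : ({0, 1, c} : Finset F).card = 3 := by
        rw [Finset.card_eq_three]
        exact ⟨0, 1, c, zero_ne_one, hm.c_ne.symm, hc.symm, rfl⟩
      have := Finset.card_le_univ ({0, 1, c} : Finset F)
      omega
    · omega
    · omega
    · exact (Nat.not_odd_iff_even.2 (hev₁.add hev₂)) hodd

end Structure

/-! ### Upper bound for the number of imprimitive duos -/

section Numerator

variable {F V : Type*} [Field F] [AddCommGroup V] [Module F V]

namespace IsMarked

variable {g g' : V ≃ₗ[F] V} {w : V} {k k' : ℕ} {c : F}

theorem smul (hm : IsMarked g g' w k k' c) {a : F} (ha : a ≠ 0) :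
    IsMarked g g' (a • w) k k' c where
  k_pos := hm.k_pos
  k_lt := hm.k_lt
  k'_pos := hm.k'_pos
  k'_lt := hm.k'_lt
  w_ne := smul_ne_zero ha hm.w_ne
  c_ne := hm.c_ne
  link := by rw [map_smul, map_smul, hm.link, smul_comm]
  fix_left j h0 h1 := by rw [map_smul, map_smul, hm.fix_left j h0 h1]
  fix_right j h0 h1 := by rw [map_smul, map_smul, hm.fix_right j h0 h1]

/-- The marking of the other common line. -/
theorem swap (hm : IsMarked g g' w k k' c) :
    IsMarked g g' ((g ^ (k : ℤ)) w) (orderOf g - k) (orderOf g' - k') c⁻¹ := by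
  have hk := hm.k_lt
  have hk0 := hm.k_pos
  have hk' := hm.k'_lt
  have hk0' := hm.k'_pos
  have hlink : (g ^ (k : ℤ)) w = c⁻¹ • (g' ^ (k' : ℤ)) w := by
    rw [hm.link, smul_smul, inv_mul_cancel₀ hm.c_ne, one_smul]
  have hz : ∀ (a : V ≃ₗ[F] V) (i j : ℤ) (v : V), (a ^ i) ((a ^ j) v) = (a ^ (i + j)) v := by
    intro a i j v
    rw [zpow_add, LinearEquiv.mul_apply]
  refine ⟨by omega, by omega, by omega, by omega, ?_, inv_ne_zero hm.c_ne, ?_, ?_, ?_⟩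
  · exact fun h => hm.w_ne ((LinearEquiv.map_eq_zero_iff _).1 h)
  · rw [hz]
    conv_lhs => rw [hlink, map_smul, hz]
    rw [Nat.cast_sub hk.le, Nat.cast_sub hk'.le, sub_add_cancel, sub_add_cancel, zpow_natCast,
      zpow_natCast, pow_orderOf_eq_one, pow_orderOf_eq_one]
  · intro j h0 h1
    rw [hlink, map_smul, map_smul, hz, hm.fix_left]
    · intro h
      apply h1
      rw [Nat.cast_sub hk'.le, show j - ((orderOf g' : ℤ) - k') = j + k' - orderOf g' by ring]
      exact dvd_sub_self_right.2 h
    · rwa [add_sub_cancel_right]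
  · intro j h0 h1
    rw [hz, hm.fix_right]
    · intro h
      apply h1
      rw [Nat.cast_sub hk.le, show j - ((orderOf g : ℤ) - k) = j + k - orderOf g by ring]
      exact dvd_sub_self_right.2 h
    · rwa [add_sub_cancel_right]

end IsMarked

theorem finite_linearEquiv [Finite V] : Finite (V ≃ₗ[F] V) :=
  DFunLike.finite _

/-- Counting marked pairs, given that the parameters `k`, `k'`, `τ c w` determine them up to
conjugation. -/
theorem two_mul_card_le_of_marked [Finite F] [FiniteDimensional F V] {r₁ r₂ : ℕ}
    (hd : Module.finrank F V + 2 = r₁ + r₂)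
    (G : Subgroup (V ≃ₗ[F] V)) (S : Set ((V ≃ₗ[F] V) × (V ≃ₗ[F] V)))
    (ho : ∀ p ∈ S, orderOf p.1 = r₁ ∧ orderOf p.2 = r₂)
    (hirr : ∀ p ∈ S, ActsIrreducibly (Subgroup.closure {p.1, p.2}))
    (hex : ∀ p ∈ S, ∃ (w : V) (k k' : ℕ) (c : F), IsMarked p.1 p.2 w k k' c)
    (τ : F → V → F)
    (hτ : ∀ p ∈ S, ∀ w k k' c, IsMarked p.1 p.2 w k k' c → τ c w ≠ 0)
    (hconj : ∀ p ∈ S, ∀ p₀ ∈ S, ∀ w w₀ k k' c c₀, IsMarked p.1 p.2 w k k' c →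
      IsMarked p₀.1 p₀.2 w₀ k k' c₀ → τ c w = τ c₀ w₀ →
      ∃ x ∈ G, x * p₀.1 * x⁻¹ = p.1 ∧ x * p₀.2 * x⁻¹ = p.2 ∧ x w₀ = w) :
    2 * S.ncard ≤ Nat.card G * ((r₁ - 1) * (r₂ - 1)) := by
  classical
  have : Finite V := Module.finite_of_finite F
  have : Finite (V ≃ₗ[F] V) := finite_linearEquiv
  have := Fintype.ofFinite F
  have := Fintype.ofFinite V
  have := Fintype.ofFinite (V ≃ₗ[F] V)
  let M : Finset (((V ≃ₗ[F] V) × (V ≃ₗ[F] V)) × V) :=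
    Finset.univ.filter fun z => z.1 ∈ S ∧ ∃ (k k' : ℕ) (c : F), IsMarked z.1.1 z.1.2 z.2 k k' c
  have hM : ∀ z, z ∈ M ↔ z.1 ∈ S ∧ ∃ (k k' : ℕ) (c : F), IsMarked z.1.1 z.1.2 z.2 k k' c := by
    intro z; simp [M]
  -- The pairs (duo, marked vector) are counted twice. Here each duo contributes the nonzero
  -- multiples of `w` and of `(g ^ k) w`, which lie on different lines.
  have hlower : 2 * (Fintype.card F - 1) * S.ncard ≤ M.card := by
    have hmaps : Set.MapsTo Prod.fst (M : Set (((V ≃ₗ[F] V) × (V ≃ₗ[F] V)) × V))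
        (S.toFinset : Set _) := by
      intro z hz
      simpa using ((hM z).1 hz).1
    rw [Finset.card_eq_sum_card_fiberwise hmaps, Set.ncard_eq_toFinset_card', mul_comm]
    refine (Finset.card_nsmul_le_sum _ _ _ fun p hp => ?_)
    have hp' : p ∈ S := by simpa using hp
    obtain ⟨w, k, k', c, hm⟩ := hex p hp'
    obtain ⟨b, hb⟩ := hm.exists_basis (ho p hp').1 (ho p hp').2 hd (hirr p hp')
    have hcard : (Finset.univ : Finset (Bool × Fˣ)).card = 2 * (Fintype.card F - 1) := by
      rw [Finset.card_univ, Fintype.card_prod, Fintype.card_bool, Fintype.card_units]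
    rw [← hcard]
    have hk := (ho p hp').1 ▸ hm.k_lt
    have hne : (Sum.inl ⟨0, by omega⟩ : MarkedIndex r₁ r₂ k') ≠ Sum.inl ⟨k, hk⟩ := by
      intro h
      have := congrArg Fin.val (Sum.inl_injective h)
      exact hm.k_pos.ne this
    have h0 : b (Sum.inl ⟨0, by omega⟩) = w := by rw [hb]; rfl
    have h1 : b (Sum.inl ⟨k, hk⟩) = (p.1 ^ (k : ℤ)) w := by rw [hb]; rfl
    have hcoord : ∀ a a' : F, a • w = a' • (p.1 ^ (k : ℤ)) w → a = 0 := by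
      intro a a' h
      rw [← h1, ← h0] at h
      have := congrArg (fun v => b.repr v (Sum.inl ⟨0, by omega⟩)) h
      simpa [Finsupp.single_apply, hne.symm] using this
    refine Finset.card_le_card_of_injOn
      (fun z => (p, (z.2 : F) • (if z.1 then w else (p.1 ^ (k : ℤ)) w))) ?_ ?_
    · rintro ⟨t, a⟩ -
      simp only [Finset.coe_filter, Set.mem_ofPred_eq, hM, and_true]
      refine ⟨hp', ?_⟩
      cases t
      · exact ⟨_, _, _, hm.swap.smul a.ne_zero⟩
      · exact ⟨_, _, _, hm.smul a.ne_zero⟩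
    · rintro ⟨t, a⟩ - ⟨t', a'⟩ - h
      have h := congrArg Prod.snd h
      cases t <;> cases t'
      · have := smul_left_injective F hm.swap.w_ne h
        exact Prod.ext rfl (Units.ext this)
      · exact absurd (hcoord _ _ h.symm) a'.ne_zero
      · exact absurd (hcoord _ _ h) a.ne_zero
      · have := smul_left_injective F hm.w_ne h
        exact Prod.ext rfl (Units.ext this)
  have hkey : ∀ z : M, ∃ (k k' : ℕ) (c : F), IsMarked z.1.1.1 z.1.1.2 z.1.2 k k' c := fun z =>
    ((hM z).1 z.2).2
  choose k k' c hm using hkey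
  have hMS : ∀ z : M, z.1.1 ∈ S := fun z => ((hM z).1 z.2).1
  let key : M → ℕ × ℕ × F := fun z => (k z, k' z, τ (c z) z.1.2)
  -- There are at most `(r₁ - 1) (r₂ - 1) (|F| - 1)` keys, and by `hconj` the pairs with the same
  -- key lie in one `G`-orbit.
  have hupper : M.card ≤ Nat.card G * ((r₁ - 1) * ((r₂ - 1) * (Fintype.card F - 1))) := by
    have h1 := Finset.card_le_mul_card_image (f := key) Finset.univ (Nat.card G) ?_
    · rw [Finset.card_univ, Fintype.card_coe] at h1
      refine h1.trans (Nat.mul_le_mul_left _ ?_)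
      have h2 : Finset.univ.image key ⊆
          Finset.Icc 1 (r₁ - 1) ×ˢ Finset.Icc 1 (r₂ - 1) ×ˢ Finset.univ.erase (0 : F) := by
        intro y hy
        obtain ⟨z, -, rfl⟩ := Finset.mem_image.1 hy
        have hz := hm z
        have := hz.k_pos
        have := (ho _ (hMS z)).1 ▸ hz.k_lt
        have := hz.k'_pos
        have := (ho _ (hMS z)).2 ▸ hz.k'_lt
        simp only [Finset.mem_product, Finset.mem_Icc, Finset.mem_erase, Finset.mem_univ, and_true,
          key]
        exact ⟨by omega, by omega, hτ _ (hMS z) _ _ _ _ hz⟩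
      refine (Finset.card_le_card h2).trans (le_of_eq ?_)
      rw [Finset.card_product, Finset.card_product, Nat.card_Icc, Nat.card_Icc,
        Finset.card_erase_of_mem (Finset.mem_univ _), Finset.card_univ]
      simp
    · intro y hy
      obtain ⟨z₀, -, rfl⟩ := Finset.mem_image.1 hy
      have hG : Nat.card G = (Finset.univ : Finset G).card := by
        rw [Nat.card_eq_fintype_card, Finset.card_univ]
      rw [hG]
      -- The value `z₀` in the second branch is only a default; surjectivity uses the first branch.
      refine Finset.card_le_card_of_surjOn (s := (Finset.univ : Finset G))
        (fun x => if h : (((x : V ≃ₗ[F] V) * z₀.1.1.1 * (x : V ≃ₗ[F] V)⁻¹,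
          (x : V ≃ₗ[F] V) * z₀.1.1.2 * (x : V ≃ₗ[F] V)⁻¹), (x : V ≃ₗ[F] V) z₀.1.2) ∈ M
          then ⟨_, h⟩ else z₀) ?_
      intro z hz
      simp only [Finset.coe_filter, Finset.mem_univ, true_and, Set.mem_ofPred_eq, key,
        Prod.mk.injEq] at hz
      obtain ⟨hz1, hz2, hz3⟩ := hz
      have hmz := hm z
      rw [hz1, hz2] at hmz
      obtain ⟨x, hx, h1, h2, h3⟩ := hconj _ (hMS z) _ (hMS z₀) _ _ _ _ _ _ hmz (hm z₀) hz3
      refine ⟨⟨x, hx⟩, by simp, ?_⟩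
      have heq : (((x * z₀.1.1.1 * x⁻¹, x * z₀.1.1.2 * x⁻¹), x z₀.1.2) :
          ((V ≃ₗ[F] V) × (V ≃ₗ[F] V)) × V) = z.1 := by
        rw [h1, h2, h3]
      simp only [heq, Finset.coe_mem, dif_pos]
  have hq : 0 < Fintype.card F - 1 := by
    have := Fintype.one_lt_card (α := F)
    omega
  refine Nat.le_of_mul_le_mul_right ?_ hq
  calc 2 * S.ncard * (Fintype.card F - 1) = 2 * (Fintype.card F - 1) * S.ncard := by ring
    _ ≤ M.card := hlower
    _ ≤ _ := hupper
    _ = _ := by ring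

end Numerator

/-! ### Lower bound for the number of stingray duos -/

section Denominator

variable {F V : Type*} [Field F] [AddCommGroup V] [Module F V]

/-- The restrictions to `U` of the elements of `G` that commute with `g`. -/
def centralizerRestrictions (G : Subgroup (V ≃ₗ[F] V)) (g : V ≃ₗ[F] V) (U : Submodule F V) :
    Set (U →ₗ[F] V) :=
  {f | ∃ c ∈ G, c * g = g * c ∧ f = (c : V →ₗ[F] V) ∘ₗ U.subtype}

/-- The image of `g - 1` is a nonzero `g`-invariant subspace of `U`, hence all of `U`. -/
theorem IsStingrayOn.exists_sub_eq {e : ℕ} {g : V ≃ₗ[F] V} {U : Submodule F V}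
    (h : IsStingrayOn e g U) {y : V} (hy : y ∈ U) : ∃ z, g z - z = y := by
  let T : V →ₗ[F] V := (g : V →ₗ[F] V) - LinearMap.id
  have hT : ∀ v, T v = g v - v := fun v => rfl
  have hle : LinearMap.range T ≤ U := by
    rintro _ ⟨v, rfl⟩
    exact h.sub_mem v
  rcases h.irreducible (LinearMap.range T) hle (by
    rintro _ ⟨v, rfl⟩
    exact ⟨g v, by rw [hT, hT, map_sub]⟩) with h0 | h0
  · exfalso
    obtain ⟨v, -, hv⟩ := h.nontrivial
    have : T v ∈ LinearMap.range T := ⟨v, rfl⟩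
    rw [h0, Submodule.mem_bot, hT, sub_eq_zero] at this
    exact hv this
  · rw [← h0] at hy
    exact hy

theorem IsStingrayOn.map_eq_of_commute {e : ℕ} {g c : V ≃ₗ[F] V} {U : Submodule F V}
    (h : IsStingrayOn e g U) (hc : c * g = g * c) : ∀ x ∈ U, c x ∈ U := by
  intro x hx
  obtain ⟨z, rfl⟩ := h.exists_sub_eq hx
  have h1 : c (g z) = g (c z) := LinearEquiv.congr_fun hc z
  rw [map_sub, h1]
  exact h.sub_mem _

theorem fixedSpace_map_of_commute {g c : V ≃ₗ[F] V} (hc : c * g = g * c) :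
    ∀ x ∈ fixedSpace g, c x ∈ fixedSpace g := by
  intro x hx
  rw [mem_fixedSpace] at hx ⊢
  have h1 : c (g x) = g (c x) := LinearEquiv.congr_fun hc x
  rw [← h1, hx]

/-- A lower bound for the number of stingray duos, by means of a family of elements of `G` that lie
in different double cosets. -/
theorem card_mul_card_le_card_stingrayDuos [Finite F] [FiniteDimensional F V]
    (G : Subgroup (V ≃ₗ[F] V)) {e₁ e₂ : ℕ} (he : e₂ ≤ e₁) (hd : e₁ + e₂ = Module.finrank F V)
    {g₁ g₂ : V ≃ₗ[F] V} {U₁ U₂ : Submodule F V}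
    (h₁ : IsStingrayOn e₁ g₁ U₁) (h₂ : IsStingrayOn e₂ g₂ U₂)
    {N : Type*} [Finite N] (y : N → V ≃ₗ[F] V) (hyG : ∀ n, y n ∈ G)
    (hyU : ∀ n, U₁ ⊔ U₂.map (y n : V →ₗ[F] V) = ⊤)
    (hdist : ∀ n n' (f h : V ≃ₗ[F] V), f ∈ G → h ∈ G → f * g₁ = g₁ * f → h * g₂ = g₂ * h →
      (∀ x ∈ U₁, f x = x) → (∀ x ∈ U₂, h x = x) → y n' = f * y n * h → n = n')
    {z₁ z₂ : ℕ} (hz₁ : (centralizerRestrictions G g₁ U₁).ncard ≤ z₁)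
    (hz₂ : (centralizerRestrictions G g₂ U₂).ncard ≤ z₂) :
    Nat.card G * Nat.card N ≤ z₁ * z₂ * (stingrayDuos G e₁ e₂ g₁ g₂).ncard := by
  classical
  have : Finite V := Module.finite_of_finite F
  have : Finite (V ≃ₗ[F] V) := finite_linearEquiv
  have : Finite (U₁ →ₗ[F] V) := DFunLike.finite _
  have : Finite (U₂ →ₗ[F] V) := DFunLike.finite _
  have := Fintype.ofFinite N
  have := Fintype.ofFinite (V ≃ₗ[F] V)
  have := Fintype.ofFinite (U₁ →ₗ[F] V)
  have := Fintype.ofFinite (U₂ →ₗ[F] V)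
  let f : G × N → (V ≃ₗ[F] V) × (V ≃ₗ[F] V) := fun p =>
    ((p.1 : V ≃ₗ[F] V) * g₁ * (p.1 : V ≃ₗ[F] V)⁻¹,
      ((p.1 : V ≃ₗ[F] V) * y p.2) * g₂ * ((p.1 : V ≃ₗ[F] V) * y p.2)⁻¹)
  have hf : ∀ p, f p ∈ stingrayDuos G e₁ e₂ g₁ g₂ := by
    rintro ⟨x, n⟩
    refine ⟨⟨x, x.2, rfl⟩, ⟨x * y n, G.mul_mem x.2 (hyG n), rfl⟩, he, hd, _, _, h₁.conj x,
      h₂.conj _, ?_⟩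
    have h3 : (((x : V ≃ₗ[F] V) * y n : V ≃ₗ[F] V) : V →ₗ[F] V)
        = ((x : V ≃ₗ[F] V) : V →ₗ[F] V) ∘ₗ (y n : V →ₗ[F] V) := rfl
    rw [h3, Submodule.map_comp, ← Submodule.map_sup, hyU, Submodule.map_top]
    exact LinearEquiv.range _
  have hbound := Finset.card_le_mul_card_image (f := f) Finset.univ (z₁ * z₂) ?_
  · rw [Finset.card_univ, Fintype.card_prod, ← Nat.card_eq_fintype_card,
      ← Nat.card_eq_fintype_card] at hbound
    refine hbound.trans (Nat.mul_le_mul_left _ ?_)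
    rw [Set.ncard_eq_toFinset_card']
    refine Finset.card_le_card fun p hp => ?_
    obtain ⟨a, -, rfl⟩ := Finset.mem_image.1 hp
    simpa using hf a
  · intro p hp
    obtain ⟨⟨x₀, n₀⟩, -, rfl⟩ := Finset.mem_image.1 hp
    -- The fibre through `(x₀, n₀)` is parametrized by `x₀⁻¹ x`, which centralizes `g₁`, and `(x₀ y
    -- n₀)⁻¹ (x y n)`, which centralizes `g₂`. It is enough to know their restrictions to `U₁` and
    -- `U₂`.
    let c : G × N → V ≃ₗ[F] V := fun p => (x₀ : V ≃ₗ[F] V)⁻¹ * p.1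
    let k : G × N → V ≃ₗ[F] V := fun p => (y n₀)⁻¹ * c p * y p.2
    have hcG : ∀ p, c p ∈ G := fun p => G.mul_mem (G.inv_mem x₀.2) p.1.2
    have hkG : ∀ p, k p ∈ G := fun p =>
      G.mul_mem (G.mul_mem (G.inv_mem (hyG _)) (hcG p)) (hyG _)
    have hcc : ∀ p, f p = f (x₀, n₀) → c p * g₁ = g₁ * c p ∧ k p * g₂ = g₂ * k p := by
      intro p hp
      have hp1 : (p.1 : V ≃ₗ[F] V) * g₁ * (p.1 : V ≃ₗ[F] V)⁻¹ =
        (x₀ : V ≃ₗ[F] V) * g₁ * (x₀ : V ≃ₗ[F] V)⁻¹ := congrArg Prod.fst hp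
      have hp2 : ((p.1 : V ≃ₗ[F] V) * y p.2) * g₂ * ((p.1 : V ≃ₗ[F] V) * y p.2)⁻¹ =
        ((x₀ : V ≃ₗ[F] V) * y n₀) * g₂ * ((x₀ : V ≃ₗ[F] V) * y n₀)⁻¹ := congrArg Prod.snd hp
      constructor
      · rw [mul_inv_eq_iff_eq_mul] at hp1
        simp only [c]
        rw [mul_assoc, hp1]
        group
      · rw [mul_inv_eq_iff_eq_mul] at hp2
        have hk : k p = ((x₀ : V ≃ₗ[F] V) * y n₀)⁻¹ * ((p.1 : V ≃ₗ[F] V) * y p.2) := by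
          simp only [k, c]; group
        rw [hk, mul_assoc, hp2]
        group
    have hz : ((centralizerRestrictions G g₁ U₁).toFinset ×ˢ
        (centralizerRestrictions G g₂ U₂).toFinset).card ≤ z₁ * z₂ := by
      rw [Finset.card_product, ← Set.ncard_eq_toFinset_card', ← Set.ncard_eq_toFinset_card']
      exact Nat.mul_le_mul hz₁ hz₂
    refine le_trans (Finset.card_le_card_of_injOn (fun p =>
      ((c p : V →ₗ[F] V) ∘ₗ U₁.subtype, (k p : V →ₗ[F] V) ∘ₗ U₂.subtype)) ?_ ?_) hz
    · intro p hp
      simp only [Finset.coe_filter, Finset.mem_univ, true_and, Set.mem_ofPred_eq] at hp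
      simp only [Finset.coe_product, Set.mem_prod, Set.coe_toFinset]
      exact ⟨⟨c p, hcG p, (hcc p hp).1, rfl⟩, ⟨k p, hkG p, (hcc p hp).2, rfl⟩⟩
    · intro p hp p' hp' heq
      simp only [Finset.coe_filter, Finset.mem_univ, true_and, Set.mem_ofPred_eq] at hp hp'
      have hc1 : ∀ u ∈ U₁, c p u = c p' u := fun u hu =>
        LinearMap.congr_fun (congrArg Prod.fst heq) ⟨u, hu⟩
      have hk1 : ∀ u ∈ U₂, k p u = k p' u := fun u hu =>
        LinearMap.congr_fun (congrArg Prod.snd heq) ⟨u, hu⟩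
      obtain ⟨hcp, hkp⟩ := hcc p hp
      obtain ⟨hcp', hkp'⟩ := hcc p' hp'
      have hcomm : ∀ {a a' g : V ≃ₗ[F] V}, a * g = g * a → a' * g = g * a' →
          (a'⁻¹ * a) * g = g * (a'⁻¹ * a) := by
        intro a a' g h h'
        have h2 : Commute a'⁻¹ g := (Commute.inv_left (show Commute a' g from h'))
        exact (h2.mul_left (show Commute a g from h)).eq
      have hinv : ∀ {a a' : V ≃ₗ[F] V} {u : V}, a u = a' u → (a'⁻¹ * a) u = u := by
        intro a a' u h
        rw [LinearEquiv.mul_apply, h]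
        exact a'.symm_apply_apply u
      -- the elements `φ = c'⁻¹ c` and `η = k⁻¹ k'` link `y p.2` and `y p'.2`
      have hyy : y p'.2 = ((c p')⁻¹ * c p) * y p.2 * ((k p)⁻¹ * k p') := by
        simp only [k]; group
      have hn : p.2 = p'.2 := hdist p.2 p'.2 ((c p')⁻¹ * c p) ((k p)⁻¹ * k p')
        (G.mul_mem (G.inv_mem (hcG _)) (hcG _)) (G.mul_mem (G.inv_mem (hkG _)) (hkG _))
        (hcomm hcp hcp') (hcomm hkp' hkp) (fun x hx => hinv (hc1 x hx))
        (fun x hx => hinv (hk1 x hx).symm) hyy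
      -- With equal indices, `c'⁻¹ c` is the identity on `U₁` and on the image of `U₂` under `y`,
      -- and these span `V`.
      have hone : (c p')⁻¹ * c p = 1 := by
        ext v
        have hv : v ∈ U₁ ⊔ U₂.map (y p.2 : V →ₗ[F] V) := by rw [hyU]; trivial
        obtain ⟨u, hu, _, ⟨u', hu', rfl⟩, rfl⟩ := Submodule.mem_sup.1 hv
        rw [map_add, hinv (hc1 u hu)]
        congr 1
        have h5 : ((c p')⁻¹ * c p) * y p.2 = y p.2 * ((k p')⁻¹ * k p) := by
          rw [← hn] at hyy
          calc (c p')⁻¹ * c p * y p.2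
              = ((c p')⁻¹ * c p * y p.2 * ((k p)⁻¹ * k p')) * ((k p')⁻¹ * k p) := by group
            _ = _ := by rw [← hyy]
        have h6 := LinearEquiv.congr_fun h5 u'
        exact h6.trans (congrArg (y p.2) (hinv (hk1 u' hu')))
      have hxeq : (p.1 : V ≃ₗ[F] V) = p'.1 := by
        have := inv_mul_eq_one.1 hone
        exact (mul_left_cancel this).symm
      exact Prod.ext (Subtype.ext hxeq) hn

end Denominator

/-! ### Stingray duos in the general linear group -/

section Linear

variable {F V : Type*} [Field F] [AddCommGroup V] [Module F V]

theorem IsStingrayOn.exists_ne_zero {e : ℕ} {g : V ≃ₗ[F] V} {U : Submodule F V}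
    (h : IsStingrayOn e g U) : ∃ v ∈ U, v ≠ 0 := by
  obtain ⟨v, hv, hne⟩ := h.nontrivial
  exact ⟨v, hv, fun h0 => hne (by rw [h0, map_zero])⟩

/-- Linear maps that commute with a stingray element and agree on a nonzero vector of `U` agree
on `U`. -/
theorem IsStingrayOn.eqOn_of_commute {e : ℕ} {g : V ≃ₗ[F] V} {U : Submodule F V}
    (h : IsStingrayOn e g U) {c c' : V →ₗ[F] V} (hc : ∀ x, c (g x) = g (c x))
    (hc' : ∀ x, c' (g x) = g (c' x)) {v : V} (hv : v ∈ U) (hv0 : v ≠ 0) (heq : c v = c' v) :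
    ∀ x ∈ U, c x = c' x := by
  rcases h.irreducible (U ⊓ LinearMap.eqLocus c c') inf_le_left (fun x hx =>
    ⟨h.invariant x hx.1, by
      have : c x = c' x := hx.2
      change c (g x) = c' (g x)
      rw [hc, hc', this]⟩) with h0 | h0
  · exact absurd ((Submodule.mem_bot F).1 (h0 ▸ ⟨hv, heq⟩ : v ∈ (⊥ : Submodule F V))) hv0
  · intro x hx
    rw [← h0] at hx
    exact hx.2

/-- An element commuting with `g` is determined on `U` by its value at one nonzero vector, and this
value is a nonzero vector of `U`. -/
theorem ncard_centralizerRestrictions_le [Finite F] [FiniteDimensional F V]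
    (G : Subgroup (V ≃ₗ[F] V)) {e : ℕ} {g : V ≃ₗ[F] V} {U : Submodule F V}
    (h : IsStingrayOn e g U) :
    (centralizerRestrictions G g U).ncard ≤ Nat.card F ^ e - 1 := by
  classical
  have : Finite V := Module.finite_of_finite F
  obtain ⟨v, hv, hv0⟩ := h.exists_ne_zero
  have hcard : (((U : Set V) \ {0} : Set V)).ncard = Nat.card F ^ e - 1 := by
    rw [Set.ncard_sdiff_singleton_of_mem U.zero_mem, ← h.finrank_eq,
      ← Module.natCard_eq_pow_finrank]
    rfl
  rw [← hcard]
  refine Set.ncard_le_ncard_of_injOn (fun f => f ⟨v, hv⟩) ?_ ?_ (Set.toFinite _)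
  · rintro _ ⟨c, -, hc, rfl⟩
    refine ⟨h.map_eq_of_commute hc v hv, fun h0 => hv0 ?_⟩
    exact (LinearEquiv.map_eq_zero_iff c).1 h0
  · rintro _ ⟨c, -, hc, rfl⟩ _ ⟨c', -, hc', rfl⟩ heq
    ext x
    exact h.eqOn_of_commute (c := (c : V →ₗ[F] V)) (c' := (c' : V →ₗ[F] V))
      (fun x => LinearEquiv.congr_fun hc x) (fun x => LinearEquiv.congr_fun hc' x) hv hv0 heq x x.2

/-- The transvection `x ↦ x + A (f)`, where `f` is the component of `x` in `F'`. -/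
noncomputable def shear {U F' : Submodule F V} (h : IsCompl U F') (A : F' →ₗ[F] U) : V ≃ₗ[F] V :=
  LinearEquiv.ofLinearMap
    (LinearMap.id + U.subtype ∘ₗ A ∘ₗ F'.projectionOnto U h.symm)
    (LinearMap.id - U.subtype ∘ₗ A ∘ₗ F'.projectionOnto U h.symm)
    (by ext x; simp)
    (by ext x; simp)

theorem shear_apply_left {U F' : Submodule F V} (h : IsCompl U F') (A : F' →ₗ[F] U) {x : V}
    (hx : x ∈ U) : shear h A x = x := by
  have : F'.projectionOnto U h.symm x = 0 := by simpa using hx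
  simp [shear, this]

theorem shear_apply_right {U F' : Submodule F V} (h : IsCompl U F') (A : F' →ₗ[F] U) (x : F') :
    shear h A (x : V) = x + A x := by
  simp [shear]

theorem eq_of_add_eq_add {U F' : Submodule F V} (h : IsCompl U F') {u u' f f' : V} (hu : u ∈ U)
    (hu' : u' ∈ U) (hf : f ∈ F') (hf' : f' ∈ F') (heq : f + u = f' + u') : f = f' ∧ u = u' := by
  have h1 : f - f' = u' - u := by
    rw [sub_eq_sub_iff_add_eq_add, heq, add_comm]
  have h2 : f - f' ∈ U ⊓ F' := ⟨h1 ▸ U.sub_mem hu' hu, F'.sub_mem hf hf'⟩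
  rw [h.inf_eq_bot, Submodule.mem_bot] at h2
  refine ⟨sub_eq_zero.1 h2, ?_⟩
  rw [h2] at h1
  exact (sub_eq_zero.1 h1.symm).symm

theorem IsStingrayOn.finrank_fixedSpace [FiniteDimensional F V] {e : ℕ} {g : V ≃ₗ[F] V}
    {U : Submodule F V} (h : IsStingrayOn e g U) :
    e + Module.finrank F (fixedSpace g) = Module.finrank F V := by
  rw [← h.finrank_eq]
  exact Submodule.finrank_add_eq_of_isCompl h.isCompl

/-- A lower bound for the number of stingray duos in the general linear group. -/
theorem card_stingrayDuos_linear [Finite F] [FiniteDimensional F V]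
    {e₁ e₂ : ℕ} (he : e₂ ≤ e₁) (hd : e₁ + e₂ = Module.finrank F V)
    {g₁ g₂ : V ≃ₗ[F] V} {U₁ U₂ : Submodule F V}
    (h₁ : IsStingrayOn e₁ g₁ U₁) (h₂ : IsStingrayOn e₂ g₂ U₂) :
    Nat.card (⊤ : Subgroup (V ≃ₗ[F] V)) * Nat.card F ^ (2 * (e₁ * e₂)) ≤
      (Nat.card F ^ e₁ - 1) * (Nat.card F ^ e₂ - 1) *
        (stingrayDuos (⊤ : Subgroup (V ≃ₗ[F] V)) e₁ e₂ g₁ g₂).ncard := by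
  have : Finite V := Module.finite_of_finite F
  have hf₁ := h₁.finrank_fixedSpace
  have hf₂ := h₂.finrank_fixedSpace
  have hu₁ := h₁.finrank_eq
  have hu₂ := h₂.finrank_eq
  let s : U₂ ≃ₗ[F] fixedSpace g₁ := LinearEquiv.ofFinrankEq _ _ (by omega)
  let t : fixedSpace g₂ ≃ₗ[F] U₁ := LinearEquiv.ofFinrankEq _ _ (by omega)
  -- This map takes `U₂` to the fixed space of `g₁` and the fixed space of `g₂` to `U₁`. The shears
  -- on its two sides give `q ^ (e₁ e₂)` choices each.
  let y₀ : V ≃ₗ[F] V := (Submodule.prodEquivOfIsCompl _ _ h₂.isCompl).symm ≪≫ₗ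
    (s.prodCongr t) ≪≫ₗ (Submodule.prodEquivOfIsCompl _ _ h₁.isCompl.symm)
  have hy₀ : ∀ u : U₂, y₀ u = s u := by
    intro u
    simp only [y₀, LinearEquiv.trans_apply]
    rw [Submodule.prodEquivOfIsCompl_symm_apply_left]
    simp
  let N := (fixedSpace g₁ →ₗ[F] U₁) × (fixedSpace g₂ →ₗ[F] U₂)
  have : Finite (fixedSpace g₁ →ₗ[F] U₁) := DFunLike.finite _
  have : Finite (fixedSpace g₂ →ₗ[F] U₂) := DFunLike.finite _
  let y : N → V ≃ₗ[F] V := fun n => shear h₁.isCompl n.1 * y₀ * shear h₂.isCompl n.2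
  have hyu : ∀ n (u : U₂), y n u = (s u : V) + (n.1 (s u) : V) := by
    intro n u
    simp only [y, LinearEquiv.mul_apply]
    rw [shear_apply_left _ _ u.2, hy₀, shear_apply_right]
  have hN : Nat.card N = Nat.card F ^ (2 * (e₁ * e₂)) := by
    rw [Nat.card_prod, Module.natCard_eq_pow_finrank (K := F) (V := fixedSpace g₁ →ₗ[F] U₁),
      Module.natCard_eq_pow_finrank (K := F) (V := fixedSpace g₂ →ₗ[F] U₂),
      Module.finrank_linearMap, Module.finrank_linearMap, ← pow_add]
    congr 1
    rw [hu₁, hu₂, show Module.finrank F (fixedSpace g₁) = e₂ by omega,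
      show Module.finrank F (fixedSpace g₂) = e₁ by omega]
    ring
  rw [← hN]
  refine card_mul_card_le_card_stingrayDuos ⊤ he hd h₁ h₂ y (fun _ => trivial) ?_ ?_
    (ncard_centralizerRestrictions_le ⊤ h₁) (ncard_centralizerRestrictions_le ⊤ h₂)
  · intro n
    rw [eq_top_iff, ← h₁.isCompl.sup_eq_top]
    refine sup_le le_sup_left fun f hf => ?_
    have h3 := hyu n (s.symm ⟨f, hf⟩)
    rw [LinearEquiv.apply_symm_apply] at h3
    have h4 : f = -(n.1 ⟨f, hf⟩ : V) + y n (s.symm ⟨f, hf⟩) := by rw [h3]; abel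
    rw [h4]
    exact Submodule.add_mem_sup (U₁.neg_mem (Subtype.property _))
      ⟨_, Subtype.property _, rfl⟩
  · intro n n' f h _ _ hf hh hfU hhU heq
    have hfF := fixedSpace_map_of_commute hf
    have hhF := fixedSpace_map_of_commute hh
    -- The image of `U₂` under `y n` is the graph of `n.1`. Comparing components along `fixedSpace
    -- g₁` and `U₁` shows that `f` is trivial and recovers `n.1`.
    have h3 : ∀ a : fixedSpace g₁, f a = a ∧ n.1 a = n'.1 a := by
      intro a
      have h4 := LinearEquiv.congr_fun heq (s.symm a : V)
      rw [hyu, LinearEquiv.mul_apply, LinearEquiv.mul_apply, hhU _ (Subtype.property _), hyu,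
        LinearEquiv.apply_symm_apply, map_add, hfU _ (Subtype.property _)] at h4
      have h5 := eq_of_add_eq_add h₁.isCompl (Subtype.property _) (Subtype.property _) a.2
        (hfF a a.2) h4
      exact ⟨h5.1.symm, (Subtype.ext h5.2).symm⟩
    have hf1 : f = 1 := by
      ext v
      have hv : v ∈ U₁ ⊔ fixedSpace g₁ := by rw [h₁.isCompl.sup_eq_top]; trivial
      obtain ⟨u, hu, a, ha, rfl⟩ := Submodule.mem_sup.1 hv
      rw [map_add, hfU u hu, (h3 ⟨a, ha⟩).1]
      rfl
    have hA : n.1 = n'.1 := LinearMap.ext fun a => (h3 a).2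
    have hD : ∀ a : fixedSpace g₂, n.2 a = n'.2 a := by
      intro a
      rw [hf1, one_mul] at heq
      simp only [y, ← hA] at heq
      rw [mul_assoc, mul_assoc, mul_assoc] at heq
      have heq := mul_left_cancel (mul_left_cancel heq)
      have h4 := LinearEquiv.congr_fun heq (a : V)
      have h6 := shear_apply_right h₂.isCompl n.2 ⟨h a, hhF a a.2⟩
      rw [shear_apply_right, LinearEquiv.mul_apply] at h4
      have h7 := h4.trans h6
      have h5 := eq_of_add_eq_add h₂.isCompl (Subtype.property _) (Subtype.property _) a.2
        (hhF a a.2) h7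
      have h8 : (⟨h a, hhF a a.2⟩ : fixedSpace g₂) = a := Subtype.ext h5.1.symm
      rw [h8] at h5
      exact (Subtype.ext h5.2).symm
    exact Prod.ext hA (LinearMap.ext hD)

end Linear

/-! ### Values of a quadratic form over a finite field -/

section QuadraticCount

variable {F M : Type*} [Field F] [Finite F] [AddCommGroup M] [Module F M] [FiniteDimensional F M]

open AddChar in
/-- A nondegenerate quadratic form on a space of dimension `2 * m` takes each value about equally
often. -/
theorem abs_card_quadratic_sub_le (Q : QuadraticForm F M)
    (hQ : ∀ x, (∀ y, QuadraticMap.polar Q x y = 0) → x = 0) {m : ℕ}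
    (hm : Module.finrank F M = 2 * m) (c : F) :
    |(Nat.card F : ℝ) * ({x | Q x = c} : Set M).ncard - (Nat.card F : ℝ) ^ (2 * m)| ≤
      ((Nat.card F : ℝ) - 1) * (Nat.card F : ℝ) ^ m := by
  classical
  have : Finite M := Module.finite_of_finite F
  have := Fintype.ofFinite F
  have := Fintype.ofFinite M
  let ψ : AddChar F ℂ := FiniteField.primitiveChar_to_Complex F
  have hψ : ψ.IsPrimitive := FiniteField.primitiveChar_to_Complex_isPrimitive F
  have hcardM : (Fintype.card M : ℂ) = (Nat.card F : ℂ) ^ (2 * m) := by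
    rw [← Nat.card_eq_fintype_card, Module.natCard_eq_pow_finrank (K := F), hm]
    push_cast; rfl
  let S : F → ℂ := fun t => ∑ x : M, ψ (t * Q x)
  -- In `S t` times its conjugate, the substitution `x = h + y` leaves a character sum in `y`, which
  -- vanishes for `h ≠ 0` by nondegeneracy.
  have hS : ∀ t, t ≠ 0 → ‖S t‖ = (Nat.card F : ℝ) ^ m := by
    intro t ht
    have hinner : ∀ h : M, ∑ y : M, ψ (t * QuadraticMap.polar Q h y)
        = if h = 0 then (Fintype.card M : ℂ) else 0 := by
      intro h
      let χ : AddChar M ℂ := ψ.compAddMonoidHom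
        (t • Q.polarBilin h : M →ₗ[F] F).toAddMonoidHom
      have hχ : ∀ y, χ y = ψ (t * QuadraticMap.polar Q h y) := fun y => rfl
      simp only [← hχ]
      split_ifs with h0
      · subst h0
        apply sum_eq_card_of_eq_one
        ext y
        simp [hχ]
      · apply sum_eq_zero_of_ne_one
        intro h1
        apply h0
        apply hQ
        intro y
        by_contra hy
        apply hψ (a := t * QuadraticMap.polar Q h y) (mul_ne_zero ht hy)
        ext s
        have h2 : χ (s • y) = 1 := by rw [h1]; rfl
        rw [hχ, QuadraticMap.polar_smul_right, smul_eq_mul] at h2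
        rw [AddChar.mulShift_apply, AddChar.one_apply, ← h2]
        congr 1; ring
    have hsq : S t * (starRingEnd ℂ) (S t) = (Nat.card F : ℂ) ^ (2 * m) := by
      calc S t * (starRingEnd ℂ) (S t)
          = ∑ y : M, ∑ x : M, ψ (t * Q x) * ψ (-(t * Q y)) := by
            simp only [S, map_sum, Finset.sum_mul_sum, map_neg_eq_conj]
            rw [Finset.sum_comm]
        _ = ∑ y : M, ∑ h : M, ψ (t * Q h) * ψ (t * QuadraticMap.polar Q h y) := by
            refine Finset.sum_congr rfl fun y _ => ?_
            rw [← Equiv.sum_comp (Equiv.addRight y)]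
            refine Finset.sum_congr rfl fun h _ => ?_
            rw [← map_add_eq_mul, ← map_add_eq_mul]
            congr 1
            simp only [Equiv.coe_addRight, QuadraticMap.polar]
            ring
        _ = ∑ h : M, ψ (t * Q h) * ∑ y : M, ψ (t * QuadraticMap.polar Q h y) := by
            rw [Finset.sum_comm]
            simp only [Finset.mul_sum]
        _ = (Nat.card F : ℂ) ^ (2 * m) := by
            simp only [hinner, mul_ite, mul_zero]
            rw [Finset.sum_ite_eq' Finset.univ (0 : M)]
            simp [hcardM]
    rw [Complex.mul_conj, Complex.normSq_eq_norm_sq] at hsq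
    have h3 : ‖S t‖ ^ 2 = ((Nat.card F : ℝ) ^ m) ^ 2 := by
      rw [← pow_mul, mul_comm m 2]
      exact_mod_cast hsq
    exact (pow_left_inj₀ (norm_nonneg _) (by positivity) two_ne_zero).1 h3
  -- The equation `Q x = c` is detected by summing `ψ (t * (Q x - c))` over `t`; the term `t = 0` is
  -- the main term.
  have hcount : (Nat.card F : ℂ) * ({x | Q x = c} : Set M).ncard =
      (Nat.card F : ℂ) ^ (2 * m) + ∑ t ∈ Finset.univ.erase (0 : F), ψ (-(t * c)) * S t := by
    have h1 : (Nat.card F : ℂ) * ({x | Q x = c} : Set M).ncard =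
        ∑ t : F, ψ (-(t * c)) * S t := by
      calc (Nat.card F : ℂ) * ({x | Q x = c} : Set M).ncard
          = ∑ x : M, ∑ t : F, ψ (t * (Q x - c)) := by
            simp only [sum_mulShift _ hψ, sub_eq_zero, Nat.cast_ite, Nat.cast_zero]
            rw [Set.ncard_eq_toFinset_card', Finset.sum_ite, Finset.sum_const_zero, add_zero,
              Finset.sum_const, nsmul_eq_mul, mul_comm, Nat.card_eq_fintype_card]
            congr 2
            congr 1
            ext x
            simp
        _ = _ := by
            rw [Finset.sum_comm]
            refine Finset.sum_congr rfl fun t _ => ?_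
            simp only [S, Finset.mul_sum]
            refine Finset.sum_congr rfl fun x _ => ?_
            rw [← map_add_eq_mul]
            congr 1; ring
    rw [h1, ← Finset.add_sum_erase _ _ (Finset.mem_univ (0 : F))]
    congr 1
    simp [S, hcardM]
  have hreal : (((Nat.card F : ℝ) * ({x | Q x = c} : Set M).ncard - (Nat.card F : ℝ) ^ (2 * m) : ℝ) : ℂ)
      = ∑ t ∈ Finset.univ.erase (0 : F), ψ (-(t * c)) * S t := by
    push_cast
    rw [hcount]; ring
  rw [← Real.norm_eq_abs, ← Complex.norm_real, hreal]
  refine (norm_sum_le _ _).trans ?_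
  have hterm : ∀ t ∈ Finset.univ.erase (0 : F), ‖ψ (-(t * c)) * S t‖ = (Nat.card F : ℝ) ^ m := by
    intro t ht
    rw [norm_mul, AddChar.norm_apply, one_mul, hS t (Finset.ne_of_mem_erase ht)]
  rw [Finset.sum_congr rfl hterm, Finset.sum_const, nsmul_eq_mul,
    Finset.card_erase_of_mem (Finset.mem_univ _), Finset.card_univ, ← Nat.card_eq_fintype_card,
    Nat.cast_sub Nat.card_pos, Nat.cast_one]

end QuadraticCount

/-! ### Quadratic spaces in odd characteristic and Witt's theorem -/

section QuadraticSpaces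

variable {F M : Type*} [Field F] [AddCommGroup M] [Module F M]

theorem finrank_ker_of_ne_zero [FiniteDimensional F M] {f : M →ₗ[F] F} (hf : f ≠ 0) :
    Module.finrank F (LinearMap.ker f) + 1 = Module.finrank F M := by
  have h1 := LinearMap.finrank_range_add_finrank_ker f
  rw [LinearMap.range_eq_top.2 (LinearMap.surjective hf), finrank_top, Module.finrank_self] at h1
  omega

namespace QuadraticForm

/-- The polar form of `Q` is nondegenerate. -/
def PolarNondegenerate (Q : QuadraticForm F M) : Prop :=
  ∀ x, (∀ y, QuadraticMap.polar Q x y = 0) → x = 0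

open _root_.QuadraticMap

theorem polar_self_eq (Q : QuadraticForm F M) (x : M) : polar Q x x = 2 * Q x := by
  rw [QuadraticMap.polar_self, two_nsmul, two_mul]

theorem apply_add_smul (Q : QuadraticForm F M) (x y : M) (t : F) :
    Q (x + t • y) = Q x + t * polar Q x y + t * t * Q y := by
  rw [QuadraticMap.map_add Q, QuadraticMap.map_smul, QuadraticMap.polar_smul_right, smul_eq_mul,
    smul_eq_mul]
  ring

theorem PolarNondegenerate.exists_ne_zero {Q : QuadraticForm F M} (hQ : Q.PolarNondegenerate)
    [Nontrivial M] : ∃ v, Q v ≠ 0 := by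
  by_contra! h
  obtain ⟨v, hv⟩ := exists_ne (0 : M)
  exact hv (hQ v fun y => by simp [polar, h])

/-- The orthogonal complement of a vector. -/
def perp (Q : QuadraticForm F M) (v : M) : Submodule F M :=
  LinearMap.ker (Q.polarBilin v)

theorem mem_perp {Q : QuadraticForm F M} {v x : M} : x ∈ Q.perp v ↔ polar Q v x = 0 := Iff.rfl

/-- The coefficient of `v` in the orthogonal projection of `x` to the line of `v`. -/
def coeff (Q : QuadraticForm F M) (v : M) : M →ₗ[F] F :=
  (2 * Q v)⁻¹ • Q.polarBilin v

theorem coeff_apply (Q : QuadraticForm F M) (v x : M) :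
    Q.coeff v x = (2 * Q v)⁻¹ * polar Q v x := rfl

theorem sub_coeff_mem_perp (h2 : (2 : F) ≠ 0) {Q : QuadraticForm F M} {v : M} (hv : Q v ≠ 0)
    (x : M) : x - Q.coeff v x • v ∈ Q.perp v := by
  rw [mem_perp, polar_sub_right, polar_smul_right, polar_self_eq, coeff_apply, smul_eq_mul]
  field_simp
  ring

/-- The orthogonal projection to the complement of `v`. -/
def perpProj (h2 : (2 : F) ≠ 0) (Q : QuadraticForm F M) {v : M} (hv : Q v ≠ 0) :
    M →ₗ[F] Q.perp v :=
  LinearMap.codRestrict _ (LinearMap.id - (Q.coeff v).smulRight v)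
    (fun x => sub_coeff_mem_perp h2 hv x)

theorem coe_perpProj (h2 : (2 : F) ≠ 0) {Q : QuadraticForm F M} {v : M} (hv : Q v ≠ 0) (x : M) :
    (Q.perpProj h2 hv x : M) = x - Q.coeff v x • v := rfl

theorem perpProj_add (h2 : (2 : F) ≠ 0) {Q : QuadraticForm F M} {v : M} (hv : Q v ≠ 0) (x : M) :
    (Q.perpProj h2 hv x : M) + Q.coeff v x • v = x := by
  rw [coe_perpProj, sub_add_cancel]

theorem PolarNondegenerate.perp (h2 : (2 : F) ≠ 0) {Q : QuadraticForm F M}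
    (hQ : Q.PolarNondegenerate) {v : M} (hv : Q v ≠ 0) :
    PolarNondegenerate (Q.comp (Q.perp v).subtype) := by
  intro x hx
  have h0 : (x : M) = 0 := by
    refine hQ _ fun y => ?_
    rw [← perpProj_add h2 hv y, polar_add_right, polar_smul_right, polar_comm Q (x : M) v,
      mem_perp.1 x.2, smul_zero, add_zero]
    exact hx _
  exact Subtype.ext h0

theorem finrank_perp [FiniteDimensional F M] (h2 : (2 : F) ≠ 0) {Q : QuadraticForm F M} {v : M}
    (hv : Q v ≠ 0) : Module.finrank F (Q.perp v) + 1 = Module.finrank F M := by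
  refine finrank_ker_of_ne_zero fun h0 => ?_
  have := LinearMap.congr_fun h0 v
  rw [polarBilin_apply_apply, polar_self_eq] at this
  exact mul_ne_zero h2 hv this

/-- A nondegenerate quadratic form in at least two variables over a finite field of odd
characteristic represents everything. -/
theorem PolarNondegenerate.exists_eq [Finite F] [FiniteDimensional F M] (h2 : (2 : F) ≠ 0)
    {Q : QuadraticForm F M} (hQ : Q.PolarNondegenerate) (hM : 2 ≤ Module.finrank F M) (c : F) :
    ∃ x, Q x = c := by
  have := Fintype.ofFinite F
  have : Nontrivial M := Module.nontrivial_of_finrank_pos (R := F) (by omega)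
  obtain ⟨v, hv⟩ := hQ.exists_ne_zero
  have hfr := finrank_perp h2 hv
  have : Nontrivial (Q.perp v) := Module.nontrivial_of_finrank_pos (R := F) (by omega)
  obtain ⟨w, hw⟩ := (hQ.perp h2 hv).exists_ne_zero
  replace hw : Q (w : M) ≠ 0 := hw
  have hodd : Fintype.card F % 2 = 1 := by
    by_contra h
    refine h2 (two_eq_zero_of_even_card ?_)
    rw [Nat.card_eq_fintype_card, Nat.even_iff]
    omega
  obtain ⟨a, b, hab⟩ := FiniteField.exists_root_sum_quadratic
    (f := Polynomial.C (Q v) * Polynomial.X ^ 2 + Polynomial.C 0 * Polynomial.X + Polynomial.C (-c))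
    (g := Polynomial.C (Q w) * Polynomial.X ^ 2 + Polynomial.C 0 * Polynomial.X + Polynomial.C 0)
    (Polynomial.degree_quadratic hv) (Polynomial.degree_quadratic hw) hodd
  refine ⟨a • v + b • w, ?_⟩
  rw [apply_add_smul, QuadraticMap.map_smul, polar_smul_left, mem_perp.1 w.2, smul_eq_mul]
  simp only [Polynomial.eval_add, Polynomial.eval_mul, Polynomial.eval_C, Polynomial.eval_pow,
    Polynomial.eval_X] at hab
  linear_combination hab

universe u v w in
/-- A nondegenerate quadratic space over a finite field of odd characteristic embeds in each
nondegenerate quadratic space of larger dimension. -/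
theorem PolarNondegenerate.exists_embedding {F : Type u} [Field F] [Finite F] (h2 : (2 : F) ≠ 0)
    {M : Type v} {N : Type w} [AddCommGroup M] [Module F M] [FiniteDimensional F M]
    [AddCommGroup N] [Module F N] [FiniteDimensional F N]
    {Q : QuadraticForm F M} {Q' : QuadraticForm F N}
    (hQ : Q.PolarNondegenerate) (hQ' : Q'.PolarNondegenerate)
    (hlt : Module.finrank F M < Module.finrank F N) :
    ∃ j : M →ₗ[F] N, ∀ x, Q' (j x) = Q x := by
  obtain ⟨k, hk⟩ : ∃ k, Module.finrank F M = k := ⟨_, rfl⟩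
  induction k generalizing M N with
  | zero =>
    have := Module.finrank_zero_iff.1 hk
    exact ⟨0, fun x => by rw [Subsingleton.elim x 0]; simp⟩
  | succ k ih =>
    have : Nontrivial M := Module.nontrivial_of_finrank_pos (R := F) (by omega)
    obtain ⟨v, hv⟩ := hQ.exists_ne_zero
    -- The larger space has dimension at least 2, so it represents `Q v`; passing to complements
    -- keeps the inequality strict.
    obtain ⟨n, hn⟩ := hQ'.exists_eq h2 (by omega) (Q v)
    have hn0 : Q' n ≠ 0 := hn ▸ hv
    have hf := finrank_perp h2 hv
    have hf' := finrank_perp h2 hn0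
    obtain ⟨j, hj⟩ := ih (hQ.perp h2 hv) (hQ'.perp h2 hn0) (by omega) (by omega)
    refine ⟨(Q'.perp n).subtype ∘ₗ j ∘ₗ Q.perpProj h2 hv + (Q.coeff v).smulRight n, fun x => ?_⟩
    have hx : Q x = Q (Q.perpProj h2 hv x : M) + Q.coeff v x * Q.coeff v x * Q v := by
      conv_lhs => rw [← perpProj_add h2 hv x]
      rw [apply_add_smul, polar_comm, mem_perp.1 (Subtype.property _), mul_zero, add_zero]
    have hjx := hj (Q.perpProj h2 hv x)
    simp only [QuadraticMap.comp_apply, Submodule.subtype_apply] at hjx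
    rw [hx, ← hjx, ← hn]
    simp only [LinearMap.add_apply, LinearMap.comp_apply, Submodule.subtype_apply,
      LinearMap.smulRight_apply]
    rw [apply_add_smul, polar_comm, mem_perp.1 (Subtype.property _), mul_zero, add_zero]

/-- The reflection in a nonsingular vector. -/
theorem exists_reflection (Q : QuadraticForm F M) {a : M} (ha : Q a ≠ 0) :
    ∃ ρ : M ≃ₗ[F] M, (∀ x, Q (ρ x) = Q x) ∧ ∀ x, ρ x = x - ((Q a)⁻¹ * polar Q a x) • a := by
  let f : M →ₗ[F] M := LinearMap.id - ((Q a)⁻¹ • Q.polarBilin a).smulRight a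
  have hf : ∀ x, f x = x - ((Q a)⁻¹ * polar Q a x) • a := fun x => rfl
  have hff : ∀ x, f (f x) = x := by
    intro x
    rw [hf (f x), hf x, polar_sub_right, polar_smul_right, polar_self_eq, smul_eq_mul, sub_sub,
      ← add_smul]
    have : (Q a)⁻¹ * polar Q a x + (Q a)⁻¹ *
        (polar Q a x - (Q a)⁻¹ * polar Q a x * (2 * Q a)) = 0 := by
      field_simp
      ring
    rw [this, zero_smul, sub_zero]
  refine ⟨LinearEquiv.ofLinearMap f f (LinearMap.ext hff) (LinearMap.ext hff), fun x => ?_, hf⟩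
  change Q (f x) = Q x
  rw [hf, sub_eq_add_neg, ← neg_smul, apply_add_smul, polar_comm Q x a]
  field_simp
  ring

/-- Since `Q (x - z) + Q (x + z) = 4 * Q x ≠ 0`, one of `x - z`, `x + z` is nonsingular. Reflection
in `x - z` maps `x` to `z`; reflection in `x + z` maps `x` to `-z`, and reflection in `z` corrects
the sign. -/
theorem exists_isometry_map (h2 : (2 : F) ≠ 0) (Q : QuadraticForm F M) {x z : M} (hx : Q x ≠ 0)
    (hxz : Q z = Q x) :
    ∃ ρ : M ≃ₗ[F] M, (∀ t, Q (ρ t) = Q t) ∧ ρ x = z ∧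
      ∀ t, polar Q x t = 0 → polar Q z t = 0 → ρ t = t := by
  have hsub : Q (x - z) = 2 * Q x - polar Q x z := by
    have := apply_add_smul Q x z (-1)
    rw [neg_one_smul, ← sub_eq_add_neg] at this
    rw [this, hxz]; ring
  have hadd : Q (x + z) = 2 * Q x + polar Q x z := by
    rw [QuadraticMap.map_add Q, hxz]; ring
  by_cases h : Q (x - z) = 0
  · have h' : Q (x + z) ≠ 0 := by
      intro h'
      apply mul_ne_zero (mul_ne_zero h2 h2) hx
      linear_combination h + h' - hsub - hadd
    have hz : Q z ≠ 0 := hxz ▸ hx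
    obtain ⟨ρ, hρ, hρ'⟩ := exists_reflection Q h'
    obtain ⟨τ, hτ, hτ'⟩ := exists_reflection Q hz
    refine ⟨ρ ≪≫ₗ τ, fun t => ?_, ?_, fun t ht ht' => ?_⟩
    · rw [LinearEquiv.trans_apply, hτ, hρ]
    · have h3 : ρ x = -z := by
        rw [hρ', polar_add_left, polar_self_eq, polar_comm Q z x, ← hadd, inv_mul_cancel₀ h',
          one_smul]
        abel
      rw [LinearEquiv.trans_apply, h3, map_neg, hτ', polar_self_eq]
      have : (Q z)⁻¹ * (2 * Q z) = 2 := by field_simp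
      rw [this, two_smul]
      abel
    · rw [LinearEquiv.trans_apply, hρ', polar_add_left, ht, ht', add_zero, mul_zero, zero_smul,
        sub_zero, hτ', ht', mul_zero, zero_smul, sub_zero]
  · obtain ⟨ρ, hρ, hρ'⟩ := exists_reflection Q h
    refine ⟨ρ, hρ, ?_, fun t ht ht' => ?_⟩
    · rw [hρ', polar_sub_left, polar_self_eq, polar_comm Q z x, ← hsub, inv_mul_cancel₀ h, one_smul]
      abel
    · rw [hρ', polar_sub_left, ht, ht', sub_zero, mul_zero, zero_smul, sub_zero]

/-- Vectors already in place are orthogonal to the old and the new position of the last one, so the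
isometry that moves it leaves them fixed. -/
theorem exists_isometry_map_family (h2 : (2 : F) ≠ 0) (Q : QuadraticForm F M) {n : ℕ}
    (v v' : Fin n → M) (hv : ∀ i, Q (v i) ≠ 0) (hvv' : ∀ i, Q (v' i) = Q (v i))
    (ho : ∀ i j, i ≠ j → polar Q (v i) (v j) = 0) (ho' : ∀ i j, i ≠ j → polar Q (v' i) (v' j) = 0) :
    ∃ ρ : M ≃ₗ[F] M, (∀ t, Q (ρ t) = Q t) ∧ ∀ i, ρ (v i) = v' i := by
  induction n with
  | zero => exact ⟨LinearEquiv.refl F M, fun _ => rfl, fun i => i.elim0⟩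
  | succ n ih =>
    obtain ⟨ρ, hρ, hρv⟩ := ih (fun i => v i.castSucc) (fun i => v' i.castSucc) (fun i => hv _)
      (fun i => hvv' _) (fun i j hij => ho _ _ (fun h => hij (Fin.castSucc_injective n h)))
      (fun i j hij => ho' _ _ (fun h => hij (Fin.castSucc_injective n h)))
    obtain ⟨τ, hτ, hτx, hτt⟩ := exists_isometry_map h2 Q (x := ρ (v (Fin.last n)))
      (z := v' (Fin.last n)) (by rw [hρ]; exact hv _) (by rw [hρ]; exact hvv' _)
    refine ⟨ρ ≪≫ₗ τ, fun t => ?_, fun i => ?_⟩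
    · rw [LinearEquiv.trans_apply, hτ, hρ]
    · rw [LinearEquiv.trans_apply]
      refine Fin.lastCases hτx (fun i => ?_) i
      have hne : Fin.last n ≠ i.castSucc := (Fin.castSucc_lt_last i).ne'
      rw [hρv i]
      refine hτt _ ?_ (ho' _ _ hne)
      rw [← hρv i, polar, ← map_add, hρ, hρ, hρ]
      exact ho _ _ hne

/-- Witt's extension theorem for nondegenerate subspaces. -/
theorem exists_isometry_extend [FiniteDimensional F M] (h2 : (2 : F) ≠ 0) (Q : QuadraticForm F M)
    {U : Submodule F M} (hU : PolarNondegenerate (Q.comp U.subtype)) (ψ : U →ₗ[F] M)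
    (hψ : ∀ u, Q (ψ u) = Q u) :
    ∃ ρ : M ≃ₗ[F] M, (∀ t, Q (ρ t) = Q t) ∧ ∀ u : U, ρ u = ψ u := by
  have := invertibleOfNonzero h2
  let B : LinearMap.BilinForm F U := (Q.comp U.subtype).polarBilin
  have hB : LinearMap.IsSymm B := ⟨fun x y => by
    simp only [B, polarBilin_apply_apply, RingHom.id_apply]; exact polar_comm _ _ _⟩
  -- An orthogonal basis of `U` reduces the claim to orthogonal families; nondegeneracy makes its
  -- vectors nonsingular.
  obtain ⟨b, hb⟩ := LinearMap.BilinForm.exists_orthogonal_basis (B := B) hB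
  have hpol : ∀ x y : U, polar (Q.comp U.subtype) x y = polar Q (x : M) (y : M) := fun x y => rfl
  have ho : ∀ i j, i ≠ j → polar Q (b i : M) (b j : M) = 0 := fun i j hij => hb hij
  have hne : ∀ i, Q (b i : M) ≠ 0 := by
    intro i h0
    apply b.ne_zero i
    refine hU _ fun y => ?_
    change B (b i) y = 0
    rw [← b.sum_repr y, map_sum]
    refine Finset.sum_eq_zero fun j _ => ?_
    rw [map_smul]
    by_cases hij : i = j
    · subst hij
      have : B (b i) (b i) = 2 * Q (b i : M) := polar_self_eq _ _
      rw [this, h0, mul_zero, smul_zero]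
    · have : B (b i) (b j) = 0 := ho i j hij
      rw [this, smul_zero]
  obtain ⟨ρ, hρ, hρv⟩ := exists_isometry_map_family h2 Q (fun i => (b i : M)) (fun i => ψ (b i)) hne
    (fun i => hψ _) ho (fun i j hij => by
      rw [polar, ← map_add, hψ, hψ, hψ]
      exact ho i j hij)
  refine ⟨ρ, hρ, fun u => ?_⟩
  have : (ρ : M →ₗ[F] M) ∘ₗ U.subtype = ψ := b.ext hρv
  exact LinearMap.congr_fun this u

end QuadraticForm

end QuadraticSpaces

/-! ### Centralizers of stingray elements in orthogonal groups -/

section Centralizer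

open Polynomial

variable {F V : Type*} [Field F] [AddCommGroup V] [Module F V]

/-- A stingray element acts irreducibly on the space `U`. -/
theorem IsStingrayOn.irreducible_restrict {e : ℕ} {g : V ≃ₗ[F] V} {U : Submodule F V}
    (h : IsStingrayOn e g U) (W : Submodule F U)
    (hW : ∀ x ∈ W, ((g : V →ₗ[F] V).restrict h.invariant) x ∈ W) : W = ⊥ ∨ W = ⊤ := by
  rcases h.irreducible (W.map U.subtype) (Submodule.map_subtype_le U W) (by
    rintro _ ⟨x, hx, rfl⟩
    exact ⟨_, hW x hx, rfl⟩) with h0 | h0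
  · left
    exact Submodule.map_injective_of_injective U.injective_subtype (h0.trans (Submodule.map_bot _).symm)
  · right
    rw [eq_top_iff]
    intro x _
    have hx : (x : V) ∈ W.map U.subtype := by rw [h0]; exact x.2
    obtain ⟨y, hy, hyx⟩ := hx
    rwa [← Subtype.ext hyx]

theorem expand_pow_card [Finite F] (p : F[X]) (m : ℕ) :
    expand F (Nat.card F ^ m) p = p ^ (Nat.card F ^ m) := by
  have := Fintype.ofFinite F
  induction m with
  | zero => simp
  | succ m ih =>
    rw [pow_succ', expand_mul, ih, map_pow, Nat.card_eq_fintype_card, FiniteField.expand_card,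
      ← pow_mul]

section Irreducible

variable {U : Type*} [AddCommGroup U] [Module F U] {a : Module.End F U}
  (hirr : ∀ W : Submodule F U, (∀ x ∈ W, a x ∈ W) → W = ⊥ ∨ W = ⊤)

theorem aeval_comm (p : F[X]) (x : U) : aeval a p (a x) = a (aeval a p x) := by
  have h : aeval a p * a = a * aeval a p := by
    have : aeval a (p * X) = aeval a (X * p) := by rw [mul_comm]
    simpa using this
  exact LinearMap.congr_fun h x

include hirr

/-- For an irreducible endomorphism `a`, the algebra `F[a]` is a domain. -/
theorem isPrime_ker_aeval [Nontrivial U] : (RingHom.ker (aeval (R := F) a)).IsPrime := by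
  refine ⟨?_, fun {p s} hps => ?_⟩
  · rw [Ne, Ideal.eq_top_iff_one, RingHom.mem_ker, map_one]
    exact one_ne_zero
  · rw [RingHom.mem_ker] at hps
    rw [RingHom.mem_ker, RingHom.mem_ker]
    rcases hirr (LinearMap.range (aeval a s)) (by
      rintro _ ⟨x, rfl⟩
      exact ⟨a x, aeval_comm s x⟩) with h | h
    · right
      exact LinearMap.range_eq_bot.1 h
    · left
      ext x
      obtain ⟨y, rfl⟩ := LinearMap.range_eq_top.1 h x
      have := LinearMap.congr_fun hps y
      rw [map_mul] at this
      exact this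

/-- A nonzero `v` is cyclic, so `c v = p(a) v` for some `p`; the space on which `c` and `p(a)` agree
is invariant and nonzero. -/
theorem exists_eq_aeval_of_commute [Nontrivial U] {c : Module.End F U}
    (hc : ∀ x, c (a x) = a (c x)) : ∃ p : F[X], c = aeval a p := by
  obtain ⟨v, hv⟩ := exists_ne (0 : U)
  let ev : F[X] →ₗ[F] U := (LinearMap.applyₗ v) ∘ₗ (aeval a).toLinearMap
  have hev : ∀ p, ev p = aeval a p v := fun p => rfl
  have hr : LinearMap.range ev = ⊤ := by
    refine (hirr _ ?_).resolve_left fun h => ?_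
    · rintro _ ⟨p, rfl⟩
      exact ⟨X * p, by rw [hev, hev, map_mul, aeval_X]; rfl⟩
    · have : ev 1 ∈ LinearMap.range ev := ⟨1, rfl⟩
      rw [h, hev, map_one] at this
      exact hv this
  obtain ⟨p, hp⟩ := LinearMap.range_eq_top.1 hr (c v)
  refine ⟨p, ?_⟩
  rcases hirr (LinearMap.eqLocus c (aeval a p)) (by
    intro x hx
    have hx' : c x = aeval a p x := hx
    change c (a x) = aeval a p (a x)
    rw [hc, aeval_comm, hx']) with h | h
  · have : v ∈ LinearMap.eqLocus c (aeval a p) := hp.symm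
    rw [h] at this
    exact absurd this hv
  · ext x
    have : x ∈ LinearMap.eqLocus c (aeval a p) := by rw [h]; trivial
    exact this

/-- An irreducible isometry `a` of a nondegenerate form with `a ^ (|F| ^ m + 1) = 1` commutes with
at most `|F| ^ m + 1` isometries. -/
theorem ncard_isometries_commute_le [Finite F] [Nontrivial U] (B : U →ₗ[F] U →ₗ[F] F)
    (hB : ∀ y, (∀ x, B x y = 0) → y = 0) (ha : ∀ x y, B (a x) (a y) = B x y) {m : ℕ}
    (ham : a ^ (Nat.card F ^ m + 1) = 1) :
    ({c | (∀ x, c (a x) = a (c x)) ∧ ∀ x y, B (c x) (c y) = B x y} : Set (Module.End F U)).ncard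
      ≤ Nat.card F ^ m + 1 := by
  classical
  set n := Nat.card F ^ m with hn
  have hprime := isPrime_ker_aeval hirr
  let K := F[X] ⧸ RingHom.ker (aeval (R := F) a)
  have hdom : IsDomain K := Ideal.Quotient.isDomain _
  let Λ : K →+* Module.End F U :=
    Ideal.Quotient.lift _ (aeval (R := F) a : F[X] →+* Module.End F U) (fun _ hx => hx)
  -- The adjoint of `a` is its inverse `a ^ n`, so the adjoint of `p(a)` is `p(a ^ n)`.
  have hadj : ∀ (p : F[X]) (x y : U), B (aeval a p x) y = B x (aeval (a ^ n) p y) := by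
    have h1 : ∀ x y, B (a x) y = B x ((a ^ n) y) := by
      intro x y
      have : y = a ((a ^ n) y) := by
        have := LinearMap.congr_fun ham y
        rw [pow_succ'] at this
        exact this.symm
      conv_lhs => rw [this]
      rw [ha]
    intro p
    induction p using Polynomial.induction_on' with
    | add p s hp hs => intro x y; simp [hp, hs]
    | monomial k t =>
      intro x y
      rw [aeval_monomial, aeval_monomial]
      simp only [Module.End.mul_apply, Module.algebraMap_end_apply, map_smul, LinearMap.smul_apply]
      congr 1
      induction k generalizing x y with
      | zero => simp
      | succ k ih =>
        rw [pow_succ, pow_succ' (a ^ n), Module.End.mul_apply, Module.End.mul_apply, ih, h1,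
          ← Module.End.mul_apply]
  -- As `p(a ^ n) = p(a) ^ n`, an isometry `p(a)` satisfies `p(a) ^ (n + 1) = 1`, which has at most
  -- `n + 1` solutions in the domain `K`.
  have hsub : ({c | (∀ x, c (a x) = a (c x)) ∧ ∀ x y, B (c x) (c y) = B x y} :
      Set (Module.End F U)) ⊆
      Λ '' ((nthRoots (n + 1) (1 : K)).toFinset : Set K) := by
    rintro c ⟨hc, hcB⟩
    obtain ⟨p, hp⟩ := exists_eq_aeval_of_commute hirr hc
    refine ⟨Ideal.Quotient.mk _ p, ?_, hp.symm⟩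
    rw [Finset.mem_coe, Multiset.mem_toFinset, mem_nthRoots (Nat.succ_pos n), ← map_pow,
      ← map_one (Ideal.Quotient.mk _), Ideal.Quotient.eq, RingHom.mem_ker, map_sub, map_one,
      sub_eq_zero, pow_succ, map_mul, hn, ← expand_pow_card, expand_aeval, ← hn, ← hp]
    ext y
    have : aeval (a ^ n) p (c y) - y = 0 := hB _ fun x => by
      rw [map_sub, ← hadj, ← hp, hcB, sub_self]
    exact sub_eq_zero.1 this
  calc _ ≤ _ := Set.ncard_le_ncard hsub ((Finset.finite_toSet _).image _)
    _ ≤ _ := Set.ncard_image_le (Finset.finite_toSet _)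
    _ = _ := Set.ncard_coe_finset _
    _ ≤ _ := Multiset.toFinset_card_le _
    _ ≤ _ := card_nthRoots _ _

end Irreducible

open QuadraticMap in
theorem IsStingrayOn.polar_eq_zero {e : ℕ} {g : V ≃ₗ[F] V} {U : Submodule F V}
    (h : IsStingrayOn e g U) {Q : QuadraticForm F V} (hg : ∀ x, Q (g x) = Q x) {u f : V}
    (hu : u ∈ U) (hf : f ∈ fixedSpace g) : polar Q u f = 0 := by
  obtain ⟨z, rfl⟩ := h.exists_sub_eq hu
  rw [mem_fixedSpace] at hf
  have h1 : polar Q (g z) f = polar Q z f := by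
    conv_lhs => rw [← hf, polar, ← map_add, hg, hg, hg]
    rfl
  rw [polar_sub_left, h1, sub_self]

open QuadraticMap in
theorem QuadraticForm.PolarNondegenerate.comp_subtype {Q : QuadraticForm F V}
    (hQ : Q.PolarNondegenerate) {A C : Submodule F V} (hsup : A ⊔ C = ⊤)
    (hAC : ∀ a ∈ A, ∀ c ∈ C, polar Q a c = 0) :
    QuadraticForm.PolarNondegenerate (Q.comp A.subtype) := by
  intro x hx
  have h0 : (x : V) = 0 := by
    refine hQ _ fun y => ?_
    have hy : y ∈ A ⊔ C := by rw [hsup]; trivial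
    obtain ⟨a, ha, c, hc, rfl⟩ := Submodule.mem_sup.1 hy
    rw [polar_add_right, hAC _ x.2 c hc, add_zero]
    exact hx ⟨a, ha⟩
  exact Subtype.ext h0

theorem IsStingrayOn.polarNondegenerate {e : ℕ} {g : V ≃ₗ[F] V} {U : Submodule F V}
    (h : IsStingrayOn e g U) {Q : QuadraticForm F V} (hQ : Q.PolarNondegenerate)
    (hg : ∀ x, Q (g x) = Q x) :
    QuadraticForm.PolarNondegenerate (Q.comp U.subtype) ∧
      QuadraticForm.PolarNondegenerate (Q.comp (fixedSpace g).subtype) := by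
  refine ⟨hQ.comp_subtype h.isCompl.sup_eq_top fun a ha c hc => h.polar_eq_zero hg ha hc,
    hQ.comp_subtype h.isCompl.symm.sup_eq_top fun a ha c hc => ?_⟩
  rw [QuadraticMap.polar_comm]
  exact h.polar_eq_zero hg hc ha

/-- The number of restrictions to `U` of the isometries that commute with a stingray element. -/
theorem ncard_centralizerRestrictions_le_of_isometry [Finite F] [FiniteDimensional F V]
    {G : Subgroup (V ≃ₗ[F] V)} {e : ℕ} {g : V ≃ₗ[F] V} {U : Submodule F V}
    (h : IsStingrayOn e g U) {Q : QuadraticForm F V} (hQ : Q.PolarNondegenerate)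
    (hG : ∀ c ∈ G, ∀ x, Q (c x) = Q x) (hgG : g ∈ G) {m : ℕ}
    (hm : orderOf g ∣ Nat.card F ^ m + 1) :
    (centralizerRestrictions G g U).ncard ≤ Nat.card F ^ m + 1 := by
  have hpol : ∀ c ∈ G, ∀ x y, QuadraticMap.polar Q (c x) (c y) = QuadraticMap.polar Q x y := by
    intro c hc x y
    rw [QuadraticMap.polar, ← map_add, hG c hc, hG c hc, hG c hc]
    rfl
  let a : Module.End F U := (g : V →ₗ[F] V).restrict h.invariant
  have hpow : ∀ (n : ℕ) (x : U), ((a ^ n) x : V) = (g ^ n) (x : V) := by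
    intro n
    induction n with
    | zero => exact fun x => rfl
    | succ n ih =>
      intro x
      rw [pow_succ', pow_succ', Module.End.mul_apply, LinearEquiv.mul_apply, ← ih]
      rfl
  obtain ⟨v, hv, hv0⟩ := h.exists_ne_zero
  have : Nontrivial U := ⟨⟨⟨v, hv⟩, 0, fun h => hv0 (congrArg Subtype.val h)⟩⟩
  have hfin : Finite (Module.End F U) := by
    have : Finite V := Module.finite_of_finite F
    exact DFunLike.finite _
  let B : U →ₗ[F] U →ₗ[F] F := (Q.comp U.subtype).polarBilin
  have hB : ∀ x y : U, B x y = QuadraticMap.polar Q (x : V) (y : V) := fun x y => rfl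
  refine le_trans ?_ (ncard_isometries_commute_le (a := a) h.irreducible_restrict B ?_ ?_ (m := m) ?_)
  · refine (Set.ncard_le_ncard ?_ ((Set.toFinite _).image
      (fun f : Module.End F U => U.subtype ∘ₗ f))).trans (Set.ncard_image_le (Set.toFinite _))
    rintro _ ⟨c, hcG, hc, rfl⟩
    refine ⟨(c : V →ₗ[F] V).restrict (h.map_eq_of_commute hc), ⟨fun x => ?_, fun x y => ?_⟩, ?_⟩
    · exact Subtype.ext (LinearEquiv.congr_fun hc (x : V))
    · rw [hB, hB]
      exact hpol c hcG _ _
    · rfl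
  · intro y hy
    refine (h.polarNondegenerate hQ (hG g hgG)).1 y fun x => ?_
    rw [QuadraticMap.polar_comm]
    exact hy x
  · intro x y
    exact hpol g hgG _ _
  · ext x
    rw [hpow, orderOf_dvd_iff_pow_eq_one.1 hm]
    rfl

end Centralizer

/-! ### Maps with a degenerate difference form -/

section CountingComplements

open QuadraticMap

variable {F : Type*} [Field F] {A C : Type*} [AddCommGroup A] [Module F A]
  [AddCommGroup C] [Module F C]

/-- The form `x ↦ Q x - Q' (α x)`. -/
def defectForm (Q : QuadraticForm F C) (Q' : QuadraticForm F A) (α : C →ₗ[F] A) :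
    QuadraticForm F C :=
  Q - Q'.comp α

theorem defectForm_apply (Q : QuadraticForm F C) (Q' : QuadraticForm F A) (α : C →ₗ[F] A) (x : C) :
    defectForm Q Q' α x = Q x - Q' (α x) := rfl

theorem polar_defectForm (Q : QuadraticForm F C) (Q' : QuadraticForm F A) (α : C →ₗ[F] A)
    (x y : C) : polar (defectForm Q Q' α) x y = polar Q x y - polar Q' (α x) (α y) := by
  simp only [polar, defectForm_apply, map_add]
  ring

variable [Finite F] [FiniteDimensional F A] [FiniteDimensional F C]

/-- The number of linear maps `α` for which a given vector is in the radical of the form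
`Q - Q' ∘ α`. -/
theorem ncard_radical_le (h2 : (2 : F) ≠ 0) {Q : QuadraticForm F C} {Q' : QuadraticForm F A}
    (hQ : Q.PolarNondegenerate) (hQ' : Q'.PolarNondegenerate) {R : ℕ}
    (hR : ∀ c, ({y | Q' y = c ∧ y ≠ 0} : Set A).ncard ≤ R) {v : C} (hv : v ≠ 0) :
    ({α | ∀ w, polar (defectForm Q Q' α) v w = 0} : Set (C →ₗ[F] A)).ncard ≤
      Nat.card F ^ ((Module.finrank F A - 1) * (Module.finrank F C - 1)) * R := by
  classical
  have : Finite A := Module.finite_of_finite F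
  have : Finite C := Module.finite_of_finite F
  have : Finite (C →ₗ[F] A) := DFunLike.finite _
  have := Fintype.ofFinite (C →ₗ[F] A)
  have := Fintype.ofFinite A
  -- The vector `α v` is nonzero with the value `Q v` under `Q'`, which leaves at most `R` choices.
  have hval : ∀ α : C →ₗ[F] A, (∀ w, polar (defectForm Q Q' α) v w = 0) →
      Q' (α v) = Q v ∧ α v ≠ 0 := by
    intro α hα
    constructor
    · have h1 := hα v
      rw [QuadraticForm.polar_self_eq, defectForm_apply] at h1
      exact (sub_eq_zero.1 ((mul_eq_zero.1 h1).resolve_left h2)).symm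
    · intro h0
      apply hv
      refine hQ v fun w => ?_
      have h1 := hα w
      rwa [polar_defectForm, h0, polar_zero_left, sub_zero] at h1
  rw [Set.ncard_eq_toFinset_card']
  refine (Finset.card_le_mul_card_image (f := fun α : C →ₗ[F] A => α v) _
    (Nat.card F ^ ((Module.finrank F A - 1) * (Module.finrank F C - 1))) ?_).trans
    (Nat.mul_le_mul_left _ ?_)
  · intro y hy
    obtain ⟨α₀, hα₀, rfl⟩ := Finset.mem_image.1 hy
    rw [Set.mem_toFinset] at hα₀
    obtain ⟨-, hy0⟩ := hval α₀ hα₀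
    -- the differences are maps to the complement of `α₀ v` that vanish at `v`
    let P : Submodule F A := LinearMap.ker (Q'.polarBilin (α₀ v))
    have hP : Module.finrank F P + 1 = Module.finrank F A := by
      apply finrank_ker_of_ne_zero
      intro h0
      exact hy0 (hQ' _ fun y => LinearMap.congr_fun h0 y)
    have hC : Module.finrank F (C ⧸ Submodule.span F {v}) + 1 = Module.finrank F C := by
      have h1 := Submodule.finrank_quotient_add_finrank (Submodule.span F {v})
      rwa [finrank_span_singleton hv] at h1
    have hfin : Finite ((C ⧸ Submodule.span F {v}) →ₗ[F] P) := by
      have : Finite (C ⧸ Submodule.span F {v}) := Module.finite_of_finite F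
      exact DFunLike.finite _
    have := Fintype.ofFinite ((C ⧸ Submodule.span F {v}) →ₗ[F] P)
    have hcard : Fintype.card ((C ⧸ Submodule.span F {v}) →ₗ[F] P) =
        Nat.card F ^ ((Module.finrank F A - 1) * (Module.finrank F C - 1)) := by
      rw [← Nat.card_eq_fintype_card, Module.natCard_eq_pow_finrank (K := F),
        Module.finrank_linearMap, mul_comm]
      congr 2 <;> omega
    rw [← hcard, ← Finset.card_univ, ← Finset.card_image_of_injective
      (f := fun δ : (C ⧸ Submodule.span F {v}) →ₗ[F] P =>
        P.subtype ∘ₗ δ ∘ₗ (Submodule.span F {v}).mkQ + α₀) Finset.univ]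
    · refine Finset.card_le_card fun α hα => ?_
      rw [Finset.mem_filter, Set.mem_toFinset] at hα
      obtain ⟨hα, hαv⟩ := hα
      have hmem : ∀ w, (α - α₀) w ∈ P := by
        intro w
        have h1 := hα w
        have h3 := hα₀ w
        rw [polar_defectForm, hαv] at h1
        rw [polar_defectForm] at h3
        change polar Q' (α₀ v) (α w - α₀ w) = 0
        rw [polar_sub_right]
        linear_combination h3 - h1
      rw [Finset.mem_image]
      refine ⟨Submodule.liftQ _ (LinearMap.codRestrict P (α - α₀) hmem) ?_, Finset.mem_univ _, ?_⟩
      · rw [Submodule.span_singleton_le_iff_mem, LinearMap.mem_ker]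
        exact Subtype.ext (sub_eq_zero.2 hαv)
      · ext w
        simp
    · intro δ δ' h
      have h1 : P.subtype ∘ₗ δ ∘ₗ (Submodule.span F {v}).mkQ =
          P.subtype ∘ₗ δ' ∘ₗ (Submodule.span F {v}).mkQ := add_right_cancel h
      apply Submodule.linearMap_qext
      ext w
      exact LinearMap.congr_fun h1 w
  · refine le_trans ?_ (hR (Q v))
    rw [Set.ncard_eq_toFinset_card']
    refine Finset.card_le_card fun y hy => ?_
    obtain ⟨α, hα, rfl⟩ := Finset.mem_image.1 hy
    rw [Set.mem_toFinset] at hα ⊢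
    exact hval α hα

/-- The number of linear maps `α` for which the form `Q - Q' ∘ α` is degenerate. -/
theorem card_sub_one_mul_ncard_degenerate_le (h2 : (2 : F) ≠ 0) {Q : QuadraticForm F C}
    {Q' : QuadraticForm F A} (hQ : Q.PolarNondegenerate) (hQ' : Q'.PolarNondegenerate) {R : ℕ}
    (hR : ∀ c, ({y | Q' y = c ∧ y ≠ 0} : Set A).ncard ≤ R) :
    (Nat.card F - 1) *
      ({α | ¬ (defectForm Q Q' α).PolarNondegenerate} : Set (C →ₗ[F] A)).ncard ≤
      (Nat.card F ^ ((Module.finrank F A - 1) * (Module.finrank F C - 1)) * R) *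
        (Nat.card F ^ Module.finrank F C - 1) := by
  classical
  have : Finite A := Module.finite_of_finite F
  have : Finite C := Module.finite_of_finite F
  have : Finite (C →ₗ[F] A) := DFunLike.finite _
  have := Fintype.ofFinite (C →ₗ[F] A)
  have := Fintype.ofFinite C
  have := Fintype.ofFinite F
  let P : Finset ((C →ₗ[F] A) × C) :=
    Finset.univ.filter fun z => z.2 ≠ 0 ∧ ∀ w, polar (defectForm Q Q' z.1) z.2 w = 0
  have hP : ∀ z, z ∈ P ↔ z.2 ≠ 0 ∧ ∀ w, polar (defectForm Q Q' z.1) z.2 w = 0 := by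
    intro z; simp [P]
  -- Pairs of a map and a nonzero radical vector are counted twice; a degenerate map comes with at
  -- least `|F| - 1` such vectors.
  have hlower : (Nat.card F - 1) *
      ({α | ¬ (defectForm Q Q' α).PolarNondegenerate} : Set (C →ₗ[F] A)).ncard ≤ P.card := by
    have hmaps : Set.MapsTo Prod.fst (P : Set ((C →ₗ[F] A) × C))
        (({α | ¬ (defectForm Q Q' α).PolarNondegenerate} : Set (C →ₗ[F] A)).toFinset : Set _) := by
      intro z hz
      rw [Set.coe_toFinset]
      exact fun h => ((hP z).1 hz).1 (h _ ((hP z).1 hz).2)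
    rw [Finset.card_eq_sum_card_fiberwise hmaps, Set.ncard_eq_toFinset_card', mul_comm]
    refine Finset.card_nsmul_le_sum _ _ _ fun α hα => ?_
    rw [Set.mem_toFinset] at hα
    have hα' : ∃ v, (∀ w, polar (defectForm Q Q' α) v w = 0) ∧ v ≠ 0 := by
      by_contra! h
      exact hα h
    obtain ⟨v, hv, hv0⟩ := hα'
    rw [Nat.card_eq_fintype_card, ← Fintype.card_units, ← Finset.card_univ]
    refine Finset.card_le_card_of_injOn (fun a : Fˣ => (α, (a : F) • v)) ?_ ?_
    · intro a _
      simp only [Finset.coe_filter, Set.mem_ofPred_eq, hP, and_true]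
      exact ⟨smul_ne_zero a.ne_zero hv0, fun w => by rw [polar_smul_left, hv, smul_zero]⟩
    · intro a _ a' _ h
      exact Units.ext (smul_left_injective F hv0 (congrArg Prod.snd h))
  refine hlower.trans ?_
  refine (Finset.card_le_mul_card_image (f := Prod.snd) P
    (Nat.card F ^ ((Module.finrank F A - 1) * (Module.finrank F C - 1)) * R) ?_).trans
    (Nat.mul_le_mul_left _ ?_)
  · intro v hv
    obtain ⟨z, hz, rfl⟩ := Finset.mem_image.1 hv
    refine le_trans ?_ (ncard_radical_le h2 hQ hQ' hR ((hP z).1 hz).1)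
    rw [Set.ncard_eq_toFinset_card']
    refine Finset.card_le_card_of_injOn Prod.fst ?_ ?_
    · intro z' hz'
      simp only [Finset.coe_filter, Set.mem_ofPred_eq, hP] at hz'
      rw [Set.coe_toFinset]
      intro w
      rw [← hz'.2]
      exact hz'.1.2 w
    · intro z₁ h₁ z₂ h₂ h
      simp only [Finset.coe_filter, Set.mem_ofPred_eq] at h₁ h₂
      exact Prod.ext h (h₁.2.trans h₂.2.symm)
  · have hle : P.image Prod.snd ⊆ Finset.univ.erase (0 : C) := by
      intro v hv
      obtain ⟨z, hz, rfl⟩ := Finset.mem_image.1 hv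
      exact Finset.mem_erase.2 ⟨((hP z).1 hz).1, Finset.mem_univ _⟩
    refine (Finset.card_le_card hle).trans (le_of_eq ?_)
    rw [Finset.card_erase_of_mem (Finset.mem_univ _), Finset.card_univ,
      ← Nat.card_eq_fintype_card, Module.natCard_eq_pow_finrank (K := F)]

end CountingComplements

/-! ### Maps whose difference form is isometric to a given form -/

section CountingIsometric

open QuadraticMap

variable {F : Type*} [Field F] {A C D : Type*} [AddCommGroup A] [Module F A]
  [AddCommGroup C] [Module F C] [AddCommGroup D] [Module F D]

/-- The linear maps `α` for which `QC - QA ∘ α` is isometric to (a subspace of) `QD`. -/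
def isometricComplements (QA : QuadraticForm F A) (QC : QuadraticForm F C)
    (QD : QuadraticForm F D) : Set (C →ₗ[F] A) :=
  {α | ∃ β : C →ₗ[F] D, Function.Injective β ∧ ∀ x, QC x = QA (α x) + QD (β x)}

/-- The extension of `α` from the complement of `u` to the whole space that maps `u` to `x`. -/
def extendPerp (h2 : (2 : F) ≠ 0) {QC : QuadraticForm F C} {u : C} (hu : QC u ≠ 0)
    (α : QC.perp u →ₗ[F] A) (x : A) : C →ₗ[F] A :=
  α ∘ₗ QC.perpProj h2 hu + (QC.coeff u).smulRight x

theorem extendPerp_apply (h2 : (2 : F) ≠ 0) {QC : QuadraticForm F C} {u : C} (hu : QC u ≠ 0)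
    (α : QC.perp u →ₗ[F] A) (x : A) (z : C) :
    extendPerp h2 hu α x z = α (QC.perpProj h2 hu z) + QC.coeff u z • x := rfl

theorem extendPerp_injective (h2 : (2 : F) ≠ 0) {QC : QuadraticForm F C} {u : C} (hu : QC u ≠ 0) :
    Function.Injective fun p : (QC.perp u →ₗ[F] A) × A => extendPerp h2 hu p.1 p.2 := by
  rintro ⟨α, x⟩ ⟨α', x'⟩ h
  have hcu : QC.coeff u u = 1 := by
    rw [QuadraticForm.coeff_apply, QuadraticForm.polar_self_eq,
      inv_mul_cancel₀ (mul_ne_zero h2 hu)]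
  have hpu : QC.perpProj h2 hu u = 0 := by
    apply Subtype.ext
    rw [QuadraticForm.coe_perpProj, hcu, one_smul, sub_self]
    rfl
  have hcw : ∀ w : QC.perp u, QC.coeff u w = 0 := fun w => by
    rw [QuadraticForm.coeff_apply, QuadraticForm.mem_perp.1 w.2, mul_zero]
  have hpw : ∀ w : QC.perp u, QC.perpProj h2 hu w = w := fun w => by
    apply Subtype.ext
    rw [QuadraticForm.coe_perpProj, hcw, zero_smul, sub_zero]
  refine Prod.ext (LinearMap.ext fun w => ?_) ?_
  · have := LinearMap.congr_fun h (w : C)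
    simpa [extendPerp_apply, hcw, hpw] using this
  · have := LinearMap.congr_fun h u
    simpa [extendPerp_apply, hcu, hpu] using this

variable [Finite F] [FiniteDimensional F A] [FiniteDimensional F C] [FiniteDimensional F D]

/-- Half of the nonzero elements of a finite field of odd characteristic are of the form
`c * a ^ 2`. -/
theorem card_sub_one_le_two_mul_ncard_squares {c : F} (hc : c ≠ 0) (d : F) :
    Nat.card F - 1 ≤ 2 * ({s | ∃ a, a ≠ 0 ∧ s = c * a ^ 2 - d} : Set F).ncard := by
  classical
  have := Fintype.ofFinite F
  have h1 := Finset.card_le_mul_card_image (f := fun a : Fˣ => c * (a : F) ^ 2 - d) Finset.univ 2 ?_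
  · rw [Finset.card_univ, Fintype.card_units, ← Nat.card_eq_fintype_card] at h1
    refine h1.trans (Nat.mul_le_mul_left _ ?_)
    rw [Set.ncard_eq_toFinset_card']
    refine Finset.card_le_card fun s hs => ?_
    obtain ⟨a, -, rfl⟩ := Finset.mem_image.1 hs
    rw [Set.mem_toFinset]
    exact ⟨a, a.ne_zero, rfl⟩
  · intro s hs
    obtain ⟨a₀, -, rfl⟩ := Finset.mem_image.1 hs
    refine (Finset.card_le_card (t := {a₀, -a₀}) fun a ha => ?_).trans Finset.card_le_two
    rw [Finset.mem_filter] at ha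
    have h3 : (a : F) ^ 2 = (a₀ : F) ^ 2 := mul_left_cancel₀ hc (sub_left_injective ha.2)
    rw [Finset.mem_insert, Finset.mem_singleton]
    rcases sq_eq_sq_iff_eq_or_eq_neg.1 h3 with h | h
    · exact Or.inl (Units.ext h)
    · exact Or.inr (Units.ext (by simpa using h))

/-- The number of extensions `α` of a given map `α'` for which `QC - QA ∘ α` is isometric
to `QD`. -/
theorem card_sub_one_mul_le_ncard_extensions (h2 : (2 : F) ≠ 0) {QA : QuadraticForm F A}
    {QC : QuadraticForm F C} {QD : QuadraticForm F D} (hQA : QA.PolarNondegenerate)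
    (hQC : QC.PolarNondegenerate) (hQD : QD.PolarNondegenerate)
    (hdim : Module.finrank F D = Module.finrank F C) {T : ℕ}
    (hT : ∀ R : QuadraticForm F A, R.PolarNondegenerate → ∀ c, T ≤ ({x | R x = c} : Set A).ncard)
    {u : C} (hu : QC u ≠ 0) (α : QC.perp u →ₗ[F] A)
    (hα : (defectForm (QC.comp (QC.perp u).subtype) QA α).PolarNondegenerate) :
    (Nat.card F - 1) * T ≤
      2 * ({x | extendPerp h2 hu α x ∈ isometricComplements QA QC QD} : Set A).ncard := by
  classical
  have : Finite A := Module.finite_of_finite F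
  have := Fintype.ofFinite A
  have := Fintype.ofFinite F
  set QC' : QuadraticForm F (QC.perp u) := QC.comp (QC.perp u).subtype with hQC'
  set S : QuadraticForm F (QC.perp u) := defectForm QC' QA α with hS
  have hnd' : QuadraticForm.PolarNondegenerate QC' := hQC.perp h2 hu
  have hfr := QuadraticForm.finrank_perp h2 hu
  -- the adjoint of `α`
  obtain ⟨L, hL⟩ : ∃ L : A →ₗ[F] QC.perp u, ∀ x w, polar S (L x) w = polar QA x (α w) := by
    have hinj : Function.Injective S.polarBilin := by
      rw [← LinearMap.ker_eq_bot, LinearMap.ker_eq_bot']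
      exact fun x hx => hα x fun y => LinearMap.congr_fun hx y
    let E := LinearEquiv.ofInjectiveOfFinrankEq S.polarBilin hinj
      (Subspace.dual_finrank_eq (K := F) (V := QC.perp u)).symm
    refine ⟨E.symm.toLinearMap ∘ₗ α.dualMap ∘ₗ QA.polarBilin, fun x w => ?_⟩
    have : E (E.symm (α.dualMap (QA.polarBilin x))) = α.dualMap (QA.polarBilin x) :=
      E.apply_symm_apply _
    exact LinearMap.congr_fun this w
  -- If `u` goes to `x` under the extension of `α`, the partner `β` sends `u` to `-j (L x) + a • f`,
  -- where `L x` cancels the mixed terms. The condition `QC u = QA x + S (L x) + a ^ 2 * QD f` then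
  -- reads `R x = QD f * a ^ 2 - QC u`.
  let R : QuadraticForm F A := -QA - S.comp L
  have hR : ∀ x, R x = -QA x - S (L x) := fun x => rfl
  have hRpol : ∀ x y, polar R x y = -polar QA x (y + α (L y)) := by
    intro x y
    have h1 : polar R x y = -polar QA x y - polar S (L x) (L y) := by
      simp only [polar, hR, map_add]
      ring
    rw [h1, hL, polar_add_right]
    ring
  have hRnd : R.PolarNondegenerate := by
    intro y hy
    have h1 : y + α (L y) = 0 := hQA _ fun x => by
      have := hy x
      rw [polar_comm, hRpol, neg_eq_zero] at this
      rw [polar_comm]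
      exact this
    -- Inserting `y = -α (L y)` into the definition of `L` cancels the `QA` terms, so `L y` is in
    -- the radical of `QC'`.
    have h3 : L y = 0 := hnd' _ fun w => by
      have h4 := hL y w
      have h5 : y = -α (L y) := eq_neg_of_add_eq_zero_left h1
      rw [hS, polar_defectForm] at h4
      have h6 : polar QA y (α w) = -polar QA (α (L y)) (α w) := by
        conv_lhs => rw [h5]
        rw [polar_neg_left]
      rw [h6] at h4
      linear_combination h4
    rw [h3, map_zero, add_zero] at h1
    exact h1
  -- the isometric copy of `S` in `D`, and its complement
  obtain ⟨j, hj⟩ := QuadraticForm.PolarNondegenerate.exists_embedding h2 hα hQD (by omega)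
  have hjpol : ∀ w w', polar QD (j w) (j w') = polar S w w' := by
    intro w w'
    rw [polar, ← map_add, hj, hj, hj]
    rfl
  have hjinj : Function.Injective j := by
    rw [← LinearMap.ker_eq_bot, LinearMap.ker_eq_bot']
    exact fun w hw => hα w fun w' => by rw [← hjpol, hw, polar_zero_left]
  obtain ⟨f, hf0, hf⟩ : ∃ f : D, f ≠ 0 ∧ ∀ w, polar QD f (j w) = 0 := by
    have h1 : ¬ Function.Injective (j.dualMap ∘ₗ QD.polarBilin) := by
      intro hinj
      have := LinearMap.finrank_le_finrank_of_injective hinj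
      rw [Subspace.dual_finrank_eq] at this
      omega
    rw [← LinearMap.ker_eq_bot, Submodule.eq_bot_iff] at h1
    push Not at h1
    obtain ⟨f, hf, hf0⟩ := h1
    exact ⟨f, hf0, fun w => LinearMap.congr_fun hf w⟩
  have hfj : f ∉ LinearMap.range j := by
    rintro ⟨w, rfl⟩
    apply hf0
    rw [hα w fun w' => by rw [← hjpol, hf], map_zero]
  have hc : QD f ≠ 0 := by
    intro h0
    apply hf0
    have htop : LinearMap.range j ⊔ Submodule.span F {f} = ⊤ := by
      apply Submodule.eq_top_of_finrank_eq
      apply le_antisymm (Submodule.finrank_le _)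
      have hlt : LinearMap.range j < LinearMap.range j ⊔ Submodule.span F {f} :=
        lt_of_le_of_ne le_sup_left fun h => hfj (by
          rw [h]; exact Submodule.mem_sup_right (Submodule.mem_span_singleton_self f))
      have := Submodule.finrank_lt_finrank_of_lt hlt
      rw [LinearMap.finrank_range_of_inj hjinj] at this
      omega
    refine hQD f fun z => ?_
    have hz : z ∈ LinearMap.range j ⊔ Submodule.span F {f} := by rw [htop]; trivial
    obtain ⟨_, ⟨w, rfl⟩, _, hs, rfl⟩ := Submodule.mem_sup.1 hz
    obtain ⟨t, rfl⟩ := Submodule.mem_span_singleton.1 hs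
    rw [polar_add_right, hf, polar_smul_right, QuadraticForm.polar_self_eq, h0]
    simp
  -- the extensions with the correct value
  have hgood : ∀ x, (∃ a, a ≠ 0 ∧ R x = QD f * a ^ 2 - QC u) →
      extendPerp h2 hu α x ∈ isometricComplements QA QC QD := by
    rintro x ⟨a, ha, hx⟩
    refine ⟨j ∘ₗ (QC.perpProj h2 hu - (QC.coeff u).smulRight (L x)) +
      (QC.coeff u).smulRight (a • f), ?_, fun z => ?_⟩
    · rw [← LinearMap.ker_eq_bot, LinearMap.ker_eq_bot']
      intro z hz
      have hz' : j (QC.perpProj h2 hu z - QC.coeff u z • L x) + QC.coeff u z • a • f = 0 := hz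
      have ht : QC.coeff u z = 0 := by
        by_contra ht
        apply hfj
        have : (QC.coeff u z * a) • f ∈ LinearMap.range j := by
          rw [mul_smul, eq_neg_of_add_eq_zero_right hz', ← map_neg]
          exact ⟨_, rfl⟩
        exact ((LinearMap.range j).smul_mem_iff (mul_ne_zero ht ha)).1 this
      rw [ht, zero_smul, zero_smul, sub_zero, add_zero] at hz'
      have hp : QC.perpProj h2 hu z = 0 := hjinj (hz'.trans (map_zero j).symm)
      rw [← QuadraticForm.perpProj_add h2 hu z, ht, hp]
      simp
    · set w := QC.perpProj h2 hu z with hw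
      set t := QC.coeff u z with ht
      have h1 : QC z = QC (w : C) + t * t * QC u := by
        conv_lhs => rw [← QuadraticForm.perpProj_add h2 hu z]
        rw [QuadraticForm.apply_add_smul, polar_comm,
          QuadraticForm.mem_perp.1 (Subtype.property _), mul_zero, add_zero]
      have h3 : extendPerp h2 hu α x z = α w + t • x := rfl
      have h4 : (j ∘ₗ (QC.perpProj h2 hu - (QC.coeff u).smulRight (L x)) +
          (QC.coeff u).smulRight (a • f)) z = j (w + (-t) • L x) + (t * a) • f := by
        rw [mul_smul, neg_smul, ← sub_eq_add_neg]
        rfl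
      have h5 : S (w : QC.perp u) = QC (w : C) - QA (α w) := rfl
      rw [h1, h3, h4, QuadraticForm.apply_add_smul, QuadraticForm.apply_add_smul,
        polar_comm QD, hf, hj, QuadraticForm.apply_add_smul, polar_comm S, hL, h5,
        polar_comm QA x]
      rw [hR] at hx
      linear_combination t * t * hx
  calc (Nat.card F - 1) * T
      ≤ 2 * ({s | ∃ a, a ≠ 0 ∧ s = QD f * a ^ 2 - QC u} : Set F).ncard * T :=
        Nat.mul_le_mul_right _ (card_sub_one_le_two_mul_ncard_squares hc (QC u))
    _ = 2 * (({s | ∃ a, a ≠ 0 ∧ s = QD f * a ^ 2 - QC u} : Set F).ncard * T) := by ring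
    _ ≤ _ := by
      refine Nat.mul_le_mul_left _ ?_
      have hsub : ({x | ∃ a, a ≠ 0 ∧ R x = QD f * a ^ 2 - QC u} : Set A) ⊆
          {x | extendPerp h2 hu α x ∈ isometricComplements QA QC QD} := hgood
      refine le_trans ?_ (Set.ncard_le_ncard hsub (Set.toFinite _))
      rw [Set.ncard_eq_toFinset_card', Set.ncard_eq_toFinset_card']
      rw [Finset.card_eq_sum_card_fiberwise (f := R)
        (t := ({s | ∃ a, a ≠ 0 ∧ s = QD f * a ^ 2 - QC u} : Set F).toFinset)]
      · refine Finset.card_nsmul_le_sum _ _ _ fun s hs => ?_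
        refine (hT R hRnd s).trans (le_of_eq ?_)
        rw [Set.ncard_eq_toFinset_card']
        congr 1
        ext x
        rw [Finset.mem_filter, Set.mem_toFinset, Set.mem_toFinset]
        rw [Set.mem_toFinset] at hs
        constructor
        · intro h
          refine ⟨?_, h⟩
          obtain ⟨a, ha, hs⟩ := hs
          exact ⟨a, ha, (show R x = s from h).trans hs⟩
        · exact fun h => h.2
      · intro x hx
        rw [Set.coe_toFinset] at hx ⊢
        exact hx

/-- A lower bound for the number of maps `α` for which `QC - QA ∘ α` is isometric to `QD`. -/
theorem card_mul_le_ncard_isometricComplements (h2 : (2 : F) ≠ 0) {QA : QuadraticForm F A}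
    {QC : QuadraticForm F C} {QD : QuadraticForm F D} (hQA : QA.PolarNondegenerate)
    (hQC : QC.PolarNondegenerate) (hQD : QD.PolarNondegenerate)
    (hdim : Module.finrank F D = Module.finrank F C) (hC : 2 ≤ Module.finrank F C) {T R : ℕ}
    (hT : ∀ R : QuadraticForm F A, R.PolarNondegenerate → ∀ c, T ≤ ({x | R x = c} : Set A).ncard)
    (hR : ∀ c, ({y | QA y = c ∧ y ≠ 0} : Set A).ncard ≤ R) :
    ∃ s : ℕ, (Nat.card F - 1) * T *
        (Nat.card F ^ (Module.finrank F A * (Module.finrank F C - 1)) - s) ≤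
        2 * (isometricComplements QA QC QD).ncard ∧
      (Nat.card F - 1) * s ≤
        (Nat.card F ^ ((Module.finrank F A - 1) * (Module.finrank F C - 2)) * R) *
          (Nat.card F ^ (Module.finrank F C - 1) - 1) := by
  classical
  have : Nontrivial C := Module.nontrivial_of_finrank_pos (R := F) (by omega)
  obtain ⟨u, hu⟩ := hQC.exists_ne_zero
  have hfr := QuadraticForm.finrank_perp h2 hu
  have hfr' : Module.finrank F (QC.perp u) = Module.finrank F C - 1 := by omega
  have : Finite A := Module.finite_of_finite F
  have : Finite C := Module.finite_of_finite F
  have : Finite (C →ₗ[F] A) := DFunLike.finite _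
  have : Finite (QC.perp u →ₗ[F] A) := DFunLike.finite _
  have := Fintype.ofFinite A
  have := Fintype.ofFinite (QC.perp u →ₗ[F] A)
  have := Fintype.ofFinite (C →ₗ[F] A)
  -- The number `s` counts the maps on the hyperplane with degenerate difference form; each other
  -- map has at least `(|F| - 1) * T / 2` extensions.
  let bad : Set (QC.perp u →ₗ[F] A) :=
    {α | ¬ (defectForm (QC.comp (QC.perp u).subtype) QA α).PolarNondegenerate}
  refine ⟨bad.ncard, ?_, ?_⟩
  · have hcard : badᶜ.ncard =
        Nat.card F ^ (Module.finrank F A * (Module.finrank F C - 1)) - bad.ncard := by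
      have h1 := Set.ncard_add_ncard_compl bad
      have h3 : Nat.card (QC.perp u →ₗ[F] A) =
          Nat.card F ^ (Module.finrank F A * (Module.finrank F C - 1)) := by
        rw [Module.natCard_eq_pow_finrank (K := F), Module.finrank_linearMap, hfr', mul_comm]
      omega
    rw [← hcard]
    let P : Finset ((QC.perp u →ₗ[F] A) × A) := Finset.univ.filter fun z =>
      z.1 ∈ badᶜ ∧ extendPerp h2 hu z.1 z.2 ∈ isometricComplements QA QC QD
    have hP : P.card ≤ (isometricComplements QA QC QD).ncard := by
      rw [Set.ncard_eq_toFinset_card']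
      refine Finset.card_le_card_of_injOn (fun z => extendPerp h2 hu z.1 z.2) ?_
        (extendPerp_injective h2 hu).injOn
      intro z hz
      rw [Set.coe_toFinset]
      exact (Finset.mem_filter.1 hz).2.2
    refine le_trans ?_ (Nat.mul_le_mul_left 2 hP)
    rw [Finset.card_eq_sum_card_fiberwise (f := Prod.fst) (t := badᶜ.toFinset), Finset.mul_sum,
      Set.ncard_eq_toFinset_card', mul_comm]
    · refine Finset.card_nsmul_le_sum _ _ _ fun α hα => ?_
      rw [Set.mem_toFinset] at hα
      have hα' : (defectForm (QC.comp (QC.perp u).subtype) QA α).PolarNondegenerate := not_not.1 hα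
      refine (card_sub_one_mul_le_ncard_extensions h2 hQA hQC hQD hdim hT hu α hα').trans
        (Nat.mul_le_mul_left 2 ?_)
      rw [Set.ncard_eq_toFinset_card']
      refine Finset.card_le_card_of_injOn (fun x => (α, x)) ?_ fun x _ y _ h => congrArg Prod.snd h
      intro x hx
      rw [Set.coe_toFinset] at hx
      exact Finset.mem_filter.2 ⟨Finset.mem_filter.2 ⟨Finset.mem_univ _, hα, hx⟩, rfl⟩
    · intro z hz
      rw [Set.coe_toFinset]
      exact (Finset.mem_filter.1 hz).2.1
  · have := card_sub_one_mul_ncard_degenerate_le (C := QC.perp u) h2 (hQC.perp h2 hu) hQA hR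
    rw [hfr', Nat.sub_sub] at this
    exact this

end CountingIsometric

/-! ### Stingray duos in orthogonal groups -/

section OrthogonalDuos

open QuadraticMap

variable {F V : Type*} [Field F] [Finite F] [AddCommGroup V] [Module F V] [FiniteDimensional F V]

/-- A lower bound for the number of stingray duos in an orthogonal group. -/
theorem card_mul_ncard_isometricComplements_le (h2 : (2 : F) ≠ 0) {Q : QuadraticForm F V}
    (hQ : Q.PolarNondegenerate) {G : Subgroup (V ≃ₗ[F] V)}
    (hG : ∀ c, c ∈ G ↔ ∀ x, Q (c x) = Q x) {e₁ e₂ : ℕ} (he : e₂ ≤ e₁)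
    (hd : e₁ + e₂ = Module.finrank F V) {g₁ g₂ : V ≃ₗ[F] V} (hg₁ : g₁ ∈ G) (hg₂ : g₂ ∈ G)
    {U₁ U₂ : Submodule F V} (h₁ : IsStingrayOn e₁ g₁ U₁) (h₂ : IsStingrayOn e₂ g₂ U₂)
    {m₁ m₂ : ℕ} (hm₁ : orderOf g₁ ∣ Nat.card F ^ m₁ + 1) (hm₂ : orderOf g₂ ∣ Nat.card F ^ m₂ + 1) :
    Nat.card G * (isometricComplements (Q.comp U₁.subtype) (Q.comp U₂.subtype)
        (Q.comp (fixedSpace g₁).subtype)).ncard ≤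
      (Nat.card F ^ m₁ + 1) * (Nat.card F ^ m₂ + 1) * (stingrayDuos G e₁ e₂ g₁ g₂).ncard := by
  have : Finite V := Module.finite_of_finite F
  have : Finite (U₂ →ₗ[F] U₁) := DFunLike.finite _
  have hf₁ := h₁.finrank_fixedSpace
  have hu₁ := h₁.finrank_eq
  have hu₂ := h₂.finrank_eq
  have hex : ∀ α : isometricComplements (Q.comp U₁.subtype) (Q.comp U₂.subtype)
      (Q.comp (fixedSpace g₁).subtype), ∃ (β : U₂ →ₗ[F] fixedSpace g₁) (y : V ≃ₗ[F] V),
      Function.Injective β ∧ y ∈ G ∧ ∀ u : U₂, y u = (β u : V) + (α.1 u : V) := by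
    rintro ⟨α, β, hβ, hαβ⟩
    -- As `U₁` is orthogonal to the fixed space of `g₁`, the map `u ↦ β u + α u` is isometric and
    -- Witt's theorem extends it to `V`.
    obtain ⟨ρ, hρ, hρu⟩ := QuadraticForm.exists_isometry_extend h2 Q
      (h₂.polarNondegenerate hQ ((hG g₂).1 hg₂)).1
      ((fixedSpace g₁).subtype ∘ₗ β + U₁.subtype ∘ₗ α) (fun u => by
        have h3 : Q (u : V) = Q (α u : V) + Q (β u : V) := hαβ u
        have h4 : polar Q (α u : V) (β u : V) = 0 :=
          h₁.polar_eq_zero ((hG g₁).1 hg₁) (α u).2 (β u).2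
        change Q ((β u : V) + (α u : V)) = Q (u : V)
        rw [QuadraticMap.map_add Q, polar_comm, h4, h3]
        ring)
    exact ⟨β, ρ, hβ, (hG ρ).2 hρ, hρu⟩
  choose β y hβ hyG hyu using hex
  refine card_mul_card_le_card_stingrayDuos G he hd h₁ h₂ y hyG ?_ ?_
    (ncard_centralizerRestrictions_le_of_isometry h₁ hQ (fun c hc => (hG c).1 hc) hg₁ hm₁)
    (ncard_centralizerRestrictions_le_of_isometry h₂ hQ (fun c hc => (hG c).1 hc) hg₂ hm₂)
  · intro n
    rw [eq_top_iff, ← h₁.isCompl.sup_eq_top]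
    refine sup_le le_sup_left fun f hf => ?_
    -- By dimension `β` is onto `fixedSpace g₁`, so the image of `U₂` complements `U₁`.
    obtain ⟨u, hu⟩ := (LinearMap.injective_iff_surjective_of_finrank_eq_finrank
      (by omega)).1 (hβ n) ⟨f, hf⟩
    have h3 := hyu n u
    rw [hu] at h3
    have h4 : f = -(n.1 u : V) + y n u := by rw [h3]; abel
    rw [h4]
    exact Submodule.add_mem_sup (U₁.neg_mem (Subtype.property _)) ⟨_, Subtype.property _, rfl⟩
  · intro n n' f h _ _ hf _ hfU hhU heq
    have hfF := fixedSpace_map_of_commute hf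
    refine Subtype.ext (LinearMap.ext fun u => ?_)
    have h4 := LinearEquiv.congr_fun heq (u : V)
    rw [hyu, LinearEquiv.mul_apply, LinearEquiv.mul_apply, hhU _ u.2, hyu, map_add,
      hfU _ (Subtype.property _)] at h4
    exact (Subtype.ext (eq_of_add_eq_add h₁.isCompl (Subtype.property _) (Subtype.property _)
      (Subtype.property _) (hfF _ (Subtype.property _)) h4).2).symm

/-- A quadratic estimate for the number of maps `α` for which `QC - QA ∘ α` is isometric
to `QD`. -/
theorem pow_mul_le_ncard_isometricComplements (h2 : (2 : F) ≠ 0) {A C D : Type*}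
    [AddCommGroup A] [Module F A] [FiniteDimensional F A]
    [AddCommGroup C] [Module F C] [FiniteDimensional F C]
    [AddCommGroup D] [Module F D] [FiniteDimensional F D]
    {QA : QuadraticForm F A} {QC : QuadraticForm F C} {QD : QuadraticForm F D}
    (hQA : QA.PolarNondegenerate) (hQC : QC.PolarNondegenerate) (hQD : QD.PolarNondegenerate)
    (hdim : Module.finrank F D = Module.finrank F C) {m n : ℕ} (hm : 1 ≤ m) (hn : 1 ≤ n)
    (hA : Module.finrank F A = 2 * m) (hC : Module.finrank F C = 2 * n) {q : ℝ}
    (hq : q = Nat.card F) (hq3 : 3 ≤ q) :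
    q ^ (4 * m * n) * ((q ^ m - (q - 1)) * ((q - 2) * q ^ m - (q - 1))) ≤
      2 * q * (q ^ m) ^ 2 * (isometricComplements QA QC QD).ncard := by
  have : Finite A := Module.finite_of_finite F
  obtain ⟨k, rfl⟩ : ∃ k, m = k + 1 := ⟨m - 1, by omega⟩
  obtain ⟨l, rfl⟩ : ∃ l, n = l + 1 := ⟨n - 1, by omega⟩
  have hq0 : 0 < q := by linarith
  set c := Nat.card F with hc
  have hc3 : 3 ≤ c := by
    rw [hq] at hq3
    exact_mod_cast hq3
  have hsub : (c - 1) * c ^ k ≤ c ^ (2 * k + 1) := by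
    calc (c - 1) * c ^ k ≤ c * c ^ k := Nat.mul_le_mul_right _ (by omega)
      _ = c ^ (k + 1) := by ring
      _ ≤ c ^ (2 * k + 1) := Nat.pow_le_pow_right (by omega) (by omega)
  have hcount : ∀ R : QuadraticForm F A, R.PolarNondegenerate → ∀ x,
      q ^ (2 * k + 1) - (q - 1) * q ^ k ≤ (({y | R y = x} : Set A).ncard : ℝ) ∧
      (({y | R y = x} : Set A).ncard : ℝ) ≤ q ^ (2 * k + 1) + (q - 1) * q ^ k := by
    intro R hR x
    have := abs_le.1 (abs_card_quadratic_sub_le R hR hA x)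
    rw [← hc, ← hq] at this
    have h5 : q ^ (2 * (k + 1)) = q * q ^ (2 * k + 1) := by ring
    have h6 : q ^ (k + 1) = q * q ^ k := by ring
    rw [h5, h6] at this
    constructor
    · refine le_of_mul_le_mul_left ?_ hq0
      linarith [this.1]
    · refine le_of_mul_le_mul_left ?_ hq0
      linarith [this.2]
  -- `T` and `R` are the Gauss sum bounds `q ^ (2 m - 1) ∓ (q - 1) * q ^ (m - 1)`, with `m = k + 1`.
  obtain ⟨s, hs1, hs2⟩ := card_mul_le_ncard_isometricComplements h2 hQA hQC hQD hdim (by omega)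
    (T := c ^ (2 * k + 1) - (c - 1) * c ^ k) (R := c ^ (2 * k + 1) + (c - 1) * c ^ k)
    (fun R hR x => by
      have := (hcount R hR x).1
      rw [hq] at this
      rw [← Nat.cast_le (α := ℝ), Nat.cast_sub hsub]
      push_cast [Nat.cast_sub (show 1 ≤ c by omega)]
      exact this)
    (fun x => by
      have := (hcount QA hQA x).2
      rw [hq] at this
      refine (Set.ncard_le_ncard (fun y hy => hy.1) (Set.toFinite {y | QA y = x})).trans ?_
      rw [← Nat.cast_le (α := ℝ)]
      push_cast [Nat.cast_sub (show 1 ≤ c by omega)]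
      exact this)
  rw [← hc, hA, hC] at hs1 hs2
  have e1 : 2 * (k + 1) * (2 * (l + 1) - 1) = 2 * (k + 1) * (2 * l + 1) := by congr 1
  have e2 : (2 * (k + 1) - 1) * (2 * (l + 1) - 2) = (2 * k + 1) * (2 * l) := by congr 1
  have e3 : 2 * (l + 1) - 1 = 2 * l + 1 := rfl
  rw [e1] at hs1
  rw [e2, e3] at hs2
  set N := (isometricComplements QA QC QD).ncard
  have hs1' : (q - 1) * (q ^ (2 * k + 1) - (q - 1) * q ^ k) *
      (q ^ (2 * (k + 1) * (2 * l + 1)) - s) ≤ 2 * N := by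
    have h7 : (((c - 1) * (c ^ (2 * k + 1) - (c - 1) * c ^ k) : ℕ) : ℝ) =
        (q - 1) * (q ^ (2 * k + 1) - (q - 1) * q ^ k) := by
      rw [Nat.cast_mul, Nat.cast_sub hsub]
      push_cast [Nat.cast_sub (show 1 ≤ c by omega)]
      rw [hq]
    have h8 : (q ^ (2 * (k + 1) * (2 * l + 1)) - s : ℝ) ≤
        ((c ^ (2 * (k + 1) * (2 * l + 1)) - s : ℕ) : ℝ) := by
      rw [hq, sub_le_iff_le_add]
      exact_mod_cast (le_tsub_add : c ^ (2 * (k + 1) * (2 * l + 1)) ≤ _ - s + s)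
    rw [← h7]
    refine (mul_le_mul_of_nonneg_left h8 (Nat.cast_nonneg _)).trans ?_
    exact_mod_cast hs1
  have hs2' : (q - 1) * s ≤ q ^ ((2 * k + 1) * (2 * l)) * (q ^ (2 * k + 1) + (q - 1) * q ^ k) *
      q ^ (2 * l + 1) := by
    have h9 : (c - 1) * s ≤ c ^ ((2 * k + 1) * (2 * l)) * (c ^ (2 * k + 1) + (c - 1) * c ^ k) *
        c ^ (2 * l + 1) := hs2.trans (Nat.mul_le_mul_left _ (Nat.sub_le _ _))
    rw [← Nat.cast_le (α := ℝ)] at h9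
    push_cast [Nat.cast_sub (show 1 ≤ c by omega)] at h9
    rw [← hq] at h9
    exact h9
  set X := q ^ (2 * (k + 1) * (2 * l + 1)) with hX
  set a := q ^ k with ha
  have ha1 : 1 ≤ a := one_le_pow₀ (by linarith)
  have h10 : q ^ (2 * k + 1) = q * a ^ 2 := by rw [ha]; ring
  have h12 : q ^ (4 * (k + 1) * (l + 1)) = X * (q * a) ^ 2 := by rw [ha, hX]; ring
  have h13 : q ^ (k + 1) = q * a := by rw [ha]; ring
  have hE : q ^ ((2 * k + 1) * (2 * l)) * q ^ (2 * l + 1) * (q * a ^ 2) = X := by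
    rw [ha, hX]; ring
  set E := q ^ ((2 * k + 1) * (2 * l)) * q ^ (2 * l + 1) with hEdef
  rw [h10] at hs1' hs2'
  rw [h12, h13]
  have hEpos : 0 < E := by rw [hEdef]; positivity
  have hs2'' : (q - 1) * s ≤ E * a * (q * a + (q - 1)) := by
    refine hs2'.trans (le_of_eq ?_)
    rw [hEdef]; ring
  have hqa : 0 ≤ q * a - (q - 1) := by nlinarith
  calc X * (q * a) ^ 2 * ((q * a - (q - 1)) * ((q - 2) * (q * a) - (q - 1)))
      = q * (q * a) ^ 2 * (a * (q * a - (q - 1)) * ((q - 1) * X - E * a * (q * a + (q - 1)))) := by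
        rw [← hE]; ring
    _ ≤ q * (q * a) ^ 2 * (a * (q * a - (q - 1)) * ((q - 1) * X - (q - 1) * s)) := by
        gcongr
    _ = q * (q * a) ^ 2 * ((q - 1) * (q * a ^ 2 - (q - 1) * a) * (X - s)) := by ring
    _ ≤ q * (q * a) ^ 2 * (2 * N) := by gcongr
    _ = 2 * q * (q * a) ^ 2 * N := by ring

end OrthogonalDuos

/-! ### Imprimitive duos in linear and orthogonal groups -/

section ImprimitiveCount

variable {F V : Type*} [Field F] [Finite F] [AddCommGroup V] [Module F V] [FiniteDimensional F V]

theorem two_mul_ncard_le_of_linear {r₁ r₂ : ℕ} (hd : Module.finrank F V + 2 = r₁ + r₂)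
    (S : Set ((V ≃ₗ[F] V) × (V ≃ₗ[F] V)))
    (ho : ∀ p ∈ S, orderOf p.1 = r₁ ∧ orderOf p.2 = r₂)
    (hirr : ∀ p ∈ S, ActsIrreducibly (Subgroup.closure {p.1, p.2}))
    (hex : ∀ p ∈ S, ∃ (w : V) (k k' : ℕ) (c : F), IsMarked p.1 p.2 w k k' c) :
    2 * S.ncard ≤ Nat.card (⊤ : Subgroup (V ≃ₗ[F] V)) * ((r₁ - 1) * (r₂ - 1)) := by
  refine two_mul_card_le_of_marked hd ⊤ S ho hirr hex (fun c _ => c)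
    (fun p _ w k k' c hm => hm.c_ne) fun p hp p₀ hp₀ w w₀ k k' c c₀ hm hm₀ hc => ?_
  obtain rfl : c = c₀ := hc
  obtain ⟨x, h1, h2, h3, -⟩ := hm₀.exists_conj hm (ho p₀ hp₀).1 (ho p₀ hp₀).2 (ho p hp).1
    (ho p hp).2 hd (hirr p₀ hp₀) (hirr p hp)
  exact ⟨x, trivial, h1, h2, h3⟩

open QuadraticMap in
-- Applying `Q` to the link gives `c ^ 2 = 1`, hence `c = -1`, and `Q w` takes over as the free
-- parameter. For equal values the conjugating map matches orthogonal bases of equal norms, so it is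
-- an isometry.
theorem two_mul_ncard_le_of_orthogonal (h2 : (2 : F) ≠ 0) {Q : QuadraticForm F V}
    (hQ : Q.PolarNondegenerate) {G : Subgroup (V ≃ₗ[F] V)}
    (hG : ∀ c, c ∈ G ↔ ∀ x, Q (c x) = Q x) {r₁ r₂ : ℕ} (hr₁ : r₁.Prime) (hr5 : 5 ≤ r₁)
    (hr3 : 3 ≤ r₂) (hd : Module.finrank F V + 2 = r₁ + r₂)
    (S : Set ((V ≃ₗ[F] V) × (V ≃ₗ[F] V))) (hSG : ∀ p ∈ S, p.1 ∈ G ∧ p.2 ∈ G)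
    (ho : ∀ p ∈ S, orderOf p.1 = r₁ ∧ orderOf p.2 = r₂)
    (hirr : ∀ p ∈ S, ActsIrreducibly (Subgroup.closure {p.1, p.2}))
    (hex : ∀ p ∈ S, ∃ (w : V) (k k' : ℕ) (c : F), IsMarked p.1 p.2 w k k' c) :
    2 * S.ncard ≤ Nat.card G * ((r₁ - 1) * (r₂ - 1)) := by
  have hpol : ∀ c ∈ G, ∀ x y, Q.polarBilin (c x) (c y) = Q.polarBilin x y := by
    intro c hc x y
    have hc := (hG c).1 hc
    rw [polarBilin_apply_apply, polarBilin_apply_apply, polar, polar, ← map_add, hc, hc, hc]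
  have horth : ∀ p ∈ S, ∀ w k k' c, IsMarked p.1 p.2 w k k' c → ∀ a a', a ≠ a' →
      polar Q (markedFamily p.1 p.2 w r₁ r₂ k' a) (markedFamily p.1 p.2 w r₁ r₂ k' a') = 0 := by
    intro p hp w k k' c hm a a' haa'
    exact hm.orthogonal Q.polarBilin (ho p hp).1 (ho p hp).2 hr₁ hr5 hr3
      (hm.c_ne_one (ho p hp).1 (ho p hp).2 hd (by omega) (hirr p hp))
      (fun x y hxy => by
        rw [polarBilin_apply_apply] at hxy ⊢
        rw [polar_comm, hxy])
      (hpol _ (hSG p hp).1) (hpol _ (hSG p hp).2) a a' haa'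
  have hval : ∀ p ∈ S, ∀ w k' a, Q (markedFamily p.1 p.2 w r₁ r₂ k' a) = Q w := by
    intro p hp w k' a
    rcases a with a | a
    · exact (hG _).1 (G.zpow_mem (hSG p hp).1 _) w
    · exact (hG _).1 (G.zpow_mem (hSG p hp).2 _) w
  have hne : ∀ p ∈ S, ∀ w k k' c, IsMarked p.1 p.2 w k k' c → Q w ≠ 0 := by
    intro p hp w k k' c hm h0
    obtain ⟨b, hb⟩ := hm.exists_basis (ho p hp).1 (ho p hp).2 hd (hirr p hp)
    have a : MarkedIndex r₁ r₂ k' := Sum.inl ⟨0, hr₁.pos⟩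
    apply b.ne_zero a
    refine hQ _ fun y => ?_
    rw [← polarBilin_apply_apply, ← b.sum_repr y, map_sum]
    refine Finset.sum_eq_zero fun a' _ => ?_
    rw [map_smul, polarBilin_apply_apply, hb]
    by_cases h : a = a'
    · rw [← h, QuadraticForm.polar_self_eq, hval p hp, h0, mul_zero, smul_zero]
    · rw [horth p hp w k k' c hm a a' h, smul_zero]
  have hneg : ∀ p ∈ S, ∀ w k k' c, IsMarked p.1 p.2 w k k' c → c = -1 := by
    intro p hp w k k' c hm
    have h3 := congrArg Q hm.link
    rw [QuadraticMap.map_smul, (hG _).1 (G.zpow_mem (hSG p hp).1 _),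
      (hG _).1 (G.zpow_mem (hSG p hp).2 _), smul_eq_mul] at h3
    have h4 : c * c = 1 := mul_right_cancel₀ (hne p hp w k k' c hm) (by rw [one_mul]; exact h3.symm)
    exact (mul_self_eq_one_iff.1 h4).resolve_left
      (hm.c_ne_one (ho p hp).1 (ho p hp).2 hd (by omega) (hirr p hp))
  refine two_mul_card_le_of_marked hd G S ho hirr hex (fun _ w => Q w) hne
    fun p hp p₀ hp₀ w w₀ k k' c c₀ hm hm₀ hw => ?_
  obtain rfl := hneg p hp w k k' c hm
  obtain rfl := hneg p₀ hp₀ w₀ k k' c₀ hm₀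
  obtain ⟨x, h3, h4, h5, hx⟩ := hm₀.exists_conj hm (ho p₀ hp₀).1 (ho p₀ hp₀).2 (ho p hp).1
    (ho p hp).2 hd (hirr p₀ hp₀) (hirr p hp)
  refine ⟨x, (hG x).2 fun v => ?_, h3, h4, h5⟩
  obtain ⟨b, hb⟩ := hm₀.exists_basis (ho p₀ hp₀).1 (ho p₀ hp₀).2 hd (hirr p₀ hp₀)
  have hB : Q.polarBilin.compl₁₂ (x : V →ₗ[F] V) (x : V →ₗ[F] V) = Q.polarBilin := by
    refine b.ext fun a => b.ext fun a' => ?_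
    rw [LinearMap.compl₁₂_apply, polarBilin_apply_apply, polarBilin_apply_apply, hb]
    change polar Q (x _) (x _) = _
    rw [hx, hx]
    by_cases h : a = a'
    · rw [← h, QuadraticForm.polar_self_eq, QuadraticForm.polar_self_eq, hval p hp, hval p₀ hp₀]
      exact congrArg _ hw
    · rw [horth p hp _ _ _ _ hm a a' h, horth p₀ hp₀ _ _ _ _ hm₀ a a' h]
  have h6 : polar Q (x v) (x v) = polar Q v v := LinearMap.congr_fun (LinearMap.congr_fun hB v) v
  rw [QuadraticForm.polar_self_eq, QuadraticForm.polar_self_eq] at h6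
  exact mul_left_cancel₀ h2 h6

end ImprimitiveCount

/-! ### Numerical estimates -/

section Estimates

/-- The case `q = 3` needs the constant: at `a = 27`, `b = 9` the quotient of the sides without 4.12
is 4.032. -/
theorem orthogonal_estimate_of_eq_three {a b : ℝ} (ha : 27 ≤ a) (hb : 9 ≤ b) :
    (a + 1) * (b + 1) * 3 * a < 4.12 * b * ((a - (3 - 1)) * ((3 - 2) * a - (3 - 1))) := by
  have h1 : (a + 1) * (b + 1) * 3 * a ≤ (a + 1) * (10 / 9 * b) * 3 * a := by
    gcongr
    linarith
  refine h1.trans_lt ?_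
  have h2 : 0 < 4.12 * ((a - 2) * (a - 2)) - (a + 1) * (10 / 9) * 3 * a := by nlinarith
  nlinarith

theorem orthogonal_estimate_of_five_le {q a b : ℝ} (hq : 5 ≤ q) (ha : q ^ 3 ≤ a) (hb : q ≤ b) :
    (a + 1) * (b + 1) * q * a < 4.12 * b * ((a - (q - 1)) * ((q - 2) * a - (q - 1))) := by
  have hq0 : 0 < q := by linarith
  have hb0 : 0 < b := by linarith
  have hqa : 25 * q ≤ a := by
    have : 25 ≤ q ^ 2 := by nlinarith
    nlinarith
  have ha0 : 0 < a := by linarith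
  -- From `a ≥ 125`, `b ≥ 5` and `25 * q ≤ a`: `1.008 = 1 + 1/125`, `1.2 = 1 + 1/5`, `0.96 = 1 -
  -- 1/25` and `0.592 = 3/5 - 1/125`.
  have h1 : (a + 1) * (b + 1) * q * a ≤ (1.008 * a) * (1.2 * b) * q * a := by
    gcongr
    · linarith
    · linarith
  have h3 : 4.12 * b * ((0.96 * a) * (0.592 * q * a)) ≤
      4.12 * b * ((a - (q - 1)) * ((q - 2) * a - (q - 1))) := by
    have : 0.592 * q * a ≤ (q - 2) * a - (q - 1) := by nlinarith
    have : 0.96 * a ≤ a - (q - 1) := by linarith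
    gcongr
    linarith
  refine h1.trans_lt (lt_of_lt_of_le ?_ h3)
  have : 0 < b * (a * (q * a)) := by positivity
  nlinarith

end Estimates

theorem two_ne_zero_of_odd_card {F : Type*} [Field F] [Finite F] (h : Odd (Nat.card F)) :
    (2 : F) ≠ 0 := by
  have := Fintype.ofFinite F
  refine Ring.two_ne_zero fun h2 => ?_
  rw [FiniteField.even_card_iff_char_two, ← Nat.card_eq_fintype_card] at h2
  exact Nat.not_even_iff_odd.2 h (Nat.even_iff.2 h2)

/-! ### Bounds for the proportion -/

section Proportion

variable {F V : Type*} [Field F] [Finite F] [AddCommGroup V] [Module F V] [FiniteDimensional F V]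

/-- An upper bound for the proportion of the imprimitive duos, from an upper bound for their number
and a lower bound for the number of all duos. -/
theorem prob₂_le {G : Subgroup (V ≃ₗ[F] V)} {e₁ e₂ : ℕ} {g₁ g₂ : V ≃ₗ[F] V} {E N z : ℕ}
    (hI : 2 * (imprimitiveDuos G e₁ e₂ g₁ g₂).ncard ≤ Nat.card G * E)
    (hD : Nat.card G * N ≤ z * (stingrayDuos G e₁ e₂ g₁ g₂).ncard) (hN : 0 < N) :
    prob₂ G e₁ e₂ g₁ g₂ ≤ E * z / (2 * N) := by
  have : Finite V := Module.finite_of_finite F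
  have : Finite (V ≃ₗ[F] V) := finite_linearEquiv
  have hG : 0 < Nat.card G := Nat.card_pos
  have hD0 : 0 < (stingrayDuos G e₁ e₂ g₁ g₂).ncard :=
    Nat.pos_of_mul_pos_left (lt_of_lt_of_le (Nat.mul_pos hG hN) hD)
  unfold prob₂
  rw [div_le_div_iff₀ (by exact_mod_cast hD0) (by positivity)]
  have h : (imprimitiveDuos G e₁ e₂ g₁ g₂).ncard * (2 * N) ≤
      E * z * (stingrayDuos G e₁ e₂ g₁ g₂).ncard := by
    calc (imprimitiveDuos G e₁ e₂ g₁ g₂).ncard * (2 * N)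
        = 2 * (imprimitiveDuos G e₁ e₂ g₁ g₂).ncard * N := by ring
      _ ≤ Nat.card G * E * N := Nat.mul_le_mul_right _ hI
      _ = E * (Nat.card G * N) := by ring
      _ ≤ E * (z * (stingrayDuos G e₁ e₂ g₁ g₂).ncard) := Nat.mul_le_mul_left _ hD
      _ = _ := by ring
  exact_mod_cast h

theorem prob₂_linear_lt {e₁ e₂ : ℕ} (he₂ : 1 ≤ e₂) (he : e₂ ≤ e₁)
    (hd : e₁ + e₂ = Module.finrank F V) {g₁ g₂ : V ≃ₗ[F] V} (hs₁ : IsStingray e₁ g₁)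
    (hs₂ : IsStingray e₂ g₂)
    (hI : 2 * (imprimitiveDuos (⊤ : Subgroup (V ≃ₗ[F] V)) e₁ e₂ g₁ g₂).ncard ≤
      Nat.card (⊤ : Subgroup (V ≃ₗ[F] V)) * (e₁ * e₂)) :
    prob₂ (⊤ : Subgroup (V ≃ₗ[F] V)) e₁ e₂ g₁ g₂ <
      0.5 * (e₁ * e₂ : ℝ) * (Nat.card F : ℝ) ^ (-2 * (e₁ * e₂ : ℝ) + e₁ + e₂) := by
  obtain ⟨U₁, h₁⟩ := hs₁
  obtain ⟨U₂, h₂⟩ := hs₂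
  have hq : 1 < Nat.card F := Finite.one_lt_card
  have hle := prob₂_le hI (card_stingrayDuos_linear he hd h₁ h₂) (Nat.pow_pos (by omega))
  refine hle.trans_lt ?_
  set q := Nat.card F
  have hq0 : (0 : ℝ) < q := by exact_mod_cast (by omega : 0 < q)
  have hexp : (q : ℝ) ^ (-2 * (e₁ * e₂ : ℝ) + e₁ + e₂) =
      (q : ℝ) ^ e₁ * (q : ℝ) ^ e₂ / (q : ℝ) ^ (2 * (e₁ * e₂)) := by
    rw [Real.rpow_add hq0, Real.rpow_add hq0, Real.rpow_natCast, Real.rpow_natCast, neg_mul,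
      Real.rpow_neg hq0.le, ← Real.rpow_natCast (q : ℝ) (2 * (e₁ * e₂))]
    push_cast
    field_simp
  have hz : (((q ^ e₁ - 1) * (q ^ e₂ - 1) : ℕ) : ℝ) < (q : ℝ) ^ e₁ * (q : ℝ) ^ e₂ := by
    have h3 : ∀ e, q ^ e - 1 < q ^ e := fun e => Nat.sub_lt (Nat.pow_pos (by omega)) one_pos
    exact_mod_cast Nat.mul_lt_mul'' (h3 e₁) (h3 e₂)
  have hE : (0 : ℝ) < e₁ * e₂ := by
    have : 0 < e₁ * e₂ := Nat.mul_pos (by omega) (by omega)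
    exact_mod_cast this
  have hY : (0 : ℝ) < (q : ℝ) ^ (2 * (e₁ * e₂)) := by positivity
  rw [hexp, Nat.cast_mul e₁ e₂, Nat.cast_pow q (2 * (e₁ * e₂))]
  calc (e₁ * e₂ : ℝ) * (((q ^ e₁ - 1) * (q ^ e₂ - 1) : ℕ) : ℝ) / (2 * (q : ℝ) ^ (2 * (e₁ * e₂)))
      < (e₁ * e₂ : ℝ) * ((q : ℝ) ^ e₁ * (q : ℝ) ^ e₂) / (2 * (q : ℝ) ^ (2 * (e₁ * e₂))) := by
        gcongr
    _ = _ := by ring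

/-- The power of `q` in the bound is `a * b / q ^ (4 m₁ m₂)` with `a = q ^ m₁`, `b = q ^ m₂`. The
constant absorbs the excess of `(a + 1) * (b + 1)` over `a * b` and the shortfall in the lower bound
for the number of representatives. -/
theorem prob₂_orthogonal_lt {Q : QuadraticForm F V} (hQ : Q.PolarNondegenerate)
    {G : Subgroup (V ≃ₗ[F] V)} (hG : ∀ c, c ∈ G ↔ ∀ x, Q (c x) = Q x) {m₁ m₂ : ℕ}
    (hm₂ : 1 ≤ m₂) (hm : m₂ ≤ m₁) (hm₁ : 3 ≤ m₁) (hd : 2 * m₁ + 2 * m₂ = Module.finrank F V)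
    {g₁ g₂ : V ≃ₗ[F] V} (hg₁ : g₁ ∈ G) (hg₂ : g₂ ∈ G) (hs₁ : IsStingray (2 * m₁) g₁)
    (hs₂ : IsStingray (2 * m₂) g₂) (ho₁ : orderOf g₁ ∣ Nat.card F ^ m₁ + 1)
    (ho₂ : orderOf g₂ ∣ Nat.card F ^ m₂ + 1) (hodd : Odd (Nat.card F))
    (h3 : Nat.card F = 3 → 2 ≤ m₂)
    (hI : 2 * (imprimitiveDuos G (2 * m₁) (2 * m₂) g₁ g₂).ncard ≤
      Nat.card G * ((2 * m₁) * (2 * m₂))) :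
    prob₂ G (2 * m₁) (2 * m₂) g₁ g₂ <
      4.12 * (((2 * m₁ : ℕ) : ℝ) * ((2 * m₂ : ℕ) : ℝ)) * (Nat.card F : ℝ) ^
        (-(((2 * m₁ : ℕ) : ℝ) * ((2 * m₂ : ℕ) : ℝ)) +
          (((2 * m₁ : ℕ) : ℝ) + ((2 * m₂ : ℕ) : ℝ)) / 2) := by
  obtain ⟨U₁, h₁⟩ := hs₁
  obtain ⟨U₂, h₂⟩ := hs₂
  have hq1 : 1 < Nat.card F := Finite.one_lt_card
  have h2 : (2 : F) ≠ 0 := two_ne_zero_of_odd_card hodd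
  have hf₁ := h₁.finrank_fixedSpace
  obtain ⟨hA, hD⟩ := h₁.polarNondegenerate hQ ((hG g₁).1 hg₁)
  have hC := (h₂.polarNondegenerate hQ ((hG g₂).1 hg₂)).1
  have hduos := card_mul_ncard_isometricComplements_le h2 hQ hG (by omega) hd hg₁ hg₂ h₁ h₂ ho₁ ho₂
  have hc3 : 3 ≤ Nat.card F := by
    obtain ⟨t, ht⟩ := hodd
    omega
  have hN := pow_mul_le_ncard_isometricComplements h2 hA hC hD
    (by rw [h₂.finrank_eq]; omega) (by omega) hm₂ h₁.finrank_eq h₂.finrank_eq rfl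
    (by exact_mod_cast hc3)
  set N := (isometricComplements (Q.comp U₁.subtype) (Q.comp U₂.subtype)
    (Q.comp (fixedSpace g₁).subtype)).ncard
  set c := Nat.card F
  set q : ℝ := (c : ℝ) with hq
  have hq3 : 3 ≤ q := by rw [hq]; exact_mod_cast hc3
  have hq0 : 0 < q := by linarith
  set P := (q ^ m₁ - (q - 1)) * ((q - 2) * q ^ m₁ - (q - 1)) with hP
  have hest : (q ^ m₁ + 1) * (q ^ m₂ + 1) * q * q ^ m₁ < 4.12 * q ^ m₂ * P := by
    rcases hodd with ⟨t, ht⟩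
    by_cases hc : c = 3
    · have hq' : q = 3 := by rw [hq, hc]; norm_num
      have ha : (27 : ℝ) ≤ q ^ m₁ := by
        rw [hq']
        calc (27 : ℝ) = 3 ^ 3 := by norm_num
          _ ≤ 3 ^ m₁ := pow_le_pow_right₀ (by norm_num) hm₁
      have hb : (9 : ℝ) ≤ q ^ m₂ := by
        rw [hq']
        calc (9 : ℝ) = 3 ^ 2 := by norm_num
          _ ≤ 3 ^ m₂ := pow_le_pow_right₀ (by norm_num) (h3 hc)
      have := orthogonal_estimate_of_eq_three ha hb
      rw [← hq'] at this
      rw [hP]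
      exact this
    · have hq5 : 5 ≤ q := by
        rw [hq]
        exact_mod_cast (by omega : 5 ≤ c)
      exact orthogonal_estimate_of_five_le hq5 (pow_le_pow_right₀ (by linarith) hm₁)
        (le_self_pow₀ (by linarith) (by omega))
  set a := q ^ m₁ with ha
  set b := q ^ m₂ with hb
  have ha0 : 0 < a := by rw [ha]; positivity
  have hb0 : 0 < b := by rw [hb]; positivity
  set Y := q ^ (4 * m₁ * m₂) with hY
  have hY0 : 0 < Y := by rw [hY]; positivity
  have hP0 : 0 < P := by
    have : 0 < 4.12 * b * P := lt_trans (by positivity) hest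
    exact pos_of_mul_pos_right this (by positivity)
  have hN0 : (0 : ℝ) < N := by
    have : 0 < 2 * q * a ^ 2 * N := lt_of_lt_of_le (by positivity) hN
    exact pos_of_mul_pos_right this (by positivity)
  have hle := prob₂_le hI hduos (by exact_mod_cast hN0)
  refine hle.trans_lt ?_
  have hexp : q ^ (-(((2 * m₁ : ℕ) : ℝ) * ((2 * m₂ : ℕ) : ℝ)) +
      (((2 * m₁ : ℕ) : ℝ) + ((2 * m₂ : ℕ) : ℝ)) / 2) = a * b / Y := by
    have h4 : -(((2 * m₁ : ℕ) : ℝ) * ((2 * m₂ : ℕ) : ℝ)) +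
        (((2 * m₁ : ℕ) : ℝ) + ((2 * m₂ : ℕ) : ℝ)) / 2 =
        (m₁ : ℝ) + m₂ - ((4 * m₁ * m₂ : ℕ) : ℝ) := by
      push_cast
      ring
    rw [h4, Real.rpow_sub hq0, Real.rpow_add hq0, Real.rpow_natCast, Real.rpow_natCast,
      Real.rpow_natCast]
  have hkey : (a + 1) * (b + 1) * Y < 8.24 * a * b * N := by
    refine lt_of_mul_lt_mul_right ?_ (mul_pos hq0 ha0).le
    calc (a + 1) * (b + 1) * Y * (q * a) = ((a + 1) * (b + 1) * q * a) * Y := by ring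
      _ < 4.12 * b * P * Y := by gcongr
      _ = 4.12 * b * (Y * P) := by ring
      _ ≤ 4.12 * b * (2 * q * a ^ 2 * N) := by gcongr
      _ = 8.24 * a * b * N * (q * a) := by ring
  have hz : (((c ^ m₁ + 1) * (c ^ m₂ + 1) : ℕ) : ℝ) = (a + 1) * (b + 1) := by
    push_cast
    rfl
  have hE : (0 : ℝ) < ((2 * m₁ : ℕ) : ℝ) * ((2 * m₂ : ℕ) : ℝ) := by
    have : 0 < (2 * m₁) * (2 * m₂) := Nat.mul_pos (by omega) (by omega)
    exact_mod_cast this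
  rw [hexp, hz, Nat.cast_mul (2 * m₁) (2 * m₂)]
  set E := ((2 * m₁ : ℕ) : ℝ) * ((2 * m₂ : ℕ) : ℝ)
  rw [div_lt_iff₀ (by positivity)]
  calc E * ((a + 1) * (b + 1)) = E * ((a + 1) * (b + 1) * Y) / Y := by field_simp
    _ < E * (8.24 * a * b * N) / Y := by gcongr
    _ = 4.12 * E * (a * b / Y) * (2 * N) := by
      ring

end Proportion

/-! ### The main theorem -/

theorem proposition6p1 {F V : Type*} [Field F] [Finite F] [AddCommGroup V] [Module F V]
    [FiniteDimensional F V]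
    (Φ : ClassicalForm F V) (q : ℕ) (hΦ : Φ.IsClassical q)
    (e₁ e₂ r₁ r₂ : ℕ)
    (he₂ : 2 ≤ e₂) (he : e₂ ≤ e₁)
    (hd : Module.finrank F V = e₁ + e₂) (hd8 : 8 < e₁ + e₂)
    (hr₁ : IsPrimitivePrimeDivisor r₁ (q ^ Φ.type.u) e₁)
    (hr₂ : IsPrimitivePrimeDivisor r₂ (q ^ Φ.type.u) e₂)
    (g₁ g₂ : V ≃ₗ[F] V)
    (hg₁ : g₁ ∈ Φ.isometryGroup) (hg₂ : g₂ ∈ Φ.isometryGroup)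
    (hs₁ : IsStingray e₁ g₁) (hs₂ : IsStingray e₂ g₂)
    (ho₁ : orderOf g₁ = r₁) (ho₂ : orderOf g₂ = r₂) :
    -- the excluded cases
    (ImprimitiveExcluded Φ.type q e₁ e₂ r₁ r₂ →
      prob₂ Φ.isometryGroup e₁ e₂ g₁ g₂ = 0) ∧
    -- the remaining cases
    (¬ ImprimitiveExcluded Φ.type q e₁ e₂ r₁ r₂ →
      2 < q ^ Φ.type.u ∧
      (r₁ = e₁ + 1 ∧ 3 ≤ r₁) ∧ (r₂ = e₂ + 1 ∧ 3 ≤ r₂) ∧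
      Even (e₁ + e₂) ∧
      (Φ.type = .L →
        prob₂ Φ.isometryGroup e₁ e₂ g₁ g₂ <
          0.5 * (e₁ * e₂ : ℝ) * (q : ℝ) ^ (-2 * (e₁ * e₂ : ℝ) + e₁ + e₂)) ∧
      (Φ.type = .U →
        prob₂ Φ.isometryGroup e₁ e₂ g₁ g₂ <
          1.46 * (e₁ * e₂ : ℝ) * (q : ℝ) ^ (-2 * (e₁ * e₂ : ℝ) + e₁ + e₂)) ∧
      (∀ ε : ℤˣ, Φ.type = .O ε →
        Odd q ∧
        prob₂ Φ.isometryGroup e₁ e₂ g₁ g₂ <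
          4.12 * (e₁ * e₂ : ℝ) * (q : ℝ) ^ (-(e₁ * e₂ : ℝ) + ((e₁ : ℝ) + e₂) / 2))) ∧
    -- the family of overgroups accounts for exactly the duos counted by `prob₂`
    imprimitiveDuos Φ.isometryGroup e₁ e₂ g₁ g₂ =
      (⋃ M ∈ imprimitiveSubgroups Φ q e₁ e₂ r₁ r₂,
        {p ∈ irreducibleDuos Φ.isometryGroup e₁ e₂ g₁ g₂ | Subgroup.closure {p.1, p.2} ≤ M}) ∧
    -- only decompositions into `d` (non-degenerate) one-dimensional summands occur
    (∀ p ∈ irreducibleDuos Φ.isometryGroup e₁ e₂ g₁ g₂,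
      ∀ (b : ℕ) (W : Fin b → Submodule F V), 2 ≤ b → IsDirectDecomposition W →
        Subgroup.closure {p.1, p.2} ≤ decompositionStabilizer W →
        b = e₁ + e₂ ∧ (∀ i, Module.finrank F (W i) = 1) ∧ ∀ i, Φ.NondegenerateOn (W i)) := by
  have hcard := hΦ.card_eq
  have hF : 1 < Nat.card F := Finite.one_lt_card
  have hN : 1 ≤ q ^ Φ.type.u := by omega
  have hstruct : ∀ p ∈ imprimitiveDuos Φ.isometryGroup e₁ e₂ g₁ g₂, ∃ (b : ℕ)
      (W : Fin b → Submodule F V), IsDirectDecomposition W ∧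
      Subgroup.closure {p.1, p.2} ≤ decompositionStabilizer W ∧ (b = e₁ + e₂ ∧
      (∀ i, Module.finrank F (W i) = 1) ∧ ∀ i, Φ.NondegenerateOn (W i)) ∧
      ¬ ImprimitiveExcluded Φ.type q e₁ e₂ r₁ r₂ ∧
      ∃ (w : V) (k k' : ℕ) (c : F), IsMarked p.1 p.2 w k k' c := by
    rintro p ⟨hp, b, W, hb, hW, hstab⟩
    obtain ⟨-, h1, h2, w, k, k', c, -, hm⟩ :=
      imprimitive_structure hΦ he₂ he hd hd8 hr₁ hr₂ hg₁ hg₂ ho₁ ho₂ hp hb hW hstab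
    exact ⟨b, W, hW, hstab, h1, h2, w, k, k', c, hm⟩
  have hmem : ∀ p ∈ imprimitiveDuos Φ.isometryGroup e₁ e₂ g₁ g₂,
      (p.1 ∈ Φ.isometryGroup ∧ p.2 ∈ Φ.isometryGroup) ∧ orderOf p.1 = r₁ ∧ orderOf p.2 = r₂ := by
    rintro p ⟨⟨⟨hp1, hp2, -⟩, -⟩, -⟩
    obtain ⟨h1, h2⟩ := conjClass_subset hg₁ hp1
    obtain ⟨h3, h4⟩ := conjClass_subset hg₂ hp2
    exact ⟨⟨h1, h3⟩, h2.trans ho₁, h4.trans ho₂⟩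
  have hirr : ∀ p ∈ imprimitiveDuos Φ.isometryGroup e₁ e₂ g₁ g₂,
      ActsIrreducibly (Subgroup.closure {p.1, p.2}) := fun p hp => hp.1.2
  have hmark : ∀ p ∈ imprimitiveDuos Φ.isometryGroup e₁ e₂ g₁ g₂,
      ∃ (w : V) (k k' : ℕ) (c : F), IsMarked p.1 p.2 w k k' c := fun p hp => by
    obtain ⟨b, W, -, -, -, -, h⟩ := hstruct p hp
    exact h
  refine ⟨fun hex => ?_, fun hex => ?_, ?_, ?_⟩
  · have h0 : imprimitiveDuos Φ.isometryGroup e₁ e₂ g₁ g₂ = ∅ := by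
      rw [Set.eq_empty_iff_forall_notMem]
      intro p hp
      obtain ⟨b, W, -, -, -, h, -⟩ := hstruct p hp
      exact h hex
    rw [prob₂, h0, Set.ncard_empty, Nat.cast_zero, zero_div]
  · have hex' := hex
    simp only [ImprimitiveExcluded, not_or, not_and] at hex'
    obtain ⟨⟨-, hodd⟩, h2, ⟨hle₁, hle₂⟩, heven⟩ := hex'
    have hre₁ : r₁ = e₁ + 1 := le_antisymm (not_lt.1 hle₁) (hr₁.succ_le hN (by omega))
    have hre₂ : r₂ = e₂ + 1 := le_antisymm (not_lt.1 hle₂) (hr₂.succ_le hN (by omega))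
    have hdr : Module.finrank F V + 2 = r₁ + r₂ := by omega
    refine ⟨by omega, ⟨hre₁, by omega⟩, ⟨hre₂, by omega⟩, Nat.not_odd_iff_even.1 heven, ?_, ?_, ?_⟩
    · intro hL
      cases Φ with
      | unitary σ B => exact ClassicalType.noConfusion hL
      | symplectic B => exact ClassicalType.noConfusion hL
      | orthogonal ε Q => exact ClassicalType.noConfusion hL
      | linear =>
        have hq : Nat.card F = q := hΦ
        have htop : (ClassicalForm.linear : ClassicalForm F V).isometryGroup = ⊤ :=
          Subgroup.ext fun x => iff_of_true trivial trivial
        rw [htop] at *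
        rw [← hq]
        refine prob₂_linear_lt (by omega) he hd.symm hs₁ hs₂ ?_
        have := two_mul_ncard_le_of_linear hdr _ (fun p hp => (hmem p hp).2) hirr hmark
        rwa [hre₁, hre₂] at this
    -- A unitary duo is never outside the excluded cases, so this bound holds vacuously.
    · intro hU
      rw [hU] at hr₁
      have hq1 : 1 ≤ q := by
        rw [hU] at hN
        exact Nat.pos_of_ne_zero fun h => by simp [h, ClassicalType.u] at hN
      exact absurd hre₁ (hr₁.ne_succ_of_sq hq1 (by omega))
    · intro ε hO
      have hqodd : Odd q := Nat.not_even_iff_odd.1 (hodd ⟨ε, hO⟩)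
      refine ⟨hqodd, ?_⟩
      cases Φ with
      | unitary σ B => exact ClassicalType.noConfusion hO
      | symplectic B => exact ClassicalType.noConfusion hO
      | linear => exact ClassicalType.noConfusion hO
      | orthogonal ε' Q =>
        obtain ⟨hq, -, hnd, -⟩ := hΦ
        have hQ : Q.PolarNondegenerate := fun x hx => hnd x trivial fun y _ => hx y
        have hu : q ^ (ClassicalForm.orthogonal ε' Q).type.u = q := pow_one q
        rw [hu] at hr₁ hr₂
        obtain ⟨m₁, hm₁⟩ := even_iff_two_dvd.1 (hr₁.even_of_eq_succ (by omega) hre₁)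
        obtain ⟨m₂, hm₂⟩ := even_iff_two_dvd.1 (hr₂.even_of_eq_succ (by omega) hre₂)
        subst hm₁ hm₂
        have hG : ∀ c : V ≃ₗ[F] V, c ∈ (ClassicalForm.orthogonal ε' Q).isometryGroup ↔
            ∀ x, Q (c x) = Q x := fun c => Iff.rfl
        rw [← hq] at hr₁ hr₂ hqodd ⊢
        -- From `2 * m₁ + 2 * m₂ > 8` and `m₂ ≤ m₁` one gets `3 ≤ m₁`.
        refine prob₂_orthogonal_lt hQ hG (by omega) (by omega) (by omega) hd.symm hg₁ hg₂ hs₁ hs₂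
          (ho₁ ▸ hr₁.dvd_pow_half_add_one (by omega)) (ho₂ ▸ hr₂.dvd_pow_half_add_one (by omega))
          hqodd (fun h3 => ?_) ?_
        -- If `|F| = 3` and `m₂ = 1`, then `r₂ = 3` would divide `|F|`.
        · by_contra hlt
          have h4 := hr₂.not_dvd_base (by omega) (by omega)
          rw [h3, hre₂, show m₂ = 1 by omega] at h4
          exact h4 (by norm_num)
        · have := two_mul_ncard_le_of_orthogonal (two_ne_zero_of_odd_card hqodd) hQ hG hr₁.1
            (by omega) (by omega) hdr _ (fun p hp => (hmem p hp).1) (fun p hp => (hmem p hp).2) hirr hmark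
          rwa [hre₁, hre₂] at this
  · ext p
    simp only [Set.mem_iUnion, exists_prop]
    constructor
    · intro hp
      obtain ⟨b, W, hW, hstab, ⟨hb, hdim, hnd⟩, hex, -⟩ := hstruct p hp
      obtain rfl : b = Module.finrank F V := hb.trans hd.symm
      refine ⟨_, ⟨hex, W, hW, hdim, hnd, rfl⟩, hp.1, le_inf ?_ hstab⟩
      rw [Subgroup.closure_le]
      rintro x (rfl | rfl)
      · exact (hmem p hp).1.1
      · exact (hmem p hp).1.2
    · rintro ⟨M, ⟨-, W, hW, -, -, rfl⟩, hp, hle⟩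
      exact ⟨hp, _, W, by omega, hW, hle.trans inf_le_right⟩
  · intro p hp b W hb hW hstab
    exact (imprimitive_structure hΦ he₂ he hd hd8 hr₁ hr₂ hg₁ hg₂ ho₁ ho₂ hp hb hW hstab).2.1
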